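/- \textbf{Foams.} A (closed) foam $F$ is a finite two-dimensional polyhedron PL-embedded in $\mathbb R^3$ (given by a triangulation in which all the structure below is a subcomplex) in which the link of every point is a circle (regular points), a theta graph (seam points) or the complete graph $K_4$ (singular vertices). Let $s(F)$ be the union of the seam points and singular vertices. The \emph{facets} are the connected components of $F\setminus s(F)$; every facet $f$ has a thickness $\mathrm{th}(f)\in\{1,2\}$, and the three sheets at a seam point have thicknesses $1,1,2$ (type $112$) or $2,2,2$ (type $222$). Hence at a singular vertex $2$, $3$ or $6$ of the six sheets are thick (types $1^42^2$, $1^32^3$, $2^6$). A \emph{seam} is a connected component of $s(F)$ minus the singular vertices; it is a circle or an open interval (a \emph{seam interval}). Moreover $F$ carries: \emph{defect lines}, closed PL curves in the closure of the thick facets in general position with respect to $s(F)$ (they meet $s(F)$ in finitely many points, possibly singular vertices, and there cross from one sheet into another); finitely many \emph{dots} in the \emph{regions} (the components of $F$ minus $s(F)$ and the defect lines), each labelled by a symmetric polynomial over $\mathbb F_2$ in as many variables as the thickness of the region, the variables having degree $2$; and a \emph{Kempe-specification}, that is, a map from the singular vertices of type $2^6$ to $\{\diamond,\triangle\}$. \textbf{Degree.}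 With $\chi$ the Euler characteristic, \begin{align*} \deg(F)={}&\sum_{\text{dots}}\deg(\text{label})-3\sum_{\mathrm{th}(f)=1}\chi(f)-4\sum_{\mathrm{th}(f)=2}\chi(f)\\ &+5\,\#\{\text{seam intervals of type }112\}+6\,\#\{\text{seam intervals of type }222\}\\ &-6\,\#\{\text{singular vertices of type }2^6\text{ or }1^32^3\}\\ &-5\,\#\{\text{singular vertices of type }1^42^2\text{ with an even number of defect lines going through}\}\\ &-6\,\#\{\text{singular vertices of type }1^42^2\text{ with an odd number of defect lines going through}\}, \end{align*} where $f$ runs over the facets. \textbf{Colorings.} A coloring $c$ of $F$ assigns to every region $r$ a subset $c(r)\subseteq\{1,2,3,4\}$ with $|c(r)|=\mathrm{th}(r)$ such that: at a seam of type $112$ the color of the thick region is the disjoint union of the colors of the two thin ones; at a seam of type $222$ the three colors are the three two-element subsets of a three-element set; the colors on the two sides of a defect line are complementary; and at a singular vertex of type $2^6$ that lies on no defect line, opposite sheets have equal colors if the vertex is marked $\triangle$, and complementary colors if it is marked $\diamond$. For $i<j$ let $F_{ij}(c)$ be the closed surface formed by the closures of the regions $r$ with $|c(r)\cap\{i,j\}|=1$.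 \textbf{Lemma.} Let $F$ be a foam that admits a coloring $c$. If $F$ carries no dots, then $$\deg(F)=-\sum_{1\le i<j\le 4}\chi(F_{ij}(c)).$$ Moreover $\deg(F)$ is even (with or without dots). -/

import Mathlib

/-!
Unoriented SL(4) foams, as finite simplicial complexes in three-space.

A closed foam is a PL-embedded compact polyhedron in `ℝ³` with prescribed local models. It is given
here by a triangulation in which the seams, the singular vertices and the defect lines are
subcomplexes; faces are recorded, as in `Geometry.SimplicialComplex`, by their finite sets of
corners, so that triangles, edges and vertices are faces with 3, 2 and 1 elements.
-/

namespace SL4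

/-- Euclidean three-space. -/
abbrev E3 : Type := EuclideanSpace ℝ (Fin 3)

/-- Simplicial complexes in three-space. -/
abbrev Cplx : Type := Geometry.SimplicialComplex ℝ E3

/-- The Euler characteristic of a union of open simplices, the alternating sum of the numbers of
simplices. For a subcomplex this is the usual Euler characteristic. For an open surface that is the
interior of a compact surface with boundary it is also the usual one, because the missing boundary
consists of circles, whose Euler characteristic vanishes. -/
noncomputable def eulerChar (S : Set (Finset E3)) : ℤ :=
  ∑ᶠ s ∈ S, (-1 : ℤ) ^ (s.card + 1)

/-- The triangles of a complex. -/
def Tri (K : Cplx) : Type := {t : Finset E3 // t ∈ K.faces ∧ t.card = 3}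

/-- The edges of a complex. -/
def edges (K : Cplx) : Set (Finset E3) := {e | e ∈ K.faces ∧ e.card = 2}

/-- The triangles which contain a given face. -/
def trisOn (K : Cplx) (s : Finset E3) : Set (Tri K) := {t | s ⊆ t.1}

/-- The triangles which have a given vertex as a corner. -/
def trisAt (K : Cplx) (v : E3) : Set (Tri K) := {t | v ∈ t.1}

/-- The seam edges: three triangles meet there. Their union is the graph `s(F)`. -/
def seamEdges (K : Cplx) : Set (Finset E3) := {e | e ∈ edges K ∧ (trisOn K e).ncard = 3}

/-- The seam edges which end at a given vertex. -/
def seamEdgesAt (K : Cplx) (v : E3) : Set (Finset E3) := {e | e ∈ seamEdges K ∧ v ∈ e}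

/-- Two triangles are adjacent when they share an edge outside the set `S`. -/
def adjGraph (K : Cplx) (S : Set (Finset E3)) : SimpleGraph (Tri K) where
  Adj t t' := t ≠ t' ∧ ∃ e ∈ edges K, e ∉ S ∧ e ⊆ t.1 ∧ e ⊆ t'.1
  symm := ⟨fun _ _ h => ⟨h.1.symm, h.2.imp fun _ he => ⟨he.1, he.2.1, he.2.2.2, he.2.2.1⟩⟩⟩
  loopless := ⟨fun _ h => h.1 rfl⟩

theorem adjGraph_anti (K : Cplx) {S T : Set (Finset E3)} (h : S ⊆ T) :
    adjGraph K T ≤ adjGraph K S :=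
  fun _ _ ht => ⟨ht.1, ht.2.imp fun _ he => ⟨he.1, fun hS => he.2.1 (h hS), he.2.2⟩⟩

/-- The facets: the connected components of the complement of `s(F)`. -/
abbrev Facet (K : Cplx) : Type := (adjGraph K (seamEdges K)).ConnectedComponent

/-- The facet that contains a triangle. -/
def facetOf (K : Cplx) (t : Tri K) : Facet K :=
  (adjGraph K (seamEdges K)).connectedComponentMk t

/-- The open simplices of which a facet consists: those that do not lie in `s(F)` and are faces of
a triangle of the facet. -/
def facetSimplices (K : Cplx) (f : Facet K) : Set (Finset E3) :=
  {s | s ∈ K.faces ∧ (∀ e ∈ seamEdges K, ¬ s ⊆ e) ∧ ∃ t : Tri K, facetOf K t = f ∧ s ⊆ t.1}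

/-- The sheets at a vertex: the connected components of the complement of `s(F)` in a small
neighbourhood of the vertex. They correspond to the arcs of the link of the vertex. -/
abbrev Sheet (K : Cplx) (v : E3) : Type :=
  ((adjGraph K (seamEdges K)).induce (trisAt K v)).ConnectedComponent

/-- The sheet at `v` that contains a triangle with corner `v`. -/
def sheetOf (K : Cplx) (v : E3) (t : trisAt K v) : Sheet K v :=
  ((adjGraph K (seamEdges K)).induce (trisAt K v)).connectedComponentMk t

/-- The edge `e` lies in the closure of the sheet `σ`. -/
def Sheet.Touches {K : Cplx} {v : E3} (σ : Sheet K v) (e : Finset E3) : Prop :=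
  ∃ t : trisAt K v, sheetOf K v t = σ ∧ e ⊆ t.1.1

/-- The local models at a vertex. The link of `v` is a connected graph, whose vertices are the edges
at `v` and whose edges are the triangles at `v`. Its trivalent vertices are the seam edges at `v`,
all its other vertices are bivalent in a foam. It must be a circle (none), a theta graph (two, and
no arc returns to its own starting point) or the complete graph on four vertices (four, any two of
which are joined by an arc). So `v` is a regular point, a seam point or a singular vertex. -/
structure LocalModel (K : Cplx) (v : E3) : Prop where
  link_connected : ((adjGraph K ∅).induce (trisAt K v)).Connected
  branch_count : (seamEdgesAt K v).ncard = 0 ∨ (seamEdgesAt K v).ncard = 2 ∨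
    (seamEdgesAt K v).ncard = 4
  no_loop : ∀ e ∈ seamEdgesAt K v, ∀ t t' : trisAt K v, e ⊆ t.1.1 → e ⊆ t'.1.1 →
    sheetOf K v t = sheetOf K v t' → t = t'
  complete : (seamEdgesAt K v).ncard = 4 → ∀ e ∈ seamEdgesAt K v, ∀ e' ∈ seamEdgesAt K v,
    e ≠ e' → ∃ σ : Sheet K v, σ.Touches e ∧ σ.Touches e'

/-- The singular vertices: the link is the complete graph on four vertices. -/
def IsSingular (K : Cplx) (v : E3) : Prop := v ∈ K.vertices ∧ (seamEdgesAt K v).ncard = 4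

/-- Number of triangles of thickness two at an edge. -/
noncomputable def thickAt (K : Cplx) (th : Facet K → ℕ) (e : Finset E3) : ℕ :=
  {t : Tri K | t ∈ trisOn K e ∧ th (facetOf K t) = 2}.ncard

/-- Number of sheets of thickness two at a vertex. A singular vertex has six sheets, so that it has
type `1⁴2²`, `1³2³` or `2⁶` when this number is 2, 3 or 6. -/
noncomputable def thickSheets (K : Cplx) (th : Facet K → ℕ) (v : E3) : ℕ :=
  {σ : Sheet K v | ∃ t : trisAt K v, sheetOf K v t = σ ∧ th (facetOf K t.1) = 2}.ncard

/-- The regions: the connected components of the complement of `s(F)` and of the set `D` of defect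
lines. -/
abbrev Region (K : Cplx) (D : Set (Finset E3)) : Type :=
  (adjGraph K (seamEdges K ∪ D)).ConnectedComponent

/-- The facet that contains a region. -/
def Region.facet {K : Cplx} {D : Set (Finset E3)} (r : Region K D) : Facet K :=
  r.map (SimpleGraph.Hom.ofLE (adjGraph_anti K Set.subset_union_left))

/-- A dot, floating in a region of thickness `k`, labelled by a symmetric polynomial in `k` variables
over the field with two elements. -/
structure Dot (K : Cplx) (D : Set (Finset E3)) (th : Facet K → ℕ) where
  region : Region K D
  label : MvPolynomial (Fin (th region.facet)) (ZMod 2)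
  symmetric : label.IsSymmetric

/-- The two Kempe types. -/
inductive KempeType
  | diamond
  | triangle

/-- A closed foam in `ℝ³`, with defect lines, dots and a Kempe-specification. -/
structure Foam where
  /-- the underlying simplicial complex, embedded in three-space -/
  K : Cplx
  finite : K.faces.Finite
  /-- the complex is two-dimensional, and every face lies in a triangle -/
  dim_le : ∀ s ∈ K.faces, s.card ≤ 3
  pure : ∀ s ∈ K.faces, ∃ t : Tri K, s ⊆ t.1
  /-- two triangles meet at an edge of a facet, three triangles at a seam edge -/
  edge_count : ∀ e ∈ edges K, (trisOn K e).ncard = 2 ∨ (trisOn K e).ncard = 3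
  local_model : ∀ v ∈ K.vertices, LocalModel K v
  thickness : Facet K → ℕ
  thickness_eq : ∀ f, thickness f = 1 ∨ thickness f = 2
  /-- every seam edge has type 112 or 222 -/
  seam_type : ∀ e ∈ seamEdges K, thickAt K thickness e = 1 ∨ thickAt K thickness e = 3
  /-- the edges of which the defect lines consist; they lie in thick facets -/
  defects : Set (Finset E3)
  defects_edges : ∀ e ∈ defects, e ∈ edges K ∧ e ∉ seamEdges K
  defects_thick : ∀ e ∈ defects, ∀ t ∈ trisOn K e, thickness (facetOf K t) = 2
  /-- The defect lines are closed curves in general position to the seams: at every vertex the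
  defect edges are matched in pairs, one pair for each passage of a line, and a line that meets
  `s(F)` crosses it, from one sheet into another one. -/
  defects_curves : ∀ v ∈ K.vertices,
    ∃ τ : {e : Finset E3 // e ∈ defects ∧ v ∈ e} → {e : Finset E3 // e ∈ defects ∧ v ∈ e},
      (∀ e, τ (τ e) = e) ∧ (∀ e, τ e ≠ e) ∧
      ((seamEdgesAt K v).Nonempty →
        ∀ e, ∀ σ : Sheet K v, ¬ (σ.Touches e.1 ∧ σ.Touches (τ e).1))
  dots : Multiset (Dot K defects thickness)
  /-- the Kempe-specification of the singular vertices of type `2⁶` -/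
  kempe : {v : E3 // IsSingular K v ∧ thickSheets K thickness v = 6} → KempeType

namespace Foam

variable (F : Foam)

/-- The region that contains a triangle. -/
def regionOf (t : Tri F.K) : Region F.K F.defects :=
  (adjGraph F.K (seamEdges F.K ∪ F.defects)).connectedComponentMk t

/-- The number of defect lines that go through a vertex. Each of them has two ends there. -/
noncomputable def linesThrough (v : E3) : ℕ := {e | e ∈ F.defects ∧ v ∈ e}.ncard / 2

/-- Two seam edges are adjacent when they share a seam point that is not a singular vertex. -/
def seamGraph : SimpleGraph {e : Finset E3 // e ∈ seamEdges F.K} where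
  Adj e e' := e ≠ e' ∧ ∃ v, v ∈ e.1 ∧ v ∈ e'.1 ∧ ¬ IsSingular F.K v
  symm := ⟨fun _ _ h => ⟨h.1.symm, h.2.imp fun _ hv => ⟨hv.2.1, hv.1, hv.2.2⟩⟩⟩
  loopless := ⟨fun _ h => h.1 rfl⟩

/-- The seams: the connected components of `s(F)` minus the singular vertices. -/
abbrev Seam : Type := F.seamGraph.ConnectedComponent

variable {F} in
/-- The seam is an open interval, rather than a circle: it ends at a singular vertex. -/
def Seam.IsInterval (σ : F.Seam) : Prop :=
  ∃ e, F.seamGraph.connectedComponentMk e = σ ∧ ∃ v ∈ e.1, IsSingular F.K v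

variable {F} in
/-- The seam has type 112. -/
def Seam.Is112 (σ : F.Seam) : Prop :=
  ∀ e, F.seamGraph.connectedComponentMk e = σ → thickAt F.K F.thickness e.1 = 1

variable {F} in
/-- The seam has type 222. -/
def Seam.Is222 (σ : F.Seam) : Prop :=
  ∀ e, F.seamGraph.connectedComponentMk e = σ → thickAt F.K F.thickness e.1 = 3

/-- The singular vertices of type `1⁴2²`. -/
def vertices42 : Set E3 := {v | IsSingular F.K v ∧ thickSheets F.K F.thickness v = 2}

/-- The singular vertices of type `1³2³`. -/
def vertices33 : Set E3 := {v | IsSingular F.K v ∧ thickSheets F.K F.thickness v = 3}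

/-- The singular vertices of type `2⁶`. -/
def vertices06 : Set E3 := {v | IsSingular F.K v ∧ thickSheets F.K F.thickness v = 6}

/-- The degree of a foam. The variables of the polynomials at the dots have degree two. -/
noncomputable def degree : ℤ :=
  (F.dots.map fun d => 2 * (d.label.totalDegree : ℤ)).sum
    - 3 * ∑ᶠ (f : Facet F.K) (_ : F.thickness f = 1), eulerChar (facetSimplices F.K f)
    - 4 * ∑ᶠ (f : Facet F.K) (_ : F.thickness f = 2), eulerChar (facetSimplices F.K f)
    + 5 * ({σ : F.Seam | σ.IsInterval ∧ σ.Is112}.ncard : ℤ)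
    + 6 * ({σ : F.Seam | σ.IsInterval ∧ σ.Is222}.ncard : ℤ)
    - 6 * ((F.vertices06 ∪ F.vertices33).ncard : ℤ)
    - 5 * ({v | v ∈ F.vertices42 ∧ Even (F.linesThrough v)}.ncard : ℤ)
    - 6 * ({v | v ∈ F.vertices42 ∧ Odd (F.linesThrough v)}.ncard : ℤ)

/-- A coloring of a foam by the four pigments, the elements of `Fin 4`. -/
structure Coloring where
  col : Region F.K F.defects → Finset (Fin 4)
  card_col : ∀ r, (col r).card = F.thickness r.facet
  /-- at a seam of type 112 the thick color is the disjoint union of the thin ones -/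
  seam112 : ∀ e ∈ seamEdges F.K, ∀ a ∈ trisOn F.K e, ∀ b ∈ trisOn F.K e, ∀ d ∈ trisOn F.K e,
    a ≠ b → F.thickness (facetOf F.K a) = 1 → F.thickness (facetOf F.K b) = 1 →
    F.thickness (facetOf F.K d) = 2 →
    Disjoint (col (F.regionOf a)) (col (F.regionOf b)) ∧
      col (F.regionOf d) = col (F.regionOf a) ∪ col (F.regionOf b)
  /-- at a seam of type 222 the colors are the two-element subsets of a set of three pigments -/
  seam222 : ∀ e ∈ seamEdges F.K, thickAt F.K F.thickness e = 3 →
    ∃ S : Finset (Fin 4), S.card = 3 ∧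
      (fun t => col (F.regionOf t)) '' trisOn F.K e = {p | p ⊆ S ∧ p.card = 2}
  /-- at a defect the colors are complementary -/
  defect : ∀ e ∈ F.defects, ∀ a ∈ trisOn F.K e, ∀ b ∈ trisOn F.K e, a ≠ b →
    col (F.regionOf a) ∪ col (F.regionOf b) = Finset.univ
  /-- At a singular vertex of type `2⁶` (away from the defect lines) sheets that are opposite, that
  is, that have no seam in common there, are colored alike for the type `triangle`, and by
  complementary colors for the type `diamond`. -/
  kempe : ∀ v, (∀ e ∈ F.defects, v.1 ∉ e) → ∀ a b : trisAt F.K v.1,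
    (∀ e ∈ seamEdgesAt F.K v.1,
      ¬ ((sheetOf F.K v.1 a).Touches e ∧ (sheetOf F.K v.1 b).Touches e)) →
    match F.kempe v with
    | KempeType.triangle => col (F.regionOf a.1) = col (F.regionOf b.1)
    | KempeType.diamond => col (F.regionOf a.1) ∪ col (F.regionOf b.1) = Finset.univ

variable {F} in
/-- The bicolored surface `F_ij(c)`: the union of the (closed) regions whose color contains exactly
one of the pigments `i` and `j`, as a subcomplex. -/
def Coloring.bicolored (c : F.Coloring) (i j : Fin 4) : Set (Finset E3) :=
  {s | s ∈ F.K.faces ∧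
    ∃ t : Tri F.K, s ⊆ t.1 ∧ (c.col (F.regionOf t) ∩ {i, j}).card = 1}

end Foam

end SL4

/-!
Both sides of the degree formula are sums over the simplices of the triangulation. A simplex `s`
contributes to `χ(F_ij(c))` exactly when the color of some triangle at `s` contains one of `i`, `j`
and not the other, so `∑ χ(F_ij(c))` counts `s`, with sign, as often as there are pairs of pigments
separated near `s` (`Coloring.sum_eulerChar_bicolored`). This number is constant along the strata of
the foam. On a facet of thickness `k` it is `k + 2`, because crossing a defect line complements the
color and complements separate the same pairs; on a seam of type 112 or 222 it is 5 or 6; at a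
singular vertex with a seam of type 222 it is 6. At a singular vertex of type `1⁴2²` it is 5 or 6
according to the parity of the number of defect lines: every line passes from one thick sheet into
the other, so both thick sheets are crossed equally often, and the parity decides whether their two
ends have equal or complementary colors (`Coloring.card_sepAt_of_thickSheets_eq_two`). A seam has
Euler characteristic `-1` if it is an interval and `0` if it is a circle (`card_seamPart`), and the
degree formula follows by adding up the strata (`Coloring.degree_eq`).

The labels of the dots have even degree, so the second claim says that the closed surfaces
`F_ij(c)`, embedded in `ℝ³`, have even Euler characteristic. That they are closed surfaces is
checked on the links of vertices; the point is that the three colors at a seam add up to zero modulo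
two, so that the surface contains two of the three sheets or none (`Coloring.mem_surfaceTris_seam`).
A closed surface `M` in `ℝ³` is orientable because it separates its two sides: for a direction in
general position, the parity of the number of triangles of `M` above a point changes when the point
crosses `M`, so that the parity seen from the center of a triangle orients the triangle, and the
orientations of neighbors agree. The Euler characteristic of an oriented closed triangulated surface
is even for an elementary reason. Reversing a directed edge, passing to the next edge of the
triangle on its left, and the composition of both, which turns around a vertex, are permutations of
the directed edges whose cycles are the edges, the triangles and the vertices of the surface, and
comparing their signs gives `V - E + F ≡ 0` modulo two
(`even_eulerChar_of_coherent_orientation`, `even_eulerChar_of_closed_surface`).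
-/

namespace SL4

/-! ### Arcs glued at their ends -/

section Arcs

variable {X Y : Type*} [DecidableEq X] [DecidableEq Y]

omit [DecidableEq X] in
theorem sum_card_eq_sum_incidences (inc : X → Finset Y) (A : Finset X) :
    ∑ x ∈ A, (inc x).card = ∑ y ∈ A.biUnion inc, (A.filter fun x => y ∈ inc x).card := by
  have := Finset.sum_card_bipartiteAbove_eq_sum_card_bipartiteBelow (s := A) (t := A.biUnion inc)
    (fun x y => y ∈ inc x)
  refine Eq.trans (Finset.sum_congr rfl fun x hx => ?_) this
  congr 1
  ext y
  simp only [Finset.mem_bipartiteAbove, Finset.mem_biUnion]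
  exact ⟨fun h => ⟨⟨x, hx, h⟩, h⟩, fun h => h.2⟩

variable [Fintype X]

/-- A connected chain of arcs, each with two ends, glued in pairs at joints, is a circle or an
interval: the number of arcs equals the number of joints, or exceeds it by one, and correspondingly
there are no free ends, or two. -/
theorem circle_or_interval (G : SimpleGraph X) (inc : X → Finset Y) (J : Y → Prop)
    [DecidablePred J] (hcard : ∀ x, (inc x).card = 2)
    (hadj : ∀ x x', G.Adj x x' ↔ x ≠ x' ∧ ∃ y, J y ∧ y ∈ inc x ∧ y ∈ inc x')
    (hJ : ∀ y, J y → ∀ x, y ∈ inc x → (Finset.univ.filter fun x => y ∈ inc x).card = 2)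
    (C : G.ConnectedComponent) (A : Finset X)
    (hA : ∀ x, x ∈ A ↔ G.connectedComponentMk x = C) :
    (∑ y ∈ (A.biUnion inc).filter (fun y => ¬ J y), (A.filter fun x => y ∈ inc x).card = 0 ∧
      A.card = ((A.biUnion inc).filter J).card) ∨
    (∑ y ∈ (A.biUnion inc).filter (fun y => ¬ J y), (A.filter fun x => y ∈ inc x).card = 2 ∧
      A.card = ((A.biUnion inc).filter J).card + 1) := by
  have h1 := sum_card_eq_sum_incidences inc A
  rw [Finset.sum_congr rfl fun x _ => hcard x, Finset.sum_const, smul_eq_mul,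
    ← Finset.sum_filter_add_sum_filter_not _ J] at h1
  have h2 : ∑ y ∈ (A.biUnion inc).filter J, (A.filter fun x => y ∈ inc x).card
      = ((A.biUnion inc).filter J).card * 2 := by
    rw [Finset.sum_congr rfl (g := fun _ => 2), Finset.sum_const, smul_eq_mul]
    intro y hy
    simp only [Finset.mem_filter, Finset.mem_biUnion] at hy
    obtain ⟨⟨x, hx, hxy⟩, hyJ⟩ := hy
    rw [← hJ y hyJ x hxy]
    congr 1
    ext x'
    simp only [Finset.mem_filter, Finset.mem_univ, true_and, and_iff_right_iff_imp]
    intro hx'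
    by_cases hxx : x' = x
    · rwa [hxx]
    · rw [hA, ← (hA x).1 hx]
      exact SimpleGraph.ConnectedComponent.sound
        ((hadj x' x).2 ⟨hxx, y, hyJ, hx', hxy⟩).reachable
  have h3 : A.card ≤ ((A.biUnion inc).filter J).card + 1 := by
    have hc := C.connected_toSimpleGraph.card_vert_le_card_edgeSet_add_one
    have hn : Nat.card C = A.card := by
      rw [← Nat.card_eq_finsetCard]
      exact Nat.card_congr (Equiv.subtypeEquivRight fun x => (hA x).symm)
    have key : ∀ e : C.toSimpleGraph.edgeSet, ∃ y : ((A.biUnion inc).filter J),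
        ∀ x ∈ e.1, y.1 ∈ inc x.1 := by
      rintro ⟨e, he⟩
      induction e using Sym2.ind with
      | _ a b =>
        have hab : G.Adj a.1 b.1 := by simpa [SimpleGraph.ConnectedComponent.toSimpleGraph] using he
        obtain ⟨-, y, hy, ha, hb⟩ := (hadj _ _).1 hab
        refine ⟨⟨y, Finset.mem_filter.2 ⟨Finset.mem_biUnion.2 ⟨a.1, (hA _).2 a.2, ha⟩, hy⟩⟩, ?_⟩
        intro x hx
        rcases Sym2.mem_iff.1 hx with rfl | rfl <;> assumption
    choose f hf using key
    have hinj : Function.Injective f := by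
      rintro ⟨e, he⟩ ⟨e', he'⟩ hee
      have H := hf ⟨e, he⟩
      have H' := hf ⟨e', he'⟩
      rw [hee] at H
      generalize hyy : f ⟨e', he'⟩ = y at H H'
      obtain ⟨y, hy⟩ := y
      simp only at H H'
      rw [Subtype.mk.injEq]
      induction e using Sym2.ind with
      | _ a b =>
      induction e' using Sym2.ind with
      | _ a' b' =>
        have hab : a ≠ b := by rintro rfl; exact SimpleGraph.irrefl _ he
        have hab' : a' ≠ b' := by rintro rfl; exact SimpleGraph.irrefl _ he'
        have ha := H a (Sym2.mem_mk_left _ _)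
        have hb := H b (Sym2.mem_mk_right _ _)
        have ha' := H' a' (Sym2.mem_mk_left _ _)
        have hb' := H' b' (Sym2.mem_mk_right _ _)
        have h2 := hJ y (Finset.mem_filter.1 hy).2 _ ha
        obtain ⟨p, q, hpq, hs⟩ := Finset.card_eq_two.1 h2
        have mem : ∀ x : C, y ∈ inc x.1 → x.1 = p ∨ x.1 = q := by
          intro x hx
          have : x.1 ∈ ({p, q} : Finset X) := by rw [← hs]; simpa using hx
          simpa using this
        rw [Sym2.eq_iff]
        have e1 := mem _ ha
        have e2 := mem _ hb
        have e3 := mem _ ha'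
        have e4 := mem _ hb'
        simp only [← Subtype.val_inj, ne_eq] at *
        grind
    have := Nat.card_le_card_of_injective f hinj
    rw [hn] at hc
    rw [Nat.card_eq_finsetCard] at this
    omega
  rw [h2] at h1
  generalize ∑ y ∈ (A.biUnion inc).filter (fun y => ¬ J y), (A.filter fun x => y ∈ inc x).card = s
    at h1 ⊢
  omega

end Arcs

/-! ### Closed surfaces with coherently oriented triangles -/

/-- The cycles of a permutation without fixed points are the fibers of `p`, when it permutes each
fiber transitively. -/
theorem sign_of_transitive_on_fibers {D B : Type*} [DecidableEq D] [Fintype D] [DecidableEq B]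
    (σ : Equiv.Perm D) (p : D → B) (S : Finset B) (hS : ∀ b, b ∈ S ↔ ∃ d, p d = b)
    (hne : ∀ d, σ d ≠ d) (hp : ∀ d d', p d = p d' ↔ σ.SameCycle d d') :
    Equiv.Perm.sign σ = (-1) ^ (Fintype.card D + S.card) := by
  rw [Equiv.Perm.sign_of_cycleType, Equiv.Perm.sum_cycleType]
  have h1 : σ.support = Finset.univ := by
    ext d; simpa using hne d
  rw [h1, Finset.card_univ]
  congr 2
  rw [Equiv.Perm.cycleType_def, Multiset.card_map]
  change σ.cycleFactorsFinset.card = _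
  symm
  choose g hg using fun b : S => (hS b.1).1 b.2
  refine Finset.card_bij (fun b hb => σ.cycleOf (g ⟨b, hb⟩)) ?_ ?_ ?_
  · intro b hb
    rw [Equiv.Perm.cycleOf_mem_cycleFactorsFinset_iff, h1]
    exact Finset.mem_univ _
  · intro b hb b' hb' h
    have h' : σ.SameCycle (g ⟨b, hb⟩) (g ⟨b', hb'⟩) := by
      have hm : g ⟨b', hb'⟩ ∈ (σ.cycleOf (g ⟨b, hb⟩)).support := by
        have h : σ.cycleOf (g ⟨b, hb⟩) = σ.cycleOf (g ⟨b', hb'⟩) := h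
        rw [h, Equiv.Perm.mem_support_cycleOf_iff]
        exact ⟨.refl _ _, by rw [h1]; simp⟩
      exact (Equiv.Perm.mem_support_cycleOf_iff.1 hm).1
    have h2 := (hp _ _).2 h'
    rwa [hg, hg] at h2
  · intro c hc
    obtain ⟨x, hx⟩ := (Equiv.Perm.mem_cycleFactorsFinset_iff.1 hc).1.nonempty_support
    refine ⟨p x, (hS _).2 ⟨x, rfl⟩, ?_⟩
    rw [Equiv.Perm.cycle_is_cycleOf hx hc]
    exact (((hp _ _).1 (hg ⟨p x, _⟩))).cycleOf_eq

theorem apply_eq_of_sameCycle {D B : Type*} {p : D → B} {σ : Equiv.Perm D}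
    (h : ∀ d, p (σ d) = p d) {d d' : D} (hd : σ.SameCycle d d') : p d = p d' := by
  have hn : ∀ τ : Equiv.Perm D, (∀ d, p (τ d) = p d) → ∀ n : ℕ, p ((τ ^ n) d) = p d := by
    intro τ hτ n
    induction n with
    | zero => rfl
    | succ n ih => rw [pow_succ', Equiv.Perm.mul_apply, hτ, ih]
  obtain ⟨i, rfl⟩ := hd
  obtain ⟨n, rfl | rfl⟩ := i.eq_nat_or_neg
  · rw [zpow_natCast, hn σ h]
  · rw [zpow_neg, zpow_natCast, ← inv_pow, hn σ⁻¹ fun d => by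
      conv_rhs => rw [← σ.apply_symm_apply d, h]
      rfl]

section OrientedSurface

variable {V : Type*} [DecidableEq V]

/-- A closed triangulated surface with connected vertex links whose triangles can be oriented
coherently has even Euler characteristic. On the directed edges, let `α` reverse an edge and let `φ`
pass to the next edge of the triangle on the left; `φ` has order three and hence is even, while the
cycles of `α` are the edges and those of `φ * α` are the vertices, so that the signs of these
permutations give `V ≡ E` modulo two. The number of triangles is even since `3 F = 2 E`. -/
theorem even_eulerChar_of_coherent_orientation (M : Finset (Finset V))
    (h3 : ∀ t ∈ M, t.card = 3)
    (h2 : ∀ t ∈ M, ∀ e ⊆ t, e.card = 2 → (M.filter fun t' => e ⊆ t').card = 2)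
    (hlink : ∀ v, ∀ t ∈ M, v ∈ t → ∀ t' ∈ M, v ∈ t' → Relation.ReflTransGen
      (fun a b => a ∈ M ∧ b ∈ M ∧ v ∈ a ∧ v ∈ b ∧ ∃ w, w ≠ v ∧ w ∈ a ∧ w ∈ b) t t')
    (ω : Finset V → V → V → Prop)
    (hrot : ∀ t ∈ M, ∀ a b c, t = {a, b, c} → a ≠ b → b ≠ c → a ≠ c → ω t a b → ω t b c)
    (hanti : ∀ t ∈ M, ∀ a ∈ t, ∀ b ∈ t, a ≠ b → (ω t a b ↔ ¬ ω t b a))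
    (hcoh : ∀ t ∈ M, ∀ t' ∈ M, t ≠ t' → ∀ a ∈ t, ∀ b ∈ t, a ∈ t' → b ∈ t' → a ≠ b →
      (ω t a b ↔ ¬ ω t' a b)) :
    Even (((M.biUnion id).card : ℤ) - ((M.biUnion (Finset.powersetCard 2)).card : ℤ) + M.card) := by
  classical
  have third : ∀ t ∈ M, ∀ a ∈ t, ∀ b ∈ t, a ≠ b → ∃ c, t = {a, b, c} ∧ b ≠ c ∧ a ≠ c := by
    intro t ht a ha b hb hab
    obtain ⟨x, y, z, hxy, hxz, hyz, rfl⟩ := Finset.card_eq_three.1 (h3 t ht)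
    simp only [Finset.mem_insert, Finset.mem_singleton] at ha hb
    rcases ha with rfl | rfl | rfl <;> rcases hb with rfl | rfl | rfl
    · exact absurd rfl hab
    · exact ⟨z, rfl, hyz, hxz⟩
    · exact ⟨y, by ext; simp; tauto, hyz.symm, hxy⟩
    · exact ⟨z, by ext; simp; tauto, hxz, hyz⟩
    · exact absurd rfl hab
    · exact ⟨x, by ext; simp; tauto, hxz.symm, hxy.symm⟩
    · exact ⟨y, by ext; simp; tauto, hxy, hyz.symm⟩
    · exact ⟨x, by ext; simp; tauto, hxy.symm, hxz.symm⟩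
    · exact absurd rfl hab
  let D : Finset (V × V) := M.biUnion Finset.offDiag
  have hD : ∀ a b, (a, b) ∈ D ↔ a ≠ b ∧ ∃ t ∈ M, a ∈ t ∧ b ∈ t := by
    intro a b
    simp only [D, Finset.mem_biUnion, Finset.mem_offDiag]
    tauto
  have left : ∀ d : D, ∃ t ∈ M, d.1.1 ∈ t ∧ d.1.2 ∈ t ∧ ω t d.1.1 d.1.2 := by
    rintro ⟨⟨a, b⟩, hd⟩
    obtain ⟨hab, t, ht, ha, hb⟩ := (hD _ _).1 hd
    by_cases h : ω t a b
    · exact ⟨t, ht, ha, hb, h⟩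
    have he : ({a, b} : Finset V) ⊆ t := by
      simp [Finset.insert_subset_iff, ha, hb]
    obtain ⟨t', ht', hne⟩ := Finset.exists_mem_ne
      (by rw [h2 t ht _ he (Finset.card_pair hab)]; norm_num) t
    rw [Finset.mem_filter] at ht'
    have ha' : a ∈ t' := ht'.2 (by simp)
    have hb' : b ∈ t' := ht'.2 (by simp)
    exact ⟨t', ht'.1, ha', hb', (hcoh t' ht'.1 t ht hne a ha' b hb' ha hb hab).2 h⟩
  choose T hTM hT1 hT2 hTω using left
  have hne : ∀ d : D, d.1.1 ≠ d.1.2 := fun d => ((hD _ _).1 d.2).1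
  have T_unique : ∀ d : D, ∀ t ∈ M, d.1.1 ∈ t → d.1.2 ∈ t → ω t d.1.1 d.1.2 → T d = t := by
    intro d t ht h1 h2 hω
    by_contra h
    exact (hcoh _ (hTM d) t ht h _ (hT1 d) _ (hT2 d) h1 h2 (hne d)).1 (hTω d) hω
  choose c hc hc1 hc2 using fun d : D => third _ (hTM d) _ (hT1 d) _ (hT2 d) (hne d)
  have hcT : ∀ d, c d ∈ T d := fun d => by
    have := hc d
    rw [this]; simp
  let φ : D → D := fun d => ⟨(d.1.2, c d), (hD _ _).2 ⟨hc1 d, T d, hTM d, hT2 d, hcT d⟩⟩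
  have Tφ : ∀ d, T (φ d) = T d := fun d =>
    T_unique _ _ (hTM d) (hT2 d) (hcT d)
      (hrot _ (hTM d) _ _ _ (hc d) (hne d) (hc1 d) (hc2 d) (hTω d))
  have cφ : ∀ d, c (φ d) = d.1.1 := by
    intro d
    have h1 : c (φ d) ∈ T d := Tφ d ▸ hcT (φ d)
    have e1 := hc1 (φ d)
    have e2 := hc2 (φ d)
    have := hc d
    rw [this] at h1
    simp only [Finset.mem_insert, Finset.mem_singleton, φ] at h1 e1 e2
    grind
  have φ3 : ∀ d, φ (φ (φ d)) = d := by
    intro d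
    apply Subtype.ext
    apply Prod.ext
    · exact cφ d
    · change c (φ (φ d)) = _
      rw [cφ]
  let Φ : Equiv.Perm D := ⟨φ, fun d => φ (φ d), φ3, φ3⟩
  have hΦ : Equiv.Perm.sign Φ = 1 := by
    have h : Φ ^ 3 = 1 := by
      ext1 d
      exact φ3 d
    have h' := congrArg Equiv.Perm.sign h
    rw [map_pow, map_one] at h'
    rcases Int.units_eq_one_or (Equiv.Perm.sign Φ) with h1 | h1
    · exact h1
    · rw [h1] at h'; exact absurd h' (by decide)
  let α : D → D := fun d => ⟨(d.1.2, d.1.1), by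
    obtain ⟨h, t, ht, h1, h2⟩ := (hD d.1.1 d.1.2).1 d.2
    exact (hD _ _).2 ⟨h.symm, t, ht, h2, h1⟩⟩
  let Α : Equiv.Perm D := ⟨α, α, fun d => rfl, fun d => rfl⟩
  have hsing : ∀ f g : D, f.1.1 = g.1.1 → T f = T g → f = g := by
    intro f g hfg hT
    apply Subtype.ext
    refine Prod.ext hfg ?_
    by_contra hde
    -- the two edges of a triangle at a corner cannot both start there
    have hf := hTω f
    have hg := hTω g
    rw [← hT, ← hfg] at hg
    have m1 := hT1 f
    have m2 := hT2 f
    have m3 : g.1.2 ∈ T f := hT ▸ hT2 g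
    have n1 := hne f
    have n2 : f.1.1 ≠ g.1.2 := hfg ▸ hne g
    obtain ⟨x, hx, hx1, hx2⟩ := third _ (hTM f) _ m1 _ m2 n1
    have : x = g.1.2 := by
      rw [hx] at m3
      simp only [Finset.mem_insert, Finset.mem_singleton] at m3
      grind
    subst this
    have hd2 := hrot _ (hTM f) _ _ _ hx n1 hx1 hx2 hf
    have hd3 := hrot _ (hTM f) _ _ _ (by rw [hx]; ext; simp; tauto) hx1 n2.symm n1.symm hd2
    exact (hanti _ (hTM f) _ m3 _ m1 n2.symm).1 hd3 hg
  have hα : Equiv.Perm.sign Α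
      = (-1) ^ (Fintype.card D + (M.biUnion (Finset.powersetCard 2)).card) := by
    refine sign_of_transitive_on_fibers Α (fun d => ({d.1.1, d.1.2} : Finset V)) _ ?_ ?_ ?_
    · intro e
      simp only [Finset.mem_biUnion, Finset.mem_powersetCard]
      constructor
      · rintro ⟨t, ht, het, he⟩
        obtain ⟨a, b, hab, rfl⟩ := Finset.card_eq_two.1 he
        exact ⟨⟨(a, b), (hD _ _).2 ⟨hab, t, ht, het (by simp), het (by simp)⟩⟩, rfl⟩
      · rintro ⟨d, rfl⟩
        exact ⟨T d, hTM d, by simp [Finset.insert_subset_iff, hT1, hT2], Finset.card_pair (hne d)⟩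
    · intro d h
      exact hne d (congrArg (fun d => d.1.1) h).symm
    · intro d d'
      constructor
      · intro h
        have h1 := hne d
        have h1' := hne d'
        have h2 : d = d' ∨ Α d = d' := by
          have e1 : d.1.1 ∈ ({d'.1.1, d'.1.2} : Finset V) := by rw [← h]; simp
          have e2 : d.1.2 ∈ ({d'.1.1, d'.1.2} : Finset V) := by rw [← h]; simp
          simp only [Finset.mem_insert, Finset.mem_singleton] at e1 e2
          simp only [Subtype.ext_iff, Prod.ext_iff, Α, α, Equiv.coe_fn_mk]
          grind
        rcases h2 with rfl | rfl
        · exact .refl _ _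
        · exact ⟨1, by simp⟩
      · refine apply_eq_of_sameCycle (σ := Α) (p := fun d : D => ({d.1.1, d.1.2} : Finset V))
          (fun d => ?_)
        exact Finset.pair_comm _ _
  have hσ : Equiv.Perm.sign (Φ * Α) = (-1) ^ (Fintype.card D + (M.biUnion id).card) := by
    refine sign_of_transitive_on_fibers (Φ * Α) (fun d => d.1.1) _ ?_ ?_ ?_
    · intro v
      simp only [Finset.mem_biUnion, id]
      constructor
      · rintro ⟨t, ht, hv⟩
        obtain ⟨w, hw, hwv⟩ := Finset.exists_mem_ne (by rw [h3 t ht]; norm_num) v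
        exact ⟨⟨(v, w), (hD _ _).2 ⟨hwv.symm, t, ht, hv, hw⟩⟩, rfl⟩
      · rintro ⟨d, rfl⟩
        exact ⟨T d, hTM d, hT1 d⟩
    · intro d h
      have := congrArg (fun d : D => d.1.2) h
      exact hc2 (Α d) this.symm
    · intro d d'
      constructor
      · intro h
        have main : ∀ t t', Relation.ReflTransGen (fun a b => a ∈ M ∧ b ∈ M ∧ d.1.1 ∈ a ∧
            d.1.1 ∈ b ∧ ∃ w, w ≠ d.1.1 ∧ w ∈ a ∧ w ∈ b) t t' → T d = t →
            ∀ e : D, e.1.1 = d.1.1 → T e = t' → (Φ * Α).SameCycle d e := by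
          intro t t' hr ht
          induction hr with
          | refl =>
            intro e he hTe
            rw [hsing d e he.symm (by rw [ht, hTe])]
          | @tail s t' _ hst ih =>
            intro e he hTe
            obtain ⟨hs, ht', hvs, hvt', w, hwv, hws, hwt'⟩ := hst
            -- the dart of `s` that starts at the vertex
            obtain ⟨x, hx, hx1, hx2⟩ := third s hs _ hvs _ hws hwv.symm
            have hdart : ∃ f : D, f.1.1 = d.1.1 ∧ T f = s := by
              by_cases h : ω s d.1.1 w
              · exact ⟨⟨(d.1.1, w), (hD _ _).2 ⟨hwv.symm, s, hs, hvs, hws⟩⟩, rfl,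
                  T_unique _ _ hs hvs hws h⟩
              · have hxs : x ∈ s := by rw [hx]; simp
                refine ⟨⟨(d.1.1, x), (hD _ _).2 ⟨hx2, s, hs, hvs, hxs⟩⟩, rfl,
                  T_unique _ _ hs hvs hxs ?_⟩
                rw [hanti s hs _ hvs _ hws hwv.symm, not_not] at h
                exact hrot s hs w _ x (hx.trans (Finset.insert_comm _ _ _)) hwv hx2 hx1 h
            obtain ⟨f, hf1, hfs⟩ := hdart
            have hdf := ih f hf1 hfs
            refine hdf.trans ?_
            by_cases hst : s = t'
            · rw [hsing f e (hf1.trans he.symm) (by rw [hfs, hTe, hst])]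
            -- one of the triangles lies on the left of the edge from the vertex to `w`
            have step : ∀ (s t' : Finset V) (hs : s ∈ M) (ht' : t' ∈ M), s ≠ t' → d.1.1 ∈ s →
                d.1.1 ∈ t' → w ∈ s → w ∈ t' → ω s d.1.1 w → ∀ f e : D, f.1.1 = d.1.1 →
                e.1.1 = d.1.1 → T f = s → T e = t' → (Φ * Α).SameCycle f e := by
              intro s t' hs ht' hst hvs hvt' hws hwt' hω f e hf he hfs hTe
              have hf' : f = ⟨(d.1.1, w), (hD _ _).2 ⟨hwv.symm, s, hs, hvs, hws⟩⟩ :=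
                hsing _ _ hf (by rw [hfs]; exact (T_unique ⟨(d.1.1, w), _⟩ _ hs hvs hws hω).symm)
              have hωt : ω t' w d.1.1 := by
                by_contra h
                rw [← hanti t' ht' _ hvt' _ hwt' hwv.symm] at h
                exact (hcoh s hs t' ht' hst _ hvs _ hws hvt' hwt' hwv.symm).1 hω h
              have hα' : T (Α f) = t' := by
                subst hf'
                exact T_unique _ _ ht' hwt' hvt' hωt
              have : (Φ * Α) f = e := by
                apply hsing
                · rw [he, ← hf]; rfl
                · rw [hTe, ← hα']; exact Tφ _
              exact ⟨1, by simpa using this⟩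
            by_cases hω : ω s d.1.1 w
            · exact step s t' hs ht' hst hvs hvt' hws hwt' hω f e hf1 he hfs hTe
            · have hω' : ω t' d.1.1 w :=
                (hcoh t' ht' s hs (Ne.symm hst) _ hvt' _ hwt' hvs hws hwv.symm).2 hω
              exact (step t' s ht' hs (Ne.symm hst) hvt' hvs hwt' hws hω' e f he hf1 hTe
                hfs).symm
        exact main _ _ (hlink d.1.1 _ (hTM d) (hT1 d) _ (hTM d') (by
          have h : d.1.1 = d'.1.1 := h
          rw [h]; exact hT1 d')) rfl d' (Eq.symm h) rfl
      · exact apply_eq_of_sameCycle (σ := Φ * Α) (p := fun d : D => d.1.1) (fun d => rfl)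
  have hEV : Even ((M.biUnion id).card + (M.biUnion (Finset.powersetCard 2)).card) := by
    rw [map_mul, hΦ, one_mul, hα] at hσ
    have : ((-1 : ℤˣ) ^ ((M.biUnion id).card + (M.biUnion (Finset.powersetCard 2)).card)) = 1 := by
      rw [pow_add, pow_add, mul_right_inj] at hσ
      rw [pow_add, hσ, ← pow_add, ← two_mul, pow_mul]
      simp
    by_contra h
    rw [Nat.not_even_iff_odd] at h
    rw [h.neg_one_pow] at this
    exact absurd this (by decide)
  have h3F : 3 * M.card = 2 * (M.biUnion (Finset.powersetCard 2)).card := by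
    have h := sum_card_eq_sum_incidences (Finset.powersetCard 2) M
    have hl : ∀ t ∈ M, (Finset.powersetCard 2 t).card = 3 := by
      intro t ht
      rw [Finset.card_powersetCard, h3 t ht]
      rfl
    have hr : ∀ e ∈ M.biUnion (Finset.powersetCard 2),
        (M.filter fun t => e ∈ Finset.powersetCard 2 t).card = 2 := by
      intro e he
      obtain ⟨t, ht, het⟩ := Finset.mem_biUnion.1 he
      rw [Finset.mem_powersetCard] at het
      simpa only [Finset.mem_powersetCard, het.2, and_true] using h2 t ht e het.1 het.2
    rw [Finset.sum_congr rfl hl, Finset.sum_const, Finset.sum_congr rfl hr, Finset.sum_const,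
      smul_eq_mul, smul_eq_mul] at h
    omega
  obtain ⟨k, hk⟩ := hEV
  exact ⟨(k : ℤ) - (M.biUnion (Finset.powersetCard 2)).card + (M.card / 2 : ℕ), by omega⟩

end OrientedSurface

/-! ### Affine functions on an interval -/

section Interval

open Filter Topology

variable {ι : Type*} [Fintype ι]

theorem exists_zero_pos_slope_at_min (p q : ι → ℝ) (α : ℝ) (hα : ∀ i, 0 ≤ p i + q i * α)
    (hmin : ∀ y, (∀ i, 0 ≤ p i + q i * y) → α ≤ y) : ∃ i, p i + q i * α = 0 ∧ 0 < q i := by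
  by_contra! h
  have hev : ∀ᶠ y in 𝓝[<] α, ∀ i, 0 ≤ p i + q i * y := by
    rw [Filter.eventually_all]
    intro i
    rcases (hα i).eq_or_lt with h0 | h0
    · filter_upwards [self_mem_nhdsWithin] with y hy
      have h1 := h i h0.symm
      have hy : y < α := hy
      nlinarith
    · have hc : Continuous fun y : ℝ => p i + q i * y := by fun_prop
      have := hc.continuousAt.eventually (lt_mem_nhds h0)
      exact (this.filter_mono nhdsWithin_le_nhds).mono fun y hy => le_of_lt hy
  obtain ⟨y, hy, hyα⟩ := (hev.and self_mem_nhdsWithin).exists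
  exact absurd (hmin y hy) (not_le.2 hyα)

/-- A segment in a line, cut out by half-lines in general position, has two ends (or is empty), and
each end lies on the boundary of exactly one of the half-lines. -/
theorem even_card_vanishing (p q : ι → ℝ) (hb : BddBelow {y | ∀ i, 0 ≤ p i + q i * y})
    (ha : BddAbove {y | ∀ i, 0 ≤ p i + q i * y})
    (hgen : ∀ y, (∀ i, 0 ≤ p i + q i * y) → ∀ i j, p i + q i * y = 0 → p j + q j * y = 0 → i = j)
    [DecidablePred fun i => ∃ y, (∀ j, 0 ≤ p j + q j * y) ∧ p i + q i * y = 0] :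
    Even (Finset.univ.filter
      fun i => ∃ y, (∀ j, 0 ≤ p j + q j * y) ∧ p i + q i * y = 0).card := by
  classical
  by_cases hne : {y | ∀ i, 0 ≤ p i + q i * y}.Nonempty
  swap
  · rw [Finset.filter_eq_empty_iff.2, Finset.card_empty]
    · exact Even.zero
    · rintro i - ⟨y, hy, -⟩
      exact hne ⟨y, hy⟩
  have hcl : IsClosed {y | ∀ i, 0 ≤ p i + q i * y} := by
    rw [Set.ofPred_forall]
    exact isClosed_iInter fun i => isClosed_le continuous_const (by fun_prop)
  have hα := hcl.csInf_mem hne hb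
  have hβ := hcl.csSup_mem hne ha
  have hαm : ∀ y, (∀ i, 0 ≤ p i + q i * y) → sInf {y | ∀ i, 0 ≤ p i + q i * y} ≤ y :=
    fun y hy => csInf_le hb hy
  have hβm : ∀ y, (∀ i, 0 ≤ p i + q i * y) → y ≤ sSup {y | ∀ i, 0 ≤ p i + q i * y} :=
    fun y hy => le_csSup ha hy
  generalize sInf {y | ∀ i, 0 ≤ p i + q i * y} = α at *
  generalize sSup {y | ∀ i, 0 ≤ p i + q i * y} = β at *
  have hα : ∀ i, 0 ≤ p i + q i * α := hα
  have hβ : ∀ i, 0 ≤ p i + q i * β := hβ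
  obtain ⟨i, hi, hqi⟩ := exists_zero_pos_slope_at_min p q α hα hαm
  obtain ⟨j, hj, hqj⟩ := exists_zero_pos_slope_at_min p (fun i => - q i) (-β)
    (fun i => by simpa using hβ i) fun y hy => by
      have := hβm (-y) fun i => by simpa using hy i
      linarith
  simp only [neg_mul, mul_neg, neg_neg, Left.neg_pos_iff] at hj hqj
  have hij : i ≠ j := by rintro rfl; linarith
  have hαβ : α ≤ β := hαm β hβ
  have : (Finset.univ.filter
      fun i => ∃ y, (∀ j, 0 ≤ p j + q j * y) ∧ p i + q i * y = 0) = {i, j} := by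
    ext k
    simp only [Finset.mem_filter, Finset.mem_univ, true_and, Finset.mem_insert,
      Finset.mem_singleton]
    constructor
    · rintro ⟨y, hy, hk⟩
      by_contra! hkk
      have h1 := hα k
      have h2 := hβ k
      have h3 := hαm y hy
      have h4 := hβm y hy
      have h5 : p k + q k * α ≠ 0 := fun h => hkk.1 (hgen α hα k i h hi)
      have h6 : p k + q k * β ≠ 0 := fun h => hkk.2 (hgen β hβ k j h hj)
      have h7 : 0 < p k + q k * α := lt_of_le_of_ne h1 h5.symm
      have h8 : 0 < p k + q k * β := lt_of_le_of_ne h2 h6.symm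
      rcases le_total 0 (q k) with h | h <;> nlinarith
    · rintro (rfl | rfl)
      exacts [⟨α, hα, hi⟩, ⟨β, hβ, hj⟩]
  rw [this, Finset.card_pair hij]
  exact even_two

end Interval

/-! ### Triangles above a point -/

/-- The determinant of three vectors. -/
def vol (u v w : E3) : ℝ :=
  u 0 * (v 1 * w 2 - v 2 * w 1) - u 1 * (v 0 * w 2 - v 2 * w 0) + u 2 * (v 0 * w 1 - v 1 * w 0)

/-- The barycentric coordinate with respect to `a` of the projection of `x` along `ξ` to the plane
of `a`, `b`, `c`. -/
noncomputable def baryCoord (ξ a b c x : E3) : ℝ :=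
  vol (b - x) (c - x) ξ / vol (b - a) (c - a) ξ

/-- The height in the direction `ξ` of the plane of `a`, `b`, `c` above `x`. -/
noncomputable def height (ξ a b c x : E3) : ℝ :=
  vol (b - a) (c - a) (a - x) / vol (b - a) (c - a) ξ

theorem vol_rotate (ξ a b c : E3) : vol (c - b) (a - b) ξ = vol (b - a) (c - a) ξ := by
  simp only [vol, PiLp.sub_apply]; ring

theorem ext_E3 {x y : E3} (h0 : x 0 = y 0) (h1 : x 1 = y 1) (h2 : x 2 = y 2) : x = y := by
  ext i; fin_cases i <;> assumption

section Bary

variable {ξ a b c : E3}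

theorem height_rotate (x : E3) : height ξ b c a x = height ξ a b c x := by
  unfold height
  rw [vol_rotate ξ]
  congr 1
  simp only [vol, PiLp.sub_apply]; ring

theorem baryCoord_add (h : vol (b - a) (c - a) ξ ≠ 0) (x : E3) :
    baryCoord ξ a b c x + baryCoord ξ b c a x + baryCoord ξ c a b x = 1 := by
  unfold baryCoord
  rw [vol_rotate ξ b c a, vol_rotate ξ a b c, ← add_div, ← add_div, div_eq_one_iff_eq h]
  simp only [vol, PiLp.sub_apply]; ring

theorem baryCoord_combination (h : vol (b - a) (c - a) ξ ≠ 0) (x : E3) :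
    baryCoord ξ a b c x • a + baryCoord ξ b c a x • b + baryCoord ξ c a b x • c
      = x + height ξ a b c x • ξ := by
  unfold baryCoord height
  rw [vol_rotate ξ b c a, vol_rotate ξ a b c]
  apply ext_E3 <;>
  · simp only [PiLp.add_apply, PiLp.smul_apply, smul_eq_mul]
    field_simp
    simp only [vol, PiLp.sub_apply]; ring

theorem baryCoord_unique (h : vol (b - a) (c - a) ξ ≠ 0) {x : E3} {r α β γ : ℝ}
    (hs : α + β + γ = 1) (hx : x + r • ξ = α • a + β • b + γ • c) :
    baryCoord ξ a b c x = α ∧ height ξ a b c x = r := by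
  obtain rfl : x = α • a + β • b + γ • c - r • ξ := by rw [← hx]; simp
  obtain rfl : α = 1 - β - γ := by linarith
  unfold baryCoord height
  rw [div_eq_iff h, div_eq_iff h]
  constructor <;>
  · simp only [vol, PiLp.sub_apply, PiLp.add_apply, PiLp.smul_apply, smul_eq_mul]; ring

theorem baryCoord_line (p q : E3) (y : ℝ) :
    baryCoord ξ a b c (p + y • (q - p))
      = baryCoord ξ a b c p + (baryCoord ξ a b c q - baryCoord ξ a b c p) * y := by
  unfold baryCoord
  rw [← sub_div, div_mul_eq_mul_div, ← add_div]
  congr 1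
  simp only [vol, PiLp.sub_apply, PiLp.add_apply, PiLp.smul_apply, smul_eq_mul]; ring

theorem height_line (p q : E3) (y : ℝ) :
    height ξ a b c (p + y • (q - p))
      = height ξ a b c p + (height ξ a b c q - height ξ a b c p) * y := by
  unfold height
  rw [← sub_div, div_mul_eq_mul_div, ← add_div]
  congr 1
  simp only [vol, PiLp.sub_apply, PiLp.add_apply, PiLp.smul_apply, smul_eq_mul]; ring

end Bary

theorem mem_convexHull_pair_iff {a b x : E3} :
    x ∈ convexHull ℝ ({a, b} : Set E3) ↔
      ∃ α β : ℝ, 0 ≤ α ∧ 0 ≤ β ∧ α + β = 1 ∧ α • a + β • b = x := by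
  rw [convexHull_pair, segment]; rfl

theorem mem_convexHull_triple_iff {a b c x : E3} :
    x ∈ convexHull ℝ ({a, b, c} : Set E3) ↔
      ∃ α β γ : ℝ, 0 ≤ α ∧ 0 ≤ β ∧ 0 ≤ γ ∧ α + β + γ = 1 ∧ α • a + β • b + γ • c = x := by
  rw [convexHull_insert (by simp), mem_convexJoin]
  simp only [Set.mem_singleton_iff, exists_eq_left, mem_convexHull_pair_iff]
  constructor
  · rintro ⟨z, ⟨β, γ, hβ, hγ, hs, rfl⟩, ⟨s, t, hs', ht', hst, rfl⟩⟩
    refine ⟨s, t * β, t * γ, hs', by positivity, by positivity, ?_, ?_⟩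
    · rw [add_assoc, ← mul_add, hs, mul_one, hst]
    · rw [smul_add, smul_smul, smul_smul, add_assoc]
  · rintro ⟨α, β, γ, hα, hβ, hγ, hs, rfl⟩
    rcases (add_nonneg hβ hγ).eq_or_lt with h | h
    · have h1 : β = 0 := by linarith
      have h2 : γ = 0 := by linarith
      subst h1 h2
      exact ⟨b, ⟨1, 0, by norm_num, le_rfl, by norm_num, by simp⟩,
        ⟨1, 0, by norm_num, le_rfl, by norm_num, by simp at hs; simp [hs]⟩⟩
    · refine ⟨(β / (β + γ)) • b + (γ / (β + γ)) • c, ⟨_, _, by positivity, by positivity,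
        by field_simp, rfl⟩, ⟨α, β + γ, hα, h.le, by linarith, ?_⟩⟩
      rw [smul_add, smul_smul, smul_smul, mul_div_cancel₀ _ h.ne', mul_div_cancel₀ _ h.ne',
        add_assoc]

/-- The ray from `x` in the direction `ξ` meets the simplex `s` (at a point other than `x`). -/
def Above (ξ : E3) (s : Finset E3) (x : E3) : Prop :=
  ∃ r : ℝ, 0 < r ∧ x + r • ξ ∈ convexHull ℝ (s : Set E3)

/-- The simplex `s` meets the half-strip above the segment from `p` to `q`. -/
def AboveSegment (ξ : E3) (s : Finset E3) (p q : E3) : Prop :=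
  ∃ y : ℝ, 0 ≤ y ∧ y ≤ 1 ∧ Above ξ s (p + y • (q - p))

section Above

variable {ξ a b c : E3} [DecidableEq E3]

theorem above_triangle_iff (h : vol (b - a) (c - a) ξ ≠ 0) (x : E3) :
    Above ξ {a, b, c} x ↔ 0 ≤ baryCoord ξ a b c x ∧ 0 ≤ baryCoord ξ b c a x ∧
      0 ≤ baryCoord ξ c a b x ∧ 0 < height ξ a b c x := by
  unfold Above
  simp only [Finset.coe_insert, Finset.coe_singleton, mem_convexHull_triple_iff]
  constructor
  · rintro ⟨r, hr, α, β, γ, hα, hβ, hγ, hs, hx⟩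
    obtain ⟨h1, h2⟩ := baryCoord_unique h hs hx.symm
    obtain ⟨h3, -⟩ := baryCoord_unique (a := b) (b := c) (c := a) (r := r) (x := x)
      (by rwa [vol_rotate]) (α := β) (β := γ) (γ := α) (by linarith) (by rw [← hx]; abel)
    obtain ⟨h4, -⟩ := baryCoord_unique (a := c) (b := a) (c := b) (r := r) (x := x)
      (by rwa [vol_rotate, vol_rotate]) (α := γ) (β := α) (γ := β) (by linarith)
      (by rw [← hx]; abel)
    rw [h1, h2, h3, h4]
    exact ⟨hα, hβ, hγ, hr⟩
  · rintro ⟨hα, hβ, hγ, hr⟩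
    exact ⟨_, hr, _, _, _, hα, hβ, hγ, baryCoord_add h x, baryCoord_combination h x⟩

theorem above_edge_iff (h : vol (b - a) (c - a) ξ ≠ 0) (x : E3) :
    Above ξ {b, c} x ↔ baryCoord ξ a b c x = 0 ∧ 0 ≤ baryCoord ξ b c a x ∧
      0 ≤ baryCoord ξ c a b x ∧ 0 < height ξ a b c x := by
  unfold Above
  simp only [Finset.coe_insert, Finset.coe_singleton, mem_convexHull_pair_iff]
  constructor
  · rintro ⟨r, hr, β, γ, hβ, hγ, hs, hx⟩
    obtain ⟨h1, h2⟩ := baryCoord_unique (x := x) (r := r) h (α := 0) (β := β) (γ := γ)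
      (by linarith) (by rw [← hx]; simp)
    obtain ⟨h3, -⟩ := baryCoord_unique (a := b) (b := c) (c := a) (r := r) (x := x)
      (by rwa [vol_rotate]) (α := β) (β := γ) (γ := 0) (by linarith) (by rw [← hx]; simp)
    obtain ⟨h4, -⟩ := baryCoord_unique (a := c) (b := a) (c := b) (r := r) (x := x)
      (by rwa [vol_rotate, vol_rotate]) (α := γ) (β := 0) (γ := β) (by linarith)
      (by rw [← hx]; simp; abel)
    rw [h1, h2, h3, h4]
    exact ⟨rfl, hβ, hγ, hr⟩
  · rintro ⟨hα, hβ, hγ, hr⟩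
    refine ⟨_, hr, _, _, hβ, hγ, ?_, ?_⟩
    · have := baryCoord_add h x
      rwa [hα, zero_add] at this
    · have := baryCoord_combination h x
      rwa [hα, zero_smul, zero_add] at this

omit [DecidableEq E3] in
theorem mem_triangle_iff (h : vol (b - a) (c - a) ξ ≠ 0) (x : E3) :
    x ∈ convexHull ℝ ({a, b, c} : Set E3) ↔ 0 ≤ baryCoord ξ a b c x ∧ 0 ≤ baryCoord ξ b c a x ∧
      0 ≤ baryCoord ξ c a b x ∧ height ξ a b c x = 0 := by
  rw [mem_convexHull_triple_iff]
  constructor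
  · rintro ⟨α, β, γ, hα, hβ, hγ, hs, hx⟩
    obtain ⟨h1, h2⟩ := baryCoord_unique h hs (r := 0) (x := x) (by rw [hx]; simp)
    obtain ⟨h3, -⟩ := baryCoord_unique (a := b) (b := c) (c := a) (r := 0) (x := x)
      (by rwa [vol_rotate]) (α := β) (β := γ) (γ := α) (by linarith) (by rw [← hx]; simp; abel)
    obtain ⟨h4, -⟩ := baryCoord_unique (a := c) (b := a) (c := b) (r := 0) (x := x)
      (by rwa [vol_rotate, vol_rotate]) (α := γ) (β := α) (γ := β) (by linarith)
      (by rw [← hx]; simp; abel)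
    rw [h1, h2, h3, h4]
    exact ⟨hα, hβ, hγ, rfl⟩
  · rintro ⟨hα, hβ, hγ, hr⟩
    refine ⟨_, _, _, hα, hβ, hγ, baryCoord_add h x, ?_⟩
    rw [baryCoord_combination h x, hr]; simp

end Above

/-- The indicator of a proposition, modulo two. -/
noncomputable def ind (P : Prop) : ZMod 2 := by
  classical exact if P then 1 else 0

theorem ind_pos {P : Prop} (h : P) : ind P = 1 := if_pos h

theorem ind_neg {P : Prop} (h : ¬ P) : ind P = 0 := if_neg h

theorem ind_congr {P Q : Prop} (h : P ↔ Q) : ind P = ind Q := by rw [propext h]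

theorem natCast_card_filter_eq_sum_ind {α : Type*} (s : Finset α) (P : α → Prop)
    [DecidablePred P] : ((s.filter P).card : ZMod 2) = ∑ x ∈ s, ind (P x) := by
  rw [Finset.natCast_card_filter]
  refine Finset.sum_congr rfl fun x _ => ?_
  by_cases h : P x
  · rw [ind_pos h, if_pos h]
  · rw [ind_neg h, if_neg h]

section Curtain

variable {ξ a b c : E3} [DecidableEq E3]

omit [DecidableEq E3] in
theorem above_vertex (h : vol (b - a) (c - a) ξ ≠ 0) {x : E3} (hb : baryCoord ξ b c a x = 0)
    (hc : baryCoord ξ c a b x = 0) (hx : 0 < height ξ a b c x) : Above ξ {a} x := by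
  refine ⟨_, hx, ?_⟩
  have h1 := baryCoord_add h x
  rw [← baryCoord_combination h x, hb, hc]
  rw [hb, hc, add_zero, add_zero] at h1
  simp [h1]

/-- The part of a triangle that lies in the half-strip above a segment is itself a segment, so that
the number of its ends is even. Each end lies above an end of the given segment, or on an edge of
the triangle. -/
theorem sum_ind_above_triangle (h : vol (b - a) (c - a) ξ ≠ 0) {p q : E3}
    (hdisj : ∀ y : ℝ, 0 ≤ y → y ≤ 1 → p + y • (q - p) ∉ convexHull ℝ ({a, b, c} : Set E3))
    (ha : ¬ AboveSegment ξ {a} p q) (hb : ¬ AboveSegment ξ {b} p q)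
    (hc : ¬ AboveSegment ξ {c} p q)
    (hp1 : ¬ Above ξ {b, c} p) (hp2 : ¬ Above ξ {c, a} p) (hp3 : ¬ Above ξ {a, b} p)
    (hq1 : ¬ Above ξ {b, c} q) (hq2 : ¬ Above ξ {c, a} q) (hq3 : ¬ Above ξ {a, b} q) :
    ind (Above ξ {a, b, c} p) + ind (Above ξ {a, b, c} q) +
      (ind (AboveSegment ξ {b, c} p q) + ind (AboveSegment ξ {c, a} p q) +
        ind (AboveSegment ξ {a, b} p q)) = 0 := by
  classical
  have hbca : vol (c - b) (a - b) ξ ≠ 0 := by rwa [vol_rotate]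
  have hcab : vol (a - c) (b - c) ξ ≠ 0 := by rwa [vol_rotate, vol_rotate]
  have tri := above_triangle_iff h
  have ea := above_edge_iff h
  have eb := above_edge_iff hbca
  have ec := above_edge_iff hcab
  have hlb : ∀ x, height ξ b c a x = height ξ a b c x := height_rotate
  have hlc : ∀ x, height ξ c a b x = height ξ a b c x := fun x => by
    rw [height_rotate, height_rotate]
  have va := fun x hb hc hx => above_vertex (x := x) h hb hc hx
  have vb := fun x hb hc hx => above_vertex (x := x) hbca hb hc hx
  have vc := fun x hb hc hx => above_vertex (x := x) hcab hb hc hx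
  have lA := fun y => baryCoord_line (ξ := ξ) (a := a) (b := b) (c := c) p q y
  have lB := fun y => baryCoord_line (ξ := ξ) (a := b) (b := c) (c := a) p q y
  have lC := fun y => baryCoord_line (ξ := ξ) (a := c) (b := a) (c := b) p q y
  have lL := fun y => height_line (ξ := ξ) (a := a) (b := b) (c := c) p q y
  have mem := mem_triangle_iff h
  simp only [hlb, hlc] at eb ec vb vc
  unfold AboveSegment at *
  simp only [tri, ea, eb, ec, mem] at *
  -- the height has no zero over the triangle, hence a constant sign there
  by_cases hL : ∀ y : ℝ, 0 ≤ y → y ≤ 1 → 0 ≤ baryCoord ξ a b c (p + y • (q - p)) →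
      0 ≤ baryCoord ξ b c a (p + y • (q - p)) → 0 ≤ baryCoord ξ c a b (p + y • (q - p)) →
      0 < height ξ a b c (p + y • (q - p))
  · let P : Fin 5 → ℝ :=
      ![baryCoord ξ a b c p, baryCoord ξ b c a p, baryCoord ξ c a b p, 0, 1]
    let Q : Fin 5 → ℝ :=
      ![baryCoord ξ a b c q - baryCoord ξ a b c p, baryCoord ξ b c a q - baryCoord ξ b c a p,
        baryCoord ξ c a b q - baryCoord ξ c a b p, 1, -1]
    have hI : ∀ y, (∀ j, 0 ≤ P j + Q j * y) ↔ 0 ≤ baryCoord ξ a b c (p + y • (q - p)) ∧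
        0 ≤ baryCoord ξ b c a (p + y • (q - p)) ∧ 0 ≤ baryCoord ξ c a b (p + y • (q - p)) ∧
        0 ≤ y ∧ y ≤ 1 := by
      intro y
      simp [Fin.forall_fin_succ, P, Q, lA, lB, lC]
    have z0 : p + (0 : ℝ) • (q - p) = p := by simp
    have z1 : p + (1 : ℝ) • (q - p) = q := by simp
    have ev := even_card_vanishing P Q ⟨0, fun y hy => ((hI y).1 hy).2.2.2.1⟩
      ⟨1, fun y hy => ((hI y).1 hy).2.2.2.2⟩ (by
        intro y hy i j
        obtain ⟨h1, h2, h3, h4, h5⟩ := (hI y).1 hy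
        have h6 := hL y h4 h5 h1 h2 h3
        have v1 := va (p + y • (q - p))
        have v2 := vb (p + y • (q - p))
        have v3 := vc (p + y • (q - p))
        have w1 : ¬ Above ξ {a} (p + y • (q - p)) := fun h => ha ⟨y, h4, h5, h⟩
        have w2 : ¬ Above ξ {b} (p + y • (q - p)) := fun h => hb ⟨y, h4, h5, h⟩
        have w3 : ¬ Above ξ {c} (p + y • (q - p)) := fun h => hc ⟨y, h4, h5, h⟩
        have y0 : y = 0 → p + y • (q - p) = p := by rintro rfl; exact z0
        have y1 : 1 + -y = 0 → p + y • (q - p) = q := fun h => by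
          obtain rfl : y = 1 := by linarith
          exact z1
        have e0 : P 0 + Q 0 * y = baryCoord ξ a b c (p + y • (q - p)) := by simp [P, Q, lA]
        have e1 : P 1 + Q 1 * y = baryCoord ξ b c a (p + y • (q - p)) := by simp [P, Q, lB]
        have e2 : P 2 + Q 2 * y = baryCoord ξ c a b (p + y • (q - p)) := by simp [P, Q, lC]
        have e3 : P 3 + Q 3 * y = y := by simp [P, Q]
        have e4 : P 4 + Q 4 * y = 1 + -y := by simp [P, Q]
        clear_value P Q
        generalize p + y • (q - p) = x at *
        clear hI lA lB lC lL tri ea eb ec hlb hlc va vb vc hL hdisj mem ha hb hc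
        fin_cases i <;> fin_cases j <;>
          simp only [Fin.zero_eta, Fin.mk_one, Fin.reduceFinMk, e0, e1, e2, e3, e4] <;>
          intro k1 k2 <;> first | trivial | (exfalso; clear e0 e1 e2 e3 e4; grind))
    rw [← ZMod.natCast_eq_zero_iff_even, natCast_card_filter_eq_sum_ind, Fin.sum_univ_five] at ev
    rw [← ev]
    have i0 : ind (∃ y, (∀ j, 0 ≤ P j + Q j * y) ∧ P 3 + Q 3 * y = 0) =
        ind (0 ≤ baryCoord ξ a b c p ∧ 0 ≤ baryCoord ξ b c a p ∧ 0 ≤ baryCoord ξ c a b p ∧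
          0 < height ξ a b c p) := by
      refine ind_congr ⟨?_, fun hh => ⟨0, (hI 0).2 ?_, by simp [P, Q]⟩⟩
      · rintro ⟨y, hy, h0⟩
        obtain rfl : y = 0 := by simpa [P, Q] using h0
        obtain ⟨h1, h2, h3, h4, h5⟩ := (hI 0).1 hy
        have h6 := hL 0 h4 h5 h1 h2 h3
        rw [z0] at *
        exact ⟨h1, h2, h3, h6⟩
      · rw [z0]; exact ⟨hh.1, hh.2.1, hh.2.2.1, le_rfl, zero_le_one⟩
    have i1 : ind (∃ y, (∀ j, 0 ≤ P j + Q j * y) ∧ P 4 + Q 4 * y = 0) =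
        ind (0 ≤ baryCoord ξ a b c q ∧ 0 ≤ baryCoord ξ b c a q ∧ 0 ≤ baryCoord ξ c a b q ∧
          0 < height ξ a b c q) := by
      refine ind_congr ⟨?_, fun hh => ⟨1, (hI 1).2 ?_, by simp [P, Q]⟩⟩
      · rintro ⟨y, hy, h0⟩
        obtain rfl : y = 1 := by
          have : 1 + -y = 0 := by simpa [P, Q] using h0
          linarith
        obtain ⟨h1, h2, h3, h4, h5⟩ := (hI 1).1 hy
        have h6 := hL 1 h4 h5 h1 h2 h3
        rw [z1] at *
        exact ⟨h1, h2, h3, h6⟩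
      · rw [z1]; exact ⟨hh.1, hh.2.1, hh.2.2.1, zero_le_one, le_rfl⟩
    have j0 : ind (∃ y, (∀ j, 0 ≤ P j + Q j * y) ∧ P 0 + Q 0 * y = 0) =
        ind (∃ y : ℝ, 0 ≤ y ∧ y ≤ 1 ∧ baryCoord ξ a b c (p + y • (q - p)) = 0 ∧
          0 ≤ baryCoord ξ b c a (p + y • (q - p)) ∧ 0 ≤ baryCoord ξ c a b (p + y • (q - p)) ∧
          0 < height ξ a b c (p + y • (q - p))) := by
      refine ind_congr (exists_congr fun y => ?_)
      have e : P 0 + Q 0 * y = baryCoord ξ a b c (p + y • (q - p)) := by simp [P, Q, lA]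
      rw [hI, e]
      refine ⟨fun ⟨⟨h1, h2, h3, h4, h5⟩, h0⟩ => ⟨h4, h5, h0, h2, h3, hL y h4 h5 h1 h2 h3⟩,
        fun ⟨h4, h5, h0, h2, h3, _⟩ => ⟨⟨h0.ge, h2, h3, h4, h5⟩, h0⟩⟩
    have j1 : ind (∃ y, (∀ j, 0 ≤ P j + Q j * y) ∧ P 1 + Q 1 * y = 0) =
        ind (∃ y : ℝ, 0 ≤ y ∧ y ≤ 1 ∧ baryCoord ξ b c a (p + y • (q - p)) = 0 ∧
          0 ≤ baryCoord ξ c a b (p + y • (q - p)) ∧ 0 ≤ baryCoord ξ a b c (p + y • (q - p)) ∧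
          0 < height ξ a b c (p + y • (q - p))) := by
      refine ind_congr (exists_congr fun y => ?_)
      have e : P 1 + Q 1 * y = baryCoord ξ b c a (p + y • (q - p)) := by simp [P, Q, lB]
      rw [hI, e]
      refine ⟨fun ⟨⟨h1, h2, h3, h4, h5⟩, h0⟩ => ⟨h4, h5, h0, h3, h1, hL y h4 h5 h1 h2 h3⟩,
        fun ⟨h4, h5, h0, h2, h3, _⟩ => ⟨⟨h3, h0.ge, h2, h4, h5⟩, h0⟩⟩
    have j2 : ind (∃ y, (∀ j, 0 ≤ P j + Q j * y) ∧ P 2 + Q 2 * y = 0) =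
        ind (∃ y : ℝ, 0 ≤ y ∧ y ≤ 1 ∧ baryCoord ξ c a b (p + y • (q - p)) = 0 ∧
          0 ≤ baryCoord ξ a b c (p + y • (q - p)) ∧ 0 ≤ baryCoord ξ b c a (p + y • (q - p)) ∧
          0 < height ξ a b c (p + y • (q - p))) := by
      refine ind_congr (exists_congr fun y => ?_)
      have e : P 2 + Q 2 * y = baryCoord ξ c a b (p + y • (q - p)) := by simp [P, Q, lC]
      rw [hI, e]
      refine ⟨fun ⟨⟨h1, h2, h3, h4, h5⟩, h0⟩ => ⟨h4, h5, h0, h1, h2, hL y h4 h5 h1 h2 h3⟩,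
        fun ⟨h4, h5, h0, h2, h3, _⟩ => ⟨⟨h2, h3, h0.ge, h4, h5⟩, h0⟩⟩
    rw [i0, i1, j0, j1, j2]
    ring
  · push Not at hL
    obtain ⟨y, hy0, hy1, hA, hB, hC, hh⟩ := hL
    have hneg : ∀ z : ℝ, 0 ≤ z → z ≤ 1 → 0 ≤ baryCoord ξ a b c (p + z • (q - p)) →
        0 ≤ baryCoord ξ b c a (p + z • (q - p)) → 0 ≤ baryCoord ξ c a b (p + z • (q - p)) →
        ¬ 0 < height ξ a b c (p + z • (q - p)) := by
      intro z hz0 hz1 hA' hB' hC' hz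
      -- the zero of the height between `y` and `z`
      obtain ⟨s, t, hs, ht, hst, h0⟩ : ∃ s t : ℝ, 0 ≤ s ∧ 0 ≤ t ∧ s + t = 1 ∧
          s * height ξ a b c (p + y • (q - p)) + t * height ξ a b c (p + z • (q - p)) = 0 := by
        have hd : 0 < height ξ a b c (p + z • (q - p)) - height ξ a b c (p + y • (q - p)) := by
          linarith
        refine ⟨height ξ a b c (p + z • (q - p)) / _, -height ξ a b c (p + y • (q - p)) / _,
          div_nonneg hz.le hd.le, div_nonneg (by linarith) hd.le, ?_, ?_⟩
        · rw [← add_div, div_eq_one_iff_eq hd.ne']; ring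
        · field_simp; ring
      refine hdisj (s * y + t * z) (by positivity) ?_ ⟨?_, ?_, ?_, ?_⟩
      · calc s * y + t * z ≤ s * 1 + t * 1 := by gcongr
          _ = 1 := by linarith
      · have e : baryCoord ξ a b c (p + (s * y + t * z) • (q - p)) = s * baryCoord ξ a b c
            (p + y • (q - p)) + t * baryCoord ξ a b c (p + z • (q - p)) := by
          rw [lA, lA, lA]; linear_combination (-baryCoord ξ a b c p) * hst
        rw [e]; positivity
      · have e : baryCoord ξ b c a (p + (s * y + t * z) • (q - p)) = s * baryCoord ξ b c a
            (p + y • (q - p)) + t * baryCoord ξ b c a (p + z • (q - p)) := by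
          rw [lB, lB, lB]; linear_combination (-baryCoord ξ b c a p) * hst
        rw [e]; positivity
      · have e : baryCoord ξ c a b (p + (s * y + t * z) • (q - p)) = s * baryCoord ξ c a b
            (p + y • (q - p)) + t * baryCoord ξ c a b (p + z • (q - p)) := by
          rw [lC, lC, lC]; linear_combination (-baryCoord ξ c a b p) * hst
        rw [e]; positivity
      · rw [← h0, lL, lL, lL]; linear_combination (-height ξ a b c p) * hst
    rw [ind_neg, ind_neg, ind_neg, ind_neg, ind_neg]
    · ring
    · rintro ⟨z, h0, h1, hA, hB, hC, hh⟩
      exact hneg z h0 h1 hB hC hA.ge hh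
    · rintro ⟨z, h0, h1, hA, hB, hC, hh⟩
      exact hneg z h0 h1 hC hA.ge hB hh
    · rintro ⟨z, h0, h1, hA, hB, hC, hh⟩
      exact hneg z h0 h1 hA.ge hB hC hh
    · rintro ⟨hA, hB, hC, hh⟩
      exact hneg 1 zero_le_one le_rfl (by simpa using hA) (by simpa using hB)
        (by simpa using hC) (by simpa using hh)
    · rintro ⟨hA, hB, hC, hh⟩
      exact hneg 0 le_rfl zero_le_one (by simpa using hA) (by simpa using hB)
        (by simpa using hC) (by simpa using hh)

end Curtain

section Touching

variable {ξ a b c : E3} [DecidableEq E3]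

/-- The variant of `sum_ind_above_triangle` for a segment which starts at the midpoint of the edge
`a b` and otherwise avoids the triangle. One more end occurs, namely the starting point, exactly
when the triangle rises over the segment. -/
theorem sum_ind_above_triangle_of_touching (h : vol (b - a) (c - a) ξ ≠ 0) {m q : E3}
    (hm : m = (1 / 2 : ℝ) • a + (1 / 2 : ℝ) • b)
    (hdisj : ∀ y : ℝ, 0 < y → y ≤ 1 → m + y • (q - m) ∉ convexHull ℝ ({a, b, c} : Set E3))
    (hc : ¬ AboveSegment ξ {c} m q)
    (hq1 : ¬ Above ξ {b, c} q) (hq2 : ¬ Above ξ {c, a} q) (hq3 : baryCoord ξ c a b q ≠ 0) :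
    (0 < baryCoord ξ c a b q → height ξ a b c q ≠ 0) ∧
    ind (Above ξ {a, b, c} m) + ind (Above ξ {a, b, c} q) +
      (ind (AboveSegment ξ {b, c} m q) + ind (AboveSegment ξ {c, a} m q) +
        ind (AboveSegment ξ {a, b} m q)) =
      ind (0 < baryCoord ξ c a b q ∧ 0 < height ξ a b c q) := by
  classical
  have hbca : vol (c - b) (a - b) ξ ≠ 0 := by rwa [vol_rotate]
  have hcab : vol (a - c) (b - c) ξ ≠ 0 := by rwa [vol_rotate, vol_rotate]
  have tri := above_triangle_iff h
  have ea := above_edge_iff h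
  have eb := above_edge_iff hbca
  have ec := above_edge_iff hcab
  have hlb : ∀ x, height ξ b c a x = height ξ a b c x := height_rotate
  have hlc : ∀ x, height ξ c a b x = height ξ a b c x := fun x => by
    rw [height_rotate, height_rotate]
  have vc := fun x hb hc hx => above_vertex (x := x) hcab hb hc hx
  have lA := fun y => baryCoord_line (ξ := ξ) (a := a) (b := b) (c := c) m q y
  have lB := fun y => baryCoord_line (ξ := ξ) (a := b) (b := c) (c := a) m q y
  have lC := fun y => baryCoord_line (ξ := ξ) (a := c) (b := a) (c := b) m q y
  have lL := fun y => height_line (ξ := ξ) (a := a) (b := b) (c := c) m q y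
  have mem := mem_triangle_iff h
  obtain ⟨mA, mL⟩ := baryCoord_unique (x := m) (r := 0) h (α := 1 / 2) (β := 1 / 2) (γ := 0)
    (by norm_num) (by rw [hm]; simp)
  obtain ⟨mB, -⟩ := baryCoord_unique (x := m) (r := 0) hbca (α := 1 / 2) (β := 0) (γ := 1 / 2)
    (by norm_num) (by rw [hm]; simp [add_comm])
  obtain ⟨mC, -⟩ := baryCoord_unique (x := m) (r := 0) hcab (α := 0) (β := 1 / 2) (γ := 1 / 2)
    (by norm_num) (by rw [hm]; simp)
  simp only [hlb, hlc] at eb ec vc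
  simp only [mA, mL, mB, mC] at lA lB lC lL
  simp only [zero_add, sub_zero] at lC lL
  have z0 : m + (0 : ℝ) • (q - m) = m := by simp
  have z1 : m + (1 : ℝ) • (q - m) = q := by simp
  constructor
  · intro hCq hLq
    -- a point of the segment close to `m` lies in the triangle
    obtain ⟨y, hy0, hy1, hyA, hyB⟩ : ∃ y : ℝ, 0 < y ∧ y ≤ 1 ∧
        y * |baryCoord ξ a b c q - 1 / 2| ≤ 1 / 2 ∧ y * |baryCoord ξ b c a q - 1 / 2| ≤ 1 / 2 := by
      set s := |baryCoord ξ a b c q - 1 / 2|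
      set t := |baryCoord ξ b c a q - 1 / 2|
      have hs : 0 ≤ s := abs_nonneg _
      have ht : 0 ≤ t := abs_nonneg _
      refine ⟨1 / (2 * (1 + s + t)), by positivity, ?_, ?_, ?_⟩
      · rw [div_le_one (by positivity)]; linarith
      · rw [div_mul_eq_mul_div, div_le_iff₀ (by positivity)]; linarith
      · rw [div_mul_eq_mul_div, div_le_iff₀ (by positivity)]; linarith
    refine hdisj y hy0 hy1 ((mem _).2 ⟨?_, ?_, ?_, ?_⟩)
    · rw [lA]; nlinarith [neg_abs_le (baryCoord ξ a b c q - 1 / 2)]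
    · rw [lB]; nlinarith [neg_abs_le (baryCoord ξ b c a q - 1 / 2)]
    · rw [lC]; positivity
    · rw [lL, hLq, zero_mul]
  by_cases hpos : 0 < baryCoord ξ c a b q ∧ 0 < height ξ a b c q
  swap
  · have hno : ∀ y : ℝ, 0 ≤ y → 0 ≤ baryCoord ξ c a b (m + y • (q - m)) →
        ¬ 0 < height ξ a b c (m + y • (q - m)) := by
      intro y hy h1 h2
      rw [lC] at h1
      rw [lL] at h2
      have hy' : 0 < y := by
        rcases hy.eq_or_lt with rfl | h
        · simp at h2
        · exact h
      exact hpos ⟨lt_of_le_of_ne (nonneg_of_mul_nonneg_left h1 hy') hq3.symm,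
        pos_of_mul_pos_left h2 hy⟩
    unfold AboveSegment
    rw [ind_neg hpos, ind_neg, ind_neg, ind_neg, ind_neg, ind_neg]
    · ring
    · rintro ⟨y, h0, h1, h2⟩
      obtain ⟨hA, hB, hC, hh⟩ := (ec _).1 h2
      exact hno y h0 hA.ge hh
    · rintro ⟨y, h0, h1, h2⟩
      obtain ⟨hA, hB, hC, hh⟩ := (eb _).1 h2
      exact hno y h0 hB hh
    · rintro ⟨y, h0, h1, h2⟩
      obtain ⟨hA, hB, hC, hh⟩ := (ea _).1 h2
      exact hno y h0 hC hh
    · intro h2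
      obtain ⟨hA, hB, hC, hh⟩ := (tri _).1 h2
      exact hno 1 zero_le_one (by rwa [z1]) (by rwa [z1])
    · intro h2
      obtain ⟨hA, hB, hC, hh⟩ := (tri _).1 h2
      exact hno 0 le_rfl (by rwa [z0]) (by rwa [z0])
  rw [ind_pos hpos]
  obtain ⟨hCq, hLq⟩ := hpos
  have m0 : ind (Above ξ {a, b, c} m) = 0 := by
    refine ind_neg fun h2 => ?_
    have := ((tri _).1 h2).2.2.2
    rw [mL] at this
    exact lt_irrefl _ this
  have e0 : ind (AboveSegment ξ {a, b} m q) = 0 := by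
    refine ind_neg ?_
    rintro ⟨y, hy0, hy1, h2⟩
    obtain ⟨hA, hB, hC, hh⟩ := (ec _).1 h2
    rw [lC] at hA
    rw [lL] at hh
    rcases mul_eq_zero.1 hA with h | rfl
    · exact hq3 h
    · simp at hh
  let P : Fin 4 → ℝ := ![1 / 2, 1 / 2, 0, 1]
  let Q : Fin 4 → ℝ := ![baryCoord ξ a b c q - 1 / 2, baryCoord ξ b c a q - 1 / 2, 1, -1]
  have hI : ∀ y, (∀ j, 0 ≤ P j + Q j * y) ↔ 0 ≤ baryCoord ξ a b c (m + y • (q - m)) ∧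
      0 ≤ baryCoord ξ b c a (m + y • (q - m)) ∧ 0 ≤ y ∧ y ≤ 1 := by
    intro y
    simp [Fin.forall_fin_succ, P, Q, lA, lB]
  have hpos : ∀ y : ℝ, 0 < y → 0 < baryCoord ξ c a b (m + y • (q - m)) ∧
      0 < height ξ a b c (m + y • (q - m)) := by
    intro y hy
    rw [lC, lL]
    exact ⟨mul_pos hCq hy, mul_pos hLq hy⟩
  have ev := even_card_vanishing P Q ⟨0, fun y hy => ((hI y).1 hy).2.2.1⟩
    ⟨1, fun y hy => ((hI y).1 hy).2.2.2⟩ (by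
      intro y hy i j
      obtain ⟨h1, h2, h4, h5⟩ := (hI y).1 hy
      have hp := hpos y
      have v3 := vc (m + y • (q - m))
      have w3 : ¬ Above ξ {c} (m + y • (q - m)) := fun h => hc ⟨y, h4, h5, h⟩
      have y0 : y = 0 → m + y • (q - m) = m := by rintro rfl; exact z0
      have y1 : 1 + -y = 0 → m + y • (q - m) = q := fun h => by
        obtain rfl : y = 1 := by linarith
        exact z1
      have e0 : P 0 + Q 0 * y = baryCoord ξ a b c (m + y • (q - m)) := by simp [P, Q, lA]
      have e1 : P 1 + Q 1 * y = baryCoord ξ b c a (m + y • (q - m)) := by simp [P, Q, lB]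
      have e2 : P 2 + Q 2 * y = y := by simp [P, Q]
      have e3 : P 3 + Q 3 * y = 1 + -y := by simp [P, Q]
      rw [ea] at hq1
      rw [eb] at hq2
      clear_value P Q
      generalize m + y • (q - m) = x at *
      clear hI lA lB lC lL tri ea eb ec hlb hlc vc hdisj mem hc hpos z0 z1 hy
      fin_cases i <;> fin_cases j <;>
        simp only [Fin.zero_eta, Fin.mk_one, Fin.reduceFinMk, e0, e1, e2, e3] <;>
        intro k1 k2 <;> first | trivial | (exfalso; clear e0 e1 e2 e3; grind))
  rw [← ZMod.natCast_eq_zero_iff_even, natCast_card_filter_eq_sum_ind, Fin.sum_univ_four] at ev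
  have i0 : ind (∃ y, (∀ j, 0 ≤ P j + Q j * y) ∧ P 2 + Q 2 * y = 0) = 1 := by
    refine ind_pos ⟨0, (hI 0).2 ?_, by simp [P, Q]⟩
    rw [z0, mA, mB]; norm_num
  have i1 : ind (∃ y, (∀ j, 0 ≤ P j + Q j * y) ∧ P 3 + Q 3 * y = 0) =
      ind (Above ξ {a, b, c} q) := by
    rw [tri]
    refine ind_congr ⟨?_, fun hh => ⟨1, (hI 1).2 ?_, by simp [P, Q]⟩⟩
    · rintro ⟨y, hy, h0⟩
      obtain rfl : y = 1 := by
        have : 1 + -y = 0 := by simpa [P, Q] using h0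
        linarith
      obtain ⟨h1, h2, h4, h5⟩ := (hI 1).1 hy
      rw [z1] at *
      exact ⟨h1, h2, hCq.le, hLq⟩
    · rw [z1]; exact ⟨hh.1, hh.2.1, zero_le_one, le_rfl⟩
  have j0 : ind (∃ y, (∀ j, 0 ≤ P j + Q j * y) ∧ P 0 + Q 0 * y = 0) =
      ind (AboveSegment ξ {b, c} m q) := by
    refine ind_congr (exists_congr fun y => ?_)
    have e : P 0 + Q 0 * y = baryCoord ξ a b c (m + y • (q - m)) := by simp [P, Q, lA]
    rw [hI, e, ea]
    refine ⟨fun ⟨⟨h1, h2, h4, h5⟩, h0⟩ => ?_,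
      fun ⟨h4, h5, h0, h2, h3, _⟩ => ⟨⟨h0.ge, h2, h4, h5⟩, h0⟩⟩
    have hy : 0 < y := by
      refine lt_of_le_of_ne h4 ?_
      rintro rfl
      rw [z0, mA] at h0
      norm_num at h0
    exact ⟨h4, h5, h0, h2, (hpos y hy).1.le, (hpos y hy).2⟩
  have j1 : ind (∃ y, (∀ j, 0 ≤ P j + Q j * y) ∧ P 1 + Q 1 * y = 0) =
      ind (AboveSegment ξ {c, a} m q) := by
    refine ind_congr (exists_congr fun y => ?_)
    have e : P 1 + Q 1 * y = baryCoord ξ b c a (m + y • (q - m)) := by simp [P, Q, lB]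
    rw [hI, e, eb]
    refine ⟨fun ⟨⟨h1, h2, h4, h5⟩, h0⟩ => ?_,
      fun ⟨h4, h5, h0, h2, h3, _⟩ => ⟨⟨h3, h0.ge, h4, h5⟩, h0⟩⟩
    have hy : 0 < y := by
      refine lt_of_le_of_ne h4 ?_
      rintro rfl
      rw [z0, mB] at h0
      norm_num at h0
    exact ⟨h4, h5, h0, (hpos y hy).1.le, h1, (hpos y hy).2⟩
  rw [i0, i1, j0, j1] at ev
  rw [m0, e0]
  have two : (1 : ZMod 2) + 1 = 0 := by decide
  linear_combination ev - two

end Touching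

/-! ### Directions in general position -/

theorem vol_ne_zero_of_notMem_span {u v ξ : E3} (huv : ∀ s t : ℝ, s • u + t • v = 0 → s = 0 ∧ t = 0)
    (hξ : ξ ∉ Submodule.span ℝ {u, v}) : vol u v ξ ≠ 0 := by
  intro h0
  have cramer : ∀ w : E3, vol u v w • ξ = vol ξ v w • u + vol u ξ w • v + vol u v ξ • w := by
    intro w
    apply ext_E3 <;>
    · simp only [vol, PiLp.add_apply, PiLp.smul_apply, smul_eq_mul]; ring
  have hz : ∀ w : E3, vol u v w = 0 := by
    intro w
    by_contra hw
    refine hξ (Submodule.mem_span_pair.2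
      ⟨(vol u v w)⁻¹ * vol ξ v w, (vol u v w)⁻¹ * vol u ξ w, ?_⟩)
    have := cramer w
    rw [h0, zero_smul, add_zero] at this
    rw [mul_smul, mul_smul, ← smul_add, ← this, smul_smul, inv_mul_cancel₀ hw, one_smul]
  have c0 := hz (EuclideanSpace.single 0 1)
  have c1 := hz (EuclideanSpace.single 1 1)
  have c2 := hz (EuclideanSpace.single 2 1)
  simp [vol] at c0 c1 c2
  have d0 := huv (v 0) (-u 0) (ext_E3 (by simp; ring) (by simp; linarith) (by simp; linarith))
  have d1 := huv (v 1) (-u 1) (ext_E3 (by simp; linarith) (by simp; ring) (by simp; linarith))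
  have d2 := huv (v 2) (-u 2) (ext_E3 (by simp; linarith) (by simp; linarith) (by simp; ring))
  have hu : u = 0 := ext_E3 (by simpa using d0.2) (by simpa using d1.2) (by simpa using d2.2)
  have := (huv 1 0 (by simp [hu])).1
  norm_num at this

/-- Some direction is not parallel to any of the planes spanned by pairs of differences of finitely
many points. -/
theorem exists_direction_in_general_position (V : Finset E3) :
    ∃ ξ : E3, ∀ x ∈ V, ∀ y ∈ V, ∀ z ∈ V, ∀ w ∈ V, ξ ∉ Submodule.span ℝ {x - y, z - w} := by
  classical
  let S : Finset (Submodule ℝ E3) := (V ×ˢ V ×ˢ V ×ˢ V).image fun p =>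
    Submodule.span ℝ {p.1 - p.2.1, p.2.2.1 - p.2.2.2}
  have hS : ⊤ ∉ S := by
    intro hS
    obtain ⟨p, -, hp⟩ := Finset.mem_image.1 hS
    have h1 : Module.finrank ℝ (Submodule.span ℝ {p.1 - p.2.1, p.2.2.1 - p.2.2.2}) ≤ 2 := by
      have := finrank_span_finset_le_card (R := ℝ)
        ({p.1 - p.2.1, p.2.2.1 - p.2.2.2} : Finset E3)
      rw [Finset.coe_pair] at this
      exact this.trans Finset.card_le_two
    rw [hp, finrank_top, finrank_euclideanSpace_fin] at h1
    omega
  have := Subspace.biUnion_ne_univ_of_top_notMem hS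
  obtain ⟨ξ, hξ⟩ := (Set.ne_univ_iff_exists_notMem _).1 this
  refine ⟨ξ, fun x hx y hy z hz w hw h => hξ ?_⟩
  simp only [Set.mem_iUnion]
  exact ⟨_, Finset.mem_image.2 ⟨(x, y, z, w), by simp [hx, hy, hz, hw], rfl⟩, h⟩

/-! ### Orientability of closed surfaces in three-space -/

section Orientation

variable [DecidableEq E3] {K : Cplx}

omit [DecidableEq E3] in
theorem eq_zero_of_affine_relation {s : Finset E3} (hs : s ∈ K.faces) (w : E3 → ℝ)
    (h0 : ∑ x ∈ s, w x = 0) (h1 : ∑ x ∈ s, w x • x = 0) : ∀ x ∈ s, w x = 0 := by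
  intro x hx
  have := (affineIndependent_iff.1 (K.indep hs)) Finset.univ (fun y => w y.1)
    (by rw [Finset.sum_coe_sort s w]; exact h0)
    (by rw [Finset.sum_coe_sort s fun y => w y • y]; exact h1) ⟨x, hx⟩ (Finset.mem_univ _)
  exact this

/-- If a point of the simplex `s` lies in the simplex `t` too, then `t` contains all corners of `s`
which have a nonzero weight at this point. -/
theorem mem_of_weight_ne_zero {s t : Finset E3} (hs : s ∈ K.faces) (ht : t ∈ K.faces)
    (w : E3 → ℝ) (hw0 : ∀ x ∈ s, 0 ≤ w x) (hw1 : ∑ x ∈ s, w x = 1)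
    (hx : ∑ x ∈ s, w x • x ∈ convexHull ℝ (t : Set E3)) : ∀ x ∈ s, w x ≠ 0 → x ∈ t := by
  have hxs : ∑ x ∈ s, w x • x ∈ convexHull ℝ (s : Set E3) :=
    Finset.mem_convexHull'.2 ⟨w, hw0, hw1, rfl⟩
  have h := K.inter_subset_convexHull hs ht ⟨hxs, hx⟩
  rw [← Finset.coe_inter, Finset.mem_convexHull'] at h
  obtain ⟨w', -, hw1', hw'⟩ := h
  have e1 : ∑ x ∈ s, (if x ∈ t then w' x else 0) = 1 := by
    rw [← Finset.sum_filter, Finset.filter_mem_eq_inter, hw1']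
  have e2 : ∑ x ∈ s, (if x ∈ t then w' x else 0) • x = ∑ x ∈ s, w x • x := by
    rw [← hw', ← Finset.filter_mem_eq_inter, Finset.sum_filter]
    exact Finset.sum_congr rfl fun x _ => by split_ifs <;> simp
  have h0 := eq_zero_of_affine_relation hs (fun x => w x - if x ∈ t then w' x else 0)
    (by rw [Finset.sum_sub_distrib, hw1, e1, sub_self])
    (by simp only [sub_smul]; rw [Finset.sum_sub_distrib, e2, sub_self])
  intro x hxs hne
  by_contra hxt
  have := h0 x hxs
  simp only [hxt, if_false, sub_zero] at this
  exact hne this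

theorem sum_triple {R : Type*} [AddCommMonoid R] {a b c : E3} (hab : a ≠ b) (hac : a ≠ c)
    (hbc : b ≠ c) (f : E3 → R) : ∑ x ∈ ({a, b, c} : Finset E3), f x = f a + (f b + f c) := by
  rw [Finset.sum_insert (by simp [hab, hac]), Finset.sum_pair hbc]

theorem mem_of_weights_pos {a b c : E3} (hab : a ≠ b) (hac : a ≠ c) (hbc : b ≠ c)
    (hs : {a, b, c} ∈ K.faces) {t : Finset E3} (ht : t ∈ K.faces) {α β γ : ℝ} (hα : 0 < α)
    (hβ : 0 < β) (hγ : 0 ≤ γ) (h1 : α + β + γ = 1)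
    (hx : α • a + β • b + γ • c ∈ convexHull ℝ (t : Set E3)) :
    a ∈ t ∧ b ∈ t ∧ (0 < γ → c ∈ t) := by
  let w : E3 → ℝ := fun x => if x = a then α else if x = b then β else γ
  have wa : w a = α := if_pos rfl
  have wb : w b = β := by simp [w, hab.symm]
  have wc : w c = γ := by simp [w, hac.symm, hbc.symm]
  have key := mem_of_weight_ne_zero hs ht w (by
      intro x _
      simp only [w]
      split_ifs <;> linarith)
    (by rw [sum_triple hab hac hbc, wa, wb, wc]; linarith)
    (by rw [sum_triple hab hac hbc, wa, wb, wc, ← add_assoc]; exact hx)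
  refine ⟨key a (by simp) (by rw [wa]; exact hα.ne'), key b (by simp) (by rw [wb]; exact hβ.ne'),
    fun h => key c (by simp) (by rw [wc]; exact h.ne')⟩

theorem linearIndependent_edges {a b c : E3} (hab : a ≠ b) (hac : a ≠ c) (hbc : b ≠ c)
    (hs : {a, b, c} ∈ K.faces) (s t : ℝ) (h : s • (b - a) + t • (c - a) = 0) : s = 0 ∧ t = 0 := by
  let w : E3 → ℝ := fun x => if x = a then -(s + t) else if x = b then s else t
  have wa : w a = -(s + t) := if_pos rfl
  have wb : w b = s := by simp [w, hab.symm]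
  have wc : w c = t := by simp [w, hac.symm, hbc.symm]
  have key := eq_zero_of_affine_relation hs w
    (by rw [sum_triple hab hac hbc, wa, wb, wc]; ring)
    (by rw [sum_triple hab hac hbc, wa, wb, wc, ← h]; module)
  exact ⟨wb ▸ key b (by simp), wc ▸ key c (by simp)⟩

theorem sum_powersetCard_two {R : Type*} [AddCommMonoid R] {a b c : E3} (hab : a ≠ b) (hac : a ≠ c)
    (hbc : b ≠ c) (g : Finset E3 → R) :
    ∑ f ∈ Finset.powersetCard 2 ({a, b, c} : Finset E3), g f
      = g {b, c} + g {c, a} + g {a, b} := by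
  have h : Finset.powersetCard 2 ({a, b, c} : Finset E3) = {{b, c}, {c, a}, {a, b}} := by
    have hsub : ({{b, c}, {c, a}, {a, b}} : Finset (Finset E3)) ⊆
        Finset.powersetCard 2 ({a, b, c} : Finset E3) := by
      intro f hf
      simp only [Finset.mem_insert, Finset.mem_singleton] at hf
      rw [Finset.mem_powersetCard]
      rcases hf with rfl | rfl | rfl
      · exact ⟨by intro x; simp; tauto, Finset.card_pair hbc⟩
      · exact ⟨by intro x; simp; tauto, Finset.card_pair hac.symm⟩
      · exact ⟨by intro x; simp; tauto, Finset.card_pair hab⟩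
    refine (Finset.eq_of_subset_of_card_le hsub ?_).symm
    rw [Finset.card_powersetCard, Finset.card_eq_three.2 ⟨a, b, c, hab, hac, hbc, rfl⟩]
    have h3 : ({{b, c}, {c, a}, {a, b}} : Finset (Finset E3)).card = 3 := by
      refine Finset.card_eq_three.2 ⟨_, _, _, ?_, ?_, ?_, rfl⟩
      · intro h; have : b ∈ ({c, a} : Finset E3) := h ▸ by simp
        simp [hbc, hab.symm] at this
      · intro h; have : c ∈ ({a, b} : Finset E3) := h ▸ by simp
        simp [hac.symm, hbc.symm] at this
      · intro h; have : c ∈ ({a, b} : Finset E3) := h ▸ by simp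
        simp [hac.symm, hbc.symm] at this
    rw [h3]
    rfl
  rw [h, Finset.sum_insert, Finset.sum_pair, add_assoc]
  · intro h; have : c ∈ ({a, b} : Finset E3) := h ▸ by simp
    simp [hac.symm, hbc.symm] at this
  · simp only [Finset.mem_insert, Finset.mem_singleton, not_or]
    constructor
    · intro h; have : b ∈ ({c, a} : Finset E3) := h ▸ by simp
      simp [hbc, hab.symm] at this
    · intro h; have : c ∈ ({a, b} : Finset E3) := h ▸ by simp
      simp [hac.symm, hbc.symm] at this

/-- The barycenter of a finite set of three points. -/
noncomputable def center (t : Finset E3) : E3 := (1 / 3 : ℝ) • ∑ x ∈ t, x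

theorem center_triple {a b c : E3} (hab : a ≠ b) (hac : a ≠ c) (hbc : b ≠ c) :
    center {a, b, c} = (1 / 3 : ℝ) • a + (1 / 3 : ℝ) • b + (1 / 3 : ℝ) • c := by
  rw [center, sum_triple hab hac hbc]; module

/-- The midpoint of two points. -/
noncomputable def mid (a b : E3) : E3 := (1 / 2 : ℝ) • a + (1 / 2 : ℝ) • b

/-- The vertices, the midpoints of edges and the barycenters of a set of triangles. -/
noncomputable def markedPoints (M : Finset (Finset E3)) : Finset E3 :=
  M.biUnion id ∪ M.image center ∪
    (M.biUnion id ×ˢ M.biUnion id).image fun p => mid p.1 p.2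

variable {M : Finset (Finset E3)} {ξ : E3}

/-- `ξ` is in general position to the marked points of `M`. -/
def InGeneralPosition (M : Finset (Finset E3)) (ξ : E3) : Prop :=
  ∀ x ∈ markedPoints M, ∀ y ∈ markedPoints M, ∀ z ∈ markedPoints M, ∀ w ∈ markedPoints M,
    ξ ∉ Submodule.span ℝ {x - y, z - w}

theorem vertex_mem_markedPoints {t : Finset E3} (ht : t ∈ M) {x : E3} (hx : x ∈ t) :
    x ∈ markedPoints M := by
  simp only [markedPoints, Finset.mem_union, Finset.mem_biUnion]
  exact Or.inl (Or.inl ⟨t, ht, hx⟩)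

theorem center_mem_markedPoints {t : Finset E3} (ht : t ∈ M) : center t ∈ markedPoints M := by
  simp only [markedPoints, Finset.mem_union, Finset.mem_image]
  exact Or.inl (Or.inr ⟨t, ht, rfl⟩)

theorem mid_mem_markedPoints {t : Finset E3} (ht : t ∈ M) {x y : E3} (hx : x ∈ t) (hy : y ∈ t) :
    mid x y ∈ markedPoints M := by
  simp only [markedPoints, Finset.mem_union, Finset.mem_image, Finset.mem_product,
    Finset.mem_biUnion]
  exact Or.inr ⟨(x, y), ⟨⟨t, ht, hx⟩, ⟨t, ht, hy⟩⟩, rfl⟩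

theorem InGeneralPosition.vol_ne_zero (hξ : InGeneralPosition M ξ) (hM : ∀ t ∈ M, t ∈ K.faces)
    {a b c : E3} (hab : a ≠ b) (hac : a ≠ c) (hbc : b ≠ c) (h : {a, b, c} ∈ M) :
    vol (b - a) (c - a) ξ ≠ 0 :=
  vol_ne_zero_of_notMem_span (linearIndependent_edges hab hac hbc (hM _ h))
    (hξ _ (vertex_mem_markedPoints h (by simp)) _ (vertex_mem_markedPoints h (by simp))
      _ (vertex_mem_markedPoints h (by simp)) _ (vertex_mem_markedPoints h (by simp)))

theorem InGeneralPosition.not_aboveSegment_vertex (hξ : InGeneralPosition M ξ) {p q v : E3}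
    (hp : p ∈ markedPoints M) (hq : q ∈ markedPoints M) (hv : v ∈ markedPoints M) :
    ¬ AboveSegment ξ {v} p q := by
  rintro ⟨y, -, -, r, hr, h⟩
  rw [Finset.coe_singleton, convexHull_singleton, Set.mem_singleton_iff] at h
  refine hξ v hv p hp q hq p hp (Submodule.mem_span_pair.2 ⟨r⁻¹, -(r⁻¹ * y), ?_⟩)
  rw [← h, neg_smul, mul_smul, ← sub_eq_add_neg, ← smul_sub,
    show p + y • (q - p) + r • ξ - p - y • (q - p) = r • ξ by abel, smul_smul,
    inv_mul_cancel₀ hr.ne', one_smul]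

theorem InGeneralPosition.not_above_edge (hξ : InGeneralPosition M ξ) {p u v : E3}
    (hp : p ∈ markedPoints M) (hu : u ∈ markedPoints M) (hv : v ∈ markedPoints M) :
    ¬ Above ξ {u, v} p := by
  rintro ⟨r, hr, h⟩
  rw [Finset.coe_pair, mem_convexHull_pair_iff] at h
  obtain ⟨α, β, -, -, hs, h⟩ := h
  refine hξ u hu p hp v hv u hu (Submodule.mem_span_pair.2 ⟨r⁻¹, r⁻¹ * β, ?_⟩)
  obtain rfl : α = 1 - β := by linarith
  have : r • ξ = (u - p) + β • (v - u) := by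
    rw [← sub_eq_of_eq_add' h]; module
  rw [mul_smul, ← smul_add, ← this, smul_smul, inv_mul_cancel₀ hr.ne', one_smul]

/-- Modulo two, the number of triangles above a point. -/
noncomputable def numAbove (M : Finset (Finset E3)) (ξ x : E3) : ZMod 2 :=
  ∑ t ∈ M, ind (Above ξ t x)

theorem sum_sum_edges_eq_zero
    (h2 : ∀ t ∈ M, ∀ e ⊆ t, e.card = 2 → (M.filter fun t' => e ⊆ t').card = 2)
    (g : Finset E3 → ZMod 2) : ∑ t ∈ M, ∑ f ∈ Finset.powersetCard 2 t, g f = 0 := by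
  rw [Finset.sum_comm' (t' := M.biUnion (Finset.powersetCard 2))
    (s' := fun f => M.filter fun t => f ∈ Finset.powersetCard 2 t)
    (fun t f => by simp only [Finset.mem_filter, Finset.mem_biUnion]; tauto)]
  refine Finset.sum_eq_zero fun f hf => ?_
  obtain ⟨t, ht, hft⟩ := Finset.mem_biUnion.1 hf
  rw [Finset.mem_powersetCard] at hft
  have h := h2 t ht f hft.1 hft.2
  simp only [Finset.mem_powersetCard, hft.2, and_true, Finset.sum_const, h, two_nsmul]
  exact CharTwo.add_self_eq_zero _

/-- Going from the barycenter of a triangle of a closed surface to the midpoint of one of its edges,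
the number of triangles above changes parity exactly when the neighbouring triangle rises over the
path. The other triangles contribute evenly, by `sum_ind_above_triangle`, because every edge lies in
two of them. -/
theorem numAbove_center_add_numAbove_mid (hM : ∀ t ∈ M, t ∈ K.faces) (h3 : ∀ t ∈ M, t.card = 3)
    (h2 : ∀ t ∈ M, ∀ e ⊆ t, e.card = 2 → (M.filter fun t' => e ⊆ t').card = 2)
    (hξ : InGeneralPosition M ξ) {a b c d : E3} (hab : a ≠ b) (hac : a ≠ c) (hbc : b ≠ c)
    (had : a ≠ d) (hbd : b ≠ d) (hcd : c ≠ d) (hc : {a, b, c} ∈ M) (hd : {a, b, d} ∈ M) :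
    (0 < baryCoord ξ d a b (center {a, b, c}) → height ξ a b d (center {a, b, c}) ≠ 0) ∧
    numAbove M ξ (center {a, b, c}) + numAbove M ξ (mid a b) =
      ind (0 < baryCoord ξ d a b (center {a, b, c}) ∧ 0 < height ξ a b d (center {a, b, c})) := by
  set q := center {a, b, c} with hq
  set m := mid a b with hm
  have hqm : q ∈ markedPoints M := center_mem_markedPoints hc
  have hmm : m ∈ markedPoints M := mid_mem_markedPoints hc (by simp) (by simp)
  have hΔc := hξ.vol_ne_zero hM hab hac hbc hc
  have hΔd := hξ.vol_ne_zero hM hab had hbd hd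
  have hpt : ∀ y : ℝ, m + y • (q - m) =
      (1 / 2 - y / 6) • a + (1 / 2 - y / 6) • b + (y / 3) • c := by
    intro y
    rw [hm, mid, hq, center_triple hab hac hbc]; module
  have hmem : ∀ t ∈ M, ∀ y : ℝ, 0 ≤ y → y ≤ 1 → m + y • (q - m) ∈ convexHull ℝ (t : Set E3) →
      a ∈ t ∧ b ∈ t ∧ (0 < y → c ∈ t) := by
    intro t ht y hy0 hy1 h
    rw [hpt] at h
    obtain ⟨h1, h2, h4⟩ := mem_of_weights_pos hab hac hbc (hM _ hc) (hM _ ht) (by linarith)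
      (by linarith) (by linarith) (by ring) h
    exact ⟨h1, h2, fun h => h4 (by linarith)⟩
  have touch := sum_ind_above_triangle_of_touching hΔd (m := m) (q := q) rfl
    (by
      intro y hy0 hy1 h
      have := (hmem _ hd y hy0.le hy1 (by simpa using h)).2.2 hy0
      simp only [Finset.mem_insert, Finset.mem_singleton] at this
      rcases this with h | h | h
      · exact hac h.symm
      · exact hbc h.symm
      · exact hcd h)
    (hξ.not_aboveSegment_vertex hmm hqm (vertex_mem_markedPoints hd (by simp)))
    (hξ.not_above_edge hqm (vertex_mem_markedPoints hd (by simp))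
      (vertex_mem_markedPoints hd (by simp)))
    (hξ.not_above_edge hqm (vertex_mem_markedPoints hd (by simp))
      (vertex_mem_markedPoints hd (by simp)))
    (by
      have e : vol (a - q) (b - q) ξ = 1 / 3 * vol (b - a) (c - a) ξ := by
        rw [hq, center_triple hab hac hbc]
        simp only [vol, PiLp.sub_apply, PiLp.add_apply, PiLp.smul_apply, smul_eq_mul]; ring
      unfold baryCoord
      rw [e, vol_rotate ξ b d a, vol_rotate ξ a b d]
      exact div_ne_zero (mul_ne_zero (by norm_num) hΔc) hΔd)
  refine ⟨touch.1, ?_⟩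
  rw [← touch.2]
  have total : ∑ t ∈ M, (ind (Above ξ t m) + ind (Above ξ t q) +
      ∑ f ∈ Finset.powersetCard 2 t, ind (AboveSegment ξ f m q)) =
      numAbove M ξ q + numAbove M ξ m := by
    rw [Finset.sum_add_distrib, Finset.sum_add_distrib,
      sum_sum_edges_eq_zero h2 fun f => ind (AboveSegment ξ f m q), add_zero, add_comm]
    rfl
  rw [← total, Finset.sum_eq_single_of_mem _ hd, sum_powersetCard_two hab had hbd]
  intro t ht htd
  by_cases htc : t = {a, b, c}
  · -- nothing of a triangle lies above its own points
    have hno : ∀ y : ℝ, 0 ≤ y → y ≤ 1 → ∀ f ⊆ t, ¬ Above ξ f (m + y • (q - m)) := by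
      rintro y hy0 hy1 f hf ⟨r, hr, hx⟩
      have hx : Above ξ {a, b, c} (m + y • (q - m)) :=
        ⟨r, hr, convexHull_mono (Finset.coe_subset.2 (htc ▸ hf)) hx⟩
      have h1 := ((above_triangle_iff hΔc _).1 hx).2.2.2
      have h2 := ((mem_triangle_iff hΔc (m + y • (q - m))).1
        (mem_convexHull_triple_iff.2 ⟨_, _, _, by linarith, by linarith, by linarith, by ring,
          (hpt y).symm⟩)).2.2.2
      exact h1.ne' h2
    have hno0 := hno 0 le_rfl zero_le_one t Finset.Subset.rfl
    have hno1 := hno 1 zero_le_one le_rfl t Finset.Subset.rfl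
    rw [zero_smul, add_zero] at hno0
    rw [one_smul, add_sub_cancel] at hno1
    rw [ind_neg hno0, ind_neg hno1, Finset.sum_eq_zero, add_zero, add_zero]
    intro f hf
    refine ind_neg ?_
    rintro ⟨y, hy0, hy1, h⟩
    exact hno y hy0 hy1 f (Finset.mem_powersetCard.1 hf).1 h
  · obtain ⟨u, v, w, huv, huw, hvw, rfl⟩ := Finset.card_eq_three.1 (h3 t ht)
    rw [sum_powersetCard_two huv huw hvw]
    have hu := vertex_mem_markedPoints ht (x := u) (by simp)
    have hv := vertex_mem_markedPoints ht (x := v) (by simp)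
    have hw := vertex_mem_markedPoints ht (x := w) (by simp)
    refine sum_ind_above_triangle (hξ.vol_ne_zero hM huv huw hvw ht) ?_
      (hξ.not_aboveSegment_vertex hmm hqm hu) (hξ.not_aboveSegment_vertex hmm hqm hv)
      (hξ.not_aboveSegment_vertex hmm hqm hw) (hξ.not_above_edge hmm hv hw)
      (hξ.not_above_edge hmm hw hu) (hξ.not_above_edge hmm hu hv)
      (hξ.not_above_edge hqm hv hw) (hξ.not_above_edge hqm hw hu) (hξ.not_above_edge hqm hu hv)
    intro y hy0 hy1 h
    obtain ⟨h1, h2', -⟩ := hmem _ ht y hy0 hy1 (by simpa using h)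
    -- only two triangles contain the edge
    have hcard := h2 _ hc {a, b} (by intro x; simp; tauto) (Finset.card_pair hab)
    have hsub : ({{a, b, c}, {a, b, d}, {u, v, w}} : Finset (Finset E3)) ⊆
        M.filter fun t' => {a, b} ⊆ t' := by
      intro t' ht'
      rw [Finset.mem_insert, Finset.mem_insert, Finset.mem_singleton] at ht'
      rw [Finset.mem_filter]
      rcases ht' with rfl | rfl | rfl
      · exact ⟨hc, by intro x; simp; tauto⟩
      · exact ⟨hd, by intro x; simp; tauto⟩
      · exact ⟨ht, by rw [Finset.insert_subset_iff]; exact ⟨h1, by simpa using h2'⟩⟩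
    have h4 := Finset.card_le_card hsub
    rw [hcard, Finset.card_eq_three.2 ⟨_, _, _, ?_, Ne.symm htc, Ne.symm htd, rfl⟩] at h4
    · omega
    · intro h
      have : c ∈ ({a, b, d} : Finset E3) := h ▸ by simp
      simp [hac.symm, hbc.symm, hcd] at this

/-- Two triangles of a closed surface which share the edge `a b` have numbers of triangles above
them of different parity exactly when they lie on the same side of `a b`, seen along `ξ`. -/
theorem numAbove_center_add_numAbove_center (hM : ∀ t ∈ M, t ∈ K.faces)
    (h3 : ∀ t ∈ M, t.card = 3)
    (h2 : ∀ t ∈ M, ∀ e ⊆ t, e.card = 2 → (M.filter fun t' => e ⊆ t').card = 2)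
    (hξ : InGeneralPosition M ξ) {a b c d : E3} (hab : a ≠ b) (hac : a ≠ c) (hbc : b ≠ c)
    (had : a ≠ d) (hbd : b ≠ d) (hcd : c ≠ d) (hc : {a, b, c} ∈ M) (hd : {a, b, d} ∈ M) :
    numAbove M ξ (center {a, b, c}) + numAbove M ξ (center {a, b, d}) =
      ind (0 < vol (b - a) (c - a) ξ * vol (b - a) (d - a) ξ) := by
  obtain ⟨n1, s1⟩ := numAbove_center_add_numAbove_mid hM h3 h2 hξ hab hac hbc had hbd hcd hc hd
  obtain ⟨n2, s2⟩ := numAbove_center_add_numAbove_mid hM h3 h2 hξ hab had hbd hac hbc hcd.symm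
    hd hc
  have hΔc := hξ.vol_ne_zero hM hab hac hbc hc
  have hΔd := hξ.vol_ne_zero hM hab had hbd hd
  have bary : ∀ c d : E3, a ≠ c → b ≠ c → baryCoord ξ d a b (center {a, b, c}) =
      1 / 3 * (vol (b - a) (c - a) ξ / vol (b - a) (d - a) ξ) := by
    intro c d hac hbc
    unfold baryCoord
    rw [vol_rotate ξ b d a, vol_rotate ξ a b d, ← mul_div_assoc, center_triple hab hac hbc]
    congr 1
    simp only [vol, PiLp.sub_apply, PiLp.add_apply, PiLp.smul_apply, smul_eq_mul]; ring
  have hei : ∀ c d : E3, a ≠ c → b ≠ c → height ξ a b d (center {a, b, c}) =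
      1 / 3 * (vol (b - a) (c - a) (d - a) / vol (b - a) (d - a) ξ) := by
    intro c d hac hbc
    unfold height
    rw [← mul_div_assoc, center_triple hab hac hbc]
    congr 1
    simp only [vol, PiLp.sub_apply, PiLp.add_apply, PiLp.smul_apply, smul_eq_mul]; ring
  have hW : vol (b - a) (d - a) (c - a) = - vol (b - a) (c - a) (d - a) := by
    simp only [vol]; ring
  rw [bary c d hac hbc, hei c d hac hbc] at n1 s1
  rw [bary d c had hbd, hei d c had hbd, hW] at n2 s2
  have e : numAbove M ξ (center {a, b, c}) + numAbove M ξ (center {a, b, d}) =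
      (numAbove M ξ (center {a, b, c}) + numAbove M ξ (mid a b)) +
      (numAbove M ξ (center {a, b, d}) + numAbove M ξ (mid a b)) := by
    linear_combination - CharTwo.add_self_eq_zero (numAbove M ξ (mid a b))
  rw [e, s1, s2]
  clear e s1 s2
  generalize vol (b - a) (c - a) ξ = x at *
  generalize vol (b - a) (d - a) ξ = y at *
  generalize vol (b - a) (c - a) (d - a) = z at *
  have third : (0 : ℝ) < 1 / 3 := by norm_num
  simp only [mul_pos_iff_of_pos_left third, ne_eq, mul_eq_zero, third.ne', false_or] at n1 n2 ⊢
  rcases lt_or_gt_of_ne hΔc with hx | hx <;> rcases lt_or_gt_of_ne hΔd with hy | hy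
  · have hz : z ≠ 0 := by
      rintro rfl
      exact n1 (div_pos_of_neg_of_neg hx hy) (by simp)
    rw [ind_pos (mul_pos_of_neg_of_neg hx hy)]
    rcases lt_or_gt_of_ne hz with hz | hz
    · rw [ind_pos ⟨div_pos_of_neg_of_neg hx hy, div_pos_of_neg_of_neg hz hy⟩, ind_neg, add_zero]
      exact fun h => absurd h.2 (not_lt.2 (div_nonpos_of_nonneg_of_nonpos (by linarith) hx.le))
    · rw [ind_neg, ind_pos ⟨div_pos_of_neg_of_neg hy hx, div_pos_of_neg_of_neg (by linarith) hx⟩,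
        zero_add]
      exact fun h => absurd h.2 (not_lt.2 (div_nonpos_of_nonneg_of_nonpos (by linarith) hy.le))
  · rw [ind_neg fun h => absurd h.1 (not_lt.2 (div_nonpos_of_nonpos_of_nonneg hx.le hy.le)),
      ind_neg fun h => absurd h.1 (not_lt.2 (div_nonpos_of_nonneg_of_nonpos hy.le hx.le)),
      ind_neg (not_lt.2 (mul_nonpos_of_nonpos_of_nonneg hx.le hy.le)), add_zero]
  · rw [ind_neg fun h => absurd h.1 (not_lt.2 (div_nonpos_of_nonneg_of_nonpos hx.le hy.le)),
      ind_neg fun h => absurd h.1 (not_lt.2 (div_nonpos_of_nonpos_of_nonneg hy.le hx.le)),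
      ind_neg (not_lt.2 (mul_nonpos_of_nonneg_of_nonpos hx.le hy.le)), add_zero]
  · have hz : z ≠ 0 := by
      rintro rfl
      exact n1 (div_pos hx hy) (by simp)
    rw [ind_pos (mul_pos hx hy)]
    rcases lt_or_gt_of_ne hz with hz | hz
    · rw [ind_neg, ind_pos ⟨div_pos hy hx, div_pos (by linarith) hx⟩, zero_add]
      exact fun h => absurd h.2 (not_lt.2 (div_nonpos_of_nonpos_of_nonneg (by linarith) hy.le))
    · rw [ind_pos ⟨div_pos hx hy, div_pos hz hy⟩, ind_neg, add_zero]
      exact fun h => absurd h.2 (not_lt.2 (div_nonpos_of_nonpos_of_nonneg (by linarith) hx.le))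

/-- A closed surface in three-space is orientable, and so has even Euler characteristic. -/
theorem even_eulerChar_of_closed_surface (hM : ∀ t ∈ M, t ∈ K.faces) (h3 : ∀ t ∈ M, t.card = 3)
    (h2 : ∀ t ∈ M, ∀ e ⊆ t, e.card = 2 → (M.filter fun t' => e ⊆ t').card = 2)
    (hlink : ∀ v, ∀ t ∈ M, v ∈ t → ∀ t' ∈ M, v ∈ t' → Relation.ReflTransGen
      (fun a b => a ∈ M ∧ b ∈ M ∧ v ∈ a ∧ v ∈ b ∧ ∃ w, w ≠ v ∧ w ∈ a ∧ w ∈ b) t t') :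
    Even (((M.biUnion id).card : ℤ) - ((M.biUnion (Finset.powersetCard 2)).card : ℤ) + M.card) := by
  obtain ⟨ξ, hξ⟩ := exists_direction_in_general_position (markedPoints M)
  have hξ : InGeneralPosition M ξ := hξ
  -- the parity of the number of triangles above chooses one of the two sides of a triangle
  let ε : Finset E3 → ℝ := fun t => if numAbove M ξ (center t) = 0 then 1 else -1
  have hε : ∀ t, ε t = 1 ∨ ε t = -1 := fun t => by
    simp only [ε]; split_ifs <;> simp
  have third_unique : ∀ {a b c c' : E3}, c ≠ a → c ≠ b →
      ({a, b, c} : Finset E3) = {a, b, c'} → c = c' := by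
    intro a b c c' h1 h2 h
    have : c ∈ ({a, b, c'} : Finset E3) := h ▸ by simp
    simpa [h1, h2] using this
  have third : ∀ t ∈ M, ∀ a ∈ t, ∀ b ∈ t, a ≠ b → ∃ c, t = {a, b, c} ∧ b ≠ c ∧ a ≠ c := by
    intro t ht a ha b hb hab
    have hb' : b ∈ t.erase a := Finset.mem_erase.2 ⟨hab.symm, hb⟩
    have h1 : ((t.erase a).erase b).card = 1 := by
      rw [Finset.card_erase_of_mem hb', Finset.card_erase_of_mem ha, h3 t ht]
    obtain ⟨c, hc⟩ := Finset.card_eq_one.1 h1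
    have hcm : c ∈ (t.erase a).erase b := hc ▸ Finset.mem_singleton_self c
    simp only [Finset.mem_erase] at hcm
    refine ⟨c, ?_, hcm.1.symm, hcm.2.1.symm⟩
    rw [← hc, Finset.insert_erase hb', Finset.insert_erase ha]
  refine even_eulerChar_of_coherent_orientation M h3 h2 hlink
    (fun t a b => ∃ c, t = {a, b, c} ∧ 0 < ε t * vol (b - a) (c - a) ξ) ?_ ?_ ?_
  · rintro t ht a b c rfl hab hbc hac ⟨c', hc', hpos⟩
    obtain rfl := third_unique hac.symm hbc.symm hc'
    refine ⟨a, by ext; simp; tauto, ?_⟩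
    rwa [vol_rotate]
  · intro t ht a ha b hb hab
    obtain ⟨c, rfl, hbc, hac⟩ := third t ht a ha b hb hab
    have hΔ := hξ.vol_ne_zero hM hab hac hbc ht
    have hneg : vol (a - b) (c - b) ξ = - vol (b - a) (c - a) ξ := by
      simp only [vol, PiLp.sub_apply]; ring
    have h0 : ε {a, b, c} * vol (b - a) (c - a) ξ ≠ 0 := by
      rcases hε {a, b, c} with h | h <;> rw [h] <;> simpa using hΔ
    constructor
    · rintro ⟨c', hc', h⟩ ⟨c'', hc'', h'⟩
      obtain rfl := third_unique hac.symm hbc.symm hc'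
      obtain rfl := third_unique hbc.symm hac.symm ((Finset.insert_comm b a {c}).trans hc'')
      rw [hneg] at h'
      linarith
    · intro h
      refine ⟨c, rfl, ?_⟩
      by_contra hn
      refine h ⟨c, Finset.insert_comm a b {c}, ?_⟩
      rw [hneg, mul_neg]
      exact neg_pos.2 (lt_of_le_of_ne (not_lt.1 hn) h0)
  · intro t ht t' ht' htt a ha b hb ha' hb' hab
    obtain ⟨c, rfl, hbc, hac⟩ := third t ht a ha b hb hab
    obtain ⟨d, rfl, hbd, had⟩ := third t' ht' a ha' b hb' hab
    have hcd : c ≠ d := by rintro rfl; exact htt rfl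
    have key := numAbove_center_add_numAbove_center hM h3 h2 hξ hab hac hbc had hbd hcd ht ht'
    have hΔc := hξ.vol_ne_zero hM hab hac hbc ht
    have hΔd := hξ.vol_ne_zero hM hab had hbd ht'
    have w1 : (∃ c', ({a, b, c} : Finset E3) = {a, b, c'} ∧
        0 < ε {a, b, c} * vol (b - a) (c' - a) ξ) ↔
        0 < ε {a, b, c} * vol (b - a) (c - a) ξ :=
      ⟨fun ⟨c', hc', h⟩ => third_unique hac.symm hbc.symm hc' ▸ h, fun h => ⟨c, rfl, h⟩⟩
    have w2 : (∃ c', ({a, b, d} : Finset E3) = {a, b, c'} ∧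
        0 < ε {a, b, d} * vol (b - a) (c' - a) ξ) ↔
        0 < ε {a, b, d} * vol (b - a) (d - a) ξ :=
      ⟨fun ⟨c', hc', h⟩ => third_unique had.symm hbd.symm hc' ▸ h, fun h => ⟨d, rfl, h⟩⟩
    rw [w1, w2]
    suffices hs : (ε {a, b, c} * vol (b - a) (c - a) ξ) * (ε {a, b, d} * vol (b - a) (d - a) ξ) < 0
      by
      rcases mul_neg_iff.1 hs with h | h
      · exact iff_of_true h.1 (not_lt.2 h.2.le)
      · exact iff_of_false (not_lt.2 h.1.le) (not_not.2 h.2)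
    have hε2 : (0 < vol (b - a) (c - a) ξ * vol (b - a) (d - a) ξ →
        ε {a, b, c} * ε {a, b, d} = -1) ∧ (¬ 0 < vol (b - a) (c - a) ξ * vol (b - a) (d - a) ξ →
        ε {a, b, c} * ε {a, b, d} = 1) := by
      simp only [ε]
      generalize numAbove M ξ (center {a, b, c}) = x at *
      generalize numAbove M ξ (center {a, b, d}) = y at *
      constructor <;> intro h
      · rw [ind_pos h] at key
        have : (x = 0 ∧ y ≠ 0) ∨ (x ≠ 0 ∧ y = 0) := by revert x y; decide
        rcases this with ⟨h1, h2⟩ | ⟨h1, h2⟩ <;> simp [h1, h2]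
      · rw [ind_neg h] at key
        have : (x = 0 ∧ y = 0) ∨ (x ≠ 0 ∧ y ≠ 0) := by revert x y; decide
        rcases this with ⟨h1, h2⟩ | ⟨h1, h2⟩ <;> simp [h1, h2]
    rw [mul_mul_mul_comm]
    by_cases h : 0 < vol (b - a) (c - a) ξ * vol (b - a) (d - a) ξ
    · rw [hε2.1 h]; linarith
    · rw [hε2.2 h, one_mul]
      exact lt_of_le_of_ne (not_lt.1 h) (mul_ne_zero hΔc hΔd)

end Orientation

/-! ### Colors as sets of pigments -/

open scoped symmDiff

/-- The pairs of pigments `i < j` of which a color contains exactly one. -/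
def separated (A : Finset (Fin 4)) : Finset (Fin 4 × Fin 4) :=
  Finset.univ.filter fun p => p.1 < p.2 ∧ (A ∩ {p.1, p.2}).card = 1

theorem card_separated_of_card_one : ∀ A : Finset (Fin 4), A.card = 1 → (separated A).card = 3 := by
  decide +kernel

theorem card_separated_of_card_two : ∀ A : Finset (Fin 4), A.card = 2 → (separated A).card = 4 := by
  decide +kernel

theorem mem_separated {A : Finset (Fin 4)} {i j : Fin 4} (hij : i < j) :
    (i, j) ∈ separated A ↔ (A ∩ {i, j}).card = 1 := by
  simp only [separated, Finset.mem_filter, Finset.mem_univ, true_and, hij]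

theorem eq_of_separated_eq_of_card_one : ∀ A B : Finset (Fin 4), A.card = 1 → B.card = 1 →
    separated A = separated B → A = B := by
  decide +kernel

theorem separated_compl : ∀ A : Finset (Fin 4), separated Aᶜ = separated A := by
  decide +kernel

theorem eq_compl_of_union_eq_univ : ∀ A B : Finset (Fin 4), A.card = 2 → B.card = 2 →
    A ∪ B = Finset.univ → B = Aᶜ := by
  decide +kernel

theorem eq_or_eq_compl_of_separated_eq : ∀ A B : Finset (Fin 4), A.card = 2 → B.card = 2 →
    separated A = separated B → B = A ∨ B = Aᶜ := by
  decide +kernel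

theorem mem_separated_symmDiff : ∀ A B : Finset (Fin 4), ∀ p,
    p ∈ separated (A ∆ B) ↔ ¬ (p ∈ separated A ↔ p ∈ separated B) := by
  decide +kernel

theorem symmDiff_of_disjoint_union : ∀ A B : Finset (Fin 4), Disjoint A B →
    A ∆ B = A ∪ B ∧ A ∆ (A ∪ B) = B ∧ B ∆ (A ∪ B) = A := by
  decide +kernel

theorem symmDiff_of_powersetCard : ∀ S ∈ Finset.powersetCard 3 (Finset.univ : Finset (Fin 4)),
    ∀ A ∈ Finset.powersetCard 2 S, ∀ B ∈ Finset.powersetCard 2 S, ∀ C ∈ Finset.powersetCard 2 S,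
    A ≠ B → A ≠ C → B ≠ C → C = A ∆ B := by
  decide +kernel

theorem card_separated_union_of_symmDiff : ∀ A B : Finset (Fin 4), A.card = 1 ∨ A.card = 2 →
    B.card = 1 ∨ B.card = 2 → (A ∆ B).card = 1 ∨ (A ∆ B).card = 2 →
    ((if A.card = 2 then 1 else 0) + (if B.card = 2 then 1 else 0) +
        (if (A ∆ B).card = 2 then 1 else 0) = 1 →
      (separated A ∪ separated B ∪ separated (A ∆ B)).card = 5) ∧
    ((if A.card = 2 then 1 else 0) + (if B.card = 2 then 1 else 0) +
        (if (A ∆ B).card = 2 then 1 else 0) = 3 →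
      (separated A ∪ separated B ∪ separated (A ∆ B)).card = 6) := by
  decide +kernel

theorem card_pairs_of_pigments :
    (Finset.univ.filter fun p : Fin 4 × Fin 4 => p.1 < p.2).card = 6 := by
  decide +kernel

/-- The pairs of pigments separated near a singular vertex of type `1⁴2²`. If its seams are numbered
so that the thick sheets lie between `1` and `2` and between `3` and `4`, then `p`, `q`, `r`, `s` are
the colors of the thin sheets `13`, `14`, `23`, `24`, and the four lines belong to the seams
`1`, `2`, `3`, `4`. -/
def separatedSquare (p q r s : Fin 4) : Finset (Fin 4 × Fin 4) :=
  (separated {p} ∪ separated {q} ∪ separated ({p} ∆ {q})) ∪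
    (separated {r} ∪ separated {s} ∪ separated ({r} ∆ {s})) ∪
    (separated {p} ∪ separated {r} ∪ separated ({p} ∆ {r})) ∪
    (separated {q} ∪ separated {s} ∪ separated ({q} ∆ {s}))

/-- If the ends of the thick sheets have equal colors, then the thin sheets carry only two pigments,
and the complementary pair of pigments is not separated. -/
theorem card_separatedSquare_of_eq : ∀ p q r s : Fin 4,
    (({p} : Finset (Fin 4)) ∆ {q}).card = 2 ∧ (({p} : Finset (Fin 4)) ∆ {r}).card = 2 ∧
      ({r} : Finset (Fin 4)) ∆ {s} = {p} ∆ {q} ∧ ({q} : Finset (Fin 4)) ∆ {s} = {p} ∆ {r} →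
    (separatedSquare p q r s).card = 5 := by
  decide +kernel

/-- If the ends of the thick sheets have complementary colors, then the thin sheets carry all four
pigments. -/
theorem card_separatedSquare_of_eq_compl : ∀ p q r s : Fin 4,
    (({p} : Finset (Fin 4)) ∆ {q}).card = 2 ∧ (({p} : Finset (Fin 4)) ∆ {r}).card = 2 ∧
      ({r} : Finset (Fin 4)) ∆ {s} = ({p} ∆ {q})ᶜ ∧ ({q} : Finset (Fin 4)) ∆ {s} = ({p} ∆ {r})ᶜ →
    (separatedSquare p q r s).card = 6 := by
  decide +kernel

open scoped Classical

/-! ### Triangles, edges and vertices of a complex -/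

section Complex

variable {K : Cplx}

theorem pair_subset {s : Finset E3} {v w : E3} (hv : v ∈ s) (hw : w ∈ s) : {v, w} ⊆ s :=
  Finset.insert_subset hv (Finset.singleton_subset_iff.2 hw)

theorem pair_mem_edges {t : Tri K} {v w : E3} (hv : v ∈ t.1) (hw : w ∈ t.1) (h : v ≠ w) :
    {v, w} ∈ edges K :=
  ⟨K.down_closed t.2.1 (by simp [Finset.insert_subset_iff, hv, hw]) (by simp), Finset.card_pair h⟩

theorem mem_edges_of_subset {t : Tri K} {e : Finset E3} (he : e ⊆ t.1) (h2 : e.card = 2) :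
    e ∈ edges K :=
  ⟨K.down_closed t.2.1 he (Finset.card_pos.1 (by omega)), h2⟩

theorem exists_pair_of_mem_edges {e : Finset E3} (he : e ∈ edges K) {v : E3} (hv : v ∈ e) :
    ∃ w, w ≠ v ∧ e = {v, w} := by
  have h1 : (e.erase v).card = 1 := by rw [Finset.card_erase_of_mem hv, he.2]
  obtain ⟨w, hw⟩ := Finset.card_eq_one.1 h1
  have hwe : w ∈ e.erase v := hw ▸ Finset.mem_singleton_self w
  refine ⟨w, (Finset.mem_erase.1 hwe).1, ?_⟩
  rw [← hw, Finset.insert_erase hv]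

theorem mem_vertices_of_mem_edges {e : Finset E3} (he : e ∈ edges K) {v : E3} (hv : v ∈ e) :
    v ∈ K.vertices :=
  K.down_closed he.1 (Finset.singleton_subset_iff.2 hv) (Finset.singleton_nonempty v)

theorem pair_injective {v w w' : E3} (hw : w ≠ v) (h : ({v, w} : Finset E3) = {v, w'}) :
    w = w' := by
  have : w ∈ ({v, w'} : Finset E3) := h ▸ by simp
  simpa [hw] using this

theorem tri_eq_of_subset {t t' : Tri K} {e : Finset E3} (he2 : e.card = 2) (he : e ⊆ t.1)
    (he' : e ⊆ t'.1) {v : E3} (hv : v ∈ t.1) (hv' : v ∈ t'.1) (hve : v ∉ e) : t = t' := by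
  have h : ∀ s : Tri K, e ⊆ s.1 → v ∈ s.1 → s.1 = insert v e := by
    intro s hs hvs
    refine (Finset.eq_of_subset_of_card_le (Finset.insert_subset hvs hs) ?_).symm
    rw [s.2.2, Finset.card_insert_of_notMem hve, he2]
  exact Subtype.ext ((h t he hv).trans (h t' he' hv').symm)

/-- In the link of `v`, triangles are adjacent when they share a further corner. -/
theorem induce_adj_iff (S : Set (Finset E3)) (v : E3) (t t' : trisAt K v) :
    ((adjGraph K S).induce (trisAt K v)).Adj t t' ↔
      t ≠ t' ∧ ∃ w, ({v, w} : Finset E3) ∉ S ∧ w ∈ t.1.1.erase v ∧ w ∈ t'.1.1.erase v := by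
  constructor
  · rintro ⟨hne, e, he, heS, h1, h2⟩
    have hne : t.1 ≠ t'.1 := hne
    have hve : v ∈ e := by
      by_contra h
      exact hne (tri_eq_of_subset he.2 h1 h2 t.2 t'.2 h)
    obtain ⟨w, hw, rfl⟩ := exists_pair_of_mem_edges he hve
    exact ⟨fun h => hne (congrArg _ h), w, heS,
      Finset.mem_erase.2 ⟨hw, h1 (by simp)⟩, Finset.mem_erase.2 ⟨hw, h2 (by simp)⟩⟩
  · rintro ⟨hne, w, hS, h1, h2⟩
    rw [Finset.mem_erase] at h1 h2
    refine ⟨fun h => hne (Subtype.ext h), {v, w}, pair_mem_edges t.2 h1.2 h1.1.symm, hS,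
      pair_subset t.2 h1.2, pair_subset t'.2 h2.2⟩

theorem facetOf_eq_of_adj {t t' : Tri K} (h : (adjGraph K (seamEdges K)).Adj t t') :
    facetOf K t = facetOf K t' :=
  SimpleGraph.ConnectedComponent.sound h.reachable

theorem facetOf_eq_of_sheetOf_eq {v : E3} {t t' : trisAt K v}
    (h : sheetOf K v t = sheetOf K v t') : facetOf K t.1 = facetOf K t'.1 := by
  have h := SimpleGraph.ConnectedComponent.exact h
  exact SimpleGraph.ConnectedComponent.sound
    (h.map (SimpleGraph.Embedding.induce (trisAt K v)).toHom)

theorem Sheet.exists_sheetOf_eq {v : E3} (σ : Sheet K v) : ∃ t, sheetOf K v t = σ :=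
  σ.exists_rep

theorem trisOn_pair (v w : E3) :
    trisOn K {v, w} = {t : Tri K | v ∈ t.1 ∧ w ∈ t.1} := by
  ext t; simp [trisOn, Finset.insert_subset_iff]

end Complex

namespace Foam

variable (F : Foam)

noncomputable instance : Fintype (Tri F.K) :=
  have : Finite (Tri F.K) := (F.finite.subset fun _ h => h.1).to_subtype
  Fintype.ofFinite _

variable {F}

theorem ncard_trisOn_of_notMem_seamEdges {e : Finset E3} (he : e ∈ edges F.K)
    (hs : e ∉ seamEdges F.K) : (trisOn F.K e).ncard = 2 := by
  rcases F.edge_count e he with h | h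
  · exact h
  · exact absurd ⟨he, h⟩ hs

theorem exists_trisOn_eq_pair {e : Finset E3} (he : e ∈ edges F.K) (hs : e ∉ seamEdges F.K) :
    ∃ t t', t ≠ t' ∧ trisOn F.K e = {t, t'} :=
  Set.ncard_eq_two.1 (ncard_trisOn_of_notMem_seamEdges he hs)

theorem exists_trisOn_eq_triple {e : Finset E3} (he : e ∈ seamEdges F.K) :
    ∃ a b d, a ≠ b ∧ a ≠ d ∧ b ≠ d ∧ trisOn F.K e = {a, b, d} := by
  obtain ⟨a, b, d, h⟩ := Set.ncard_eq_three.1 he.2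
  exact ⟨a, b, d, h⟩

theorem card_link_star {v w : E3} (hw : w ≠ v) :
    (Finset.univ.filter fun t : trisAt F.K v => w ∈ t.1.1.erase v).card
      = (trisOn F.K {v, w}).ncard := by
  rw [← Set.ncard_coe_finset, ← Set.ncard_image_of_injective _ Subtype.val_injective, trisOn_pair]
  congr 1
  ext t
  simp only [Set.mem_image, Finset.coe_filter, Finset.mem_univ, true_and, Finset.mem_erase,
    Set.mem_ofPred_eq]
  constructor
  · rintro ⟨t, ht, rfl⟩
    exact ⟨t.2, ht.2⟩
  · rintro ⟨h1, h2⟩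
    exact ⟨⟨t, h1⟩, ⟨hw, h2⟩, rfl⟩

theorem seamEdgesAt_finite (v : E3) : (seamEdgesAt F.K v).Finite :=
  F.finite.subset fun _ h => h.1.1.1

/-! ### Sheets -/

/-- The seam edges in the closure of a sheet. -/
def touched {v : E3} (σ : Sheet F.K v) : Set (Finset E3) :=
  {e | e ∈ seamEdgesAt F.K v ∧ σ.Touches e}

/-- A sheet at a seam point or a singular vertex corresponds to an arc of the link whose ends are
two different branch points. -/
theorem ncard_touched {v : E3} (hv : (seamEdgesAt F.K v).Nonempty) (σ : Sheet F.K v) :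
    (touched σ).ncard = 2 := by
  obtain ⟨e₀, he₀⟩ := hv
  have hvK : v ∈ F.K.vertices := mem_vertices_of_mem_edges he₀.1.1 he₀.2
  have LM := F.local_model v hvK
  let A : Finset (trisAt F.K v) := Finset.univ.filter fun t => sheetOf F.K v t = σ
  have hA : ∀ t, t ∈ A ↔ sheetOf F.K v t = σ := fun t => by simp [A]
  -- the sum of the numbers of ends is the number of touched edges
  have key := circle_or_interval ((adjGraph F.K (seamEdges F.K)).induce (trisAt F.K v))
    (fun t => t.1.1.erase v) (fun w => ({v, w} : Finset E3) ∉ seamEdges F.K)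
    (fun t => by rw [Finset.card_erase_of_mem t.2, t.1.2.2]) (induce_adj_iff _ v)
    (fun w hw t ht => by
      rw [Finset.mem_erase] at ht
      rw [card_link_star ht.1]
      exact ncard_trisOn_of_notMem_seamEdges (pair_mem_edges t.2 ht.2 ht.1.symm) hw) σ A hA
  have hone : ∀ w ∈ (A.biUnion fun t => t.1.1.erase v).filter
      (fun w => ¬ ({v, w} : Finset E3) ∉ seamEdges F.K),
      (A.filter fun t => w ∈ t.1.1.erase v).card = 1 := by
    intro w hw
    simp only [Finset.mem_filter, Finset.mem_biUnion, not_not] at hw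
    obtain ⟨⟨t, ht, hwt⟩, hws⟩ := hw
    rw [Finset.card_eq_one]
    refine ⟨t, ?_⟩
    ext t'
    simp only [Finset.mem_filter, Finset.mem_singleton]
    constructor
    · rintro ⟨ht', hwt'⟩
      refine LM.no_loop {v, w} ⟨hws, by simp⟩ t' t ?_ ?_ (((hA _).1 ht').trans ((hA _).1 ht).symm)
      · exact pair_subset t'.2 (Finset.mem_erase.1 hwt').2
      · exact pair_subset t.2 (Finset.mem_erase.1 hwt).2
    · rintro rfl
      exact ⟨ht, hwt⟩
  rw [Finset.sum_congr rfl hone, Finset.sum_const, smul_eq_mul, mul_one] at key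
  have hcard : ((A.biUnion fun t => t.1.1.erase v).filter
      (fun w => ¬ ({v, w} : Finset E3) ∉ seamEdges F.K)).card = (touched σ).ncard := by
    rw [← Set.ncard_coe_finset]
    refine Set.ncard_congr (fun w _ => {v, w}) ?_ ?_ ?_
    · intro w hw
      simp only [Finset.coe_filter, Finset.mem_biUnion, not_not, Set.mem_ofPred_eq] at hw
      obtain ⟨⟨t, ht, hwt⟩, hws⟩ := hw
      refine ⟨⟨hws, by simp⟩, t, (hA _).1 ht, ?_⟩
      exact pair_subset t.2 (Finset.mem_erase.1 hwt).2
    · intro w w' hw hw' h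
      simp only [Finset.coe_filter, Finset.mem_biUnion, not_not, Set.mem_ofPred_eq] at hw
      obtain ⟨⟨t, ht, hwt⟩, hws⟩ := hw
      exact pair_injective (Finset.mem_erase.1 hwt).1 h
    · rintro e ⟨⟨hes, hve⟩, t, ht, het⟩
      obtain ⟨w, hw, rfl⟩ := exists_pair_of_mem_edges hes.1 hve
      refine ⟨w, ?_, rfl⟩
      simp only [Finset.coe_filter, Finset.mem_biUnion, not_not, Set.mem_ofPred_eq]
      exact ⟨⟨t, (hA _).2 ht, Finset.mem_erase.2 ⟨hw, het (by simp)⟩⟩, hes⟩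
  rw [hcard] at key
  -- the link is connected, hence is not a circle without branch points
  have hne : (touched σ).ncard ≠ 0 := by
    intro h0
    have hempty : touched σ = ∅ :=
      (Set.ncard_eq_zero ((seamEdgesAt_finite v).subset fun _ h => h.1)).1 h0
    obtain ⟨t, ht⟩ := σ.exists_sheetOf_eq
    obtain ⟨a, _, _, -, -, -, habd⟩ := exists_trisOn_eq_triple he₀.1
    have ha : e₀ ⊆ a.1 := by
      have : a ∈ trisOn F.K e₀ := by rw [habd]; simp
      exact this
    have hreach := LM.link_connected.preconnected t ⟨a, ha he₀.2⟩
    have hall : ∀ t', ((adjGraph F.K ∅).induce (trisAt F.K v)).Reachable t t' →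
        sheetOf F.K v t' = σ := by
      rintro t' h
      rw [SimpleGraph.reachable_iff_reflTransGen] at h
      induction h with
      | refl => exact ht
      | @tail b c _ hbc ih =>
        obtain ⟨hne, w, -, hwb, hwc⟩ := (induce_adj_iff _ _ _ _).1 hbc
        rw [← ih]
        refine SimpleGraph.ConnectedComponent.sound (SimpleGraph.Adj.reachable ?_)
        refine (induce_adj_iff _ _ _ _).2 ⟨hne.symm, w, fun hs => ?_, hwc, hwb⟩
        have : ({v, w} : Finset E3) ∈ touched σ := ⟨⟨hs, by simp⟩, b, ih, by
          exact pair_subset b.2 (Finset.mem_erase.1 hwb).2⟩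
        rw [hempty] at this
        exact this
    have : e₀ ∈ touched σ := ⟨he₀, ⟨a, ha he₀.2⟩, hall _ hreach, ha⟩
    rw [hempty] at this
    exact this
  rcases key with ⟨h, -⟩ | ⟨h, -⟩
  · exact absurd h hne
  · exact h

theorem touched_eq {v : E3} {σ : Sheet F.K v} {e e' : Finset E3} (he : e ∈ touched σ)
    (he' : e' ∈ touched σ) (h : e ≠ e') : touched σ = {e, e'} := by
  refine (Set.eq_of_subset_of_ncard_le (by rintro x (rfl | rfl) <;> assumption) ?_
    ((seamEdgesAt_finite v).subset fun _ h => h.1)).symm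
  rw [ncard_touched ⟨e, he.1⟩, Set.ncard_pair h]

end Foam

/-! ### Colors near seams -/

namespace Foam

variable {F : Foam}

theorem thickAt_eq {e : Finset E3} {a b d : Tri F.K} (hab : a ≠ b) (had : a ≠ d) (hbd : b ≠ d)
    (he : trisOn F.K e = {a, b, d}) : thickAt F.K F.thickness e =
      (if F.thickness (facetOf F.K a) = 2 then 1 else 0) +
      (if F.thickness (facetOf F.K b) = 2 then 1 else 0) +
      (if F.thickness (facetOf F.K d) = 2 then 1 else 0) := by
  have : {t : Tri F.K | t ∈ trisOn F.K e ∧ F.thickness (facetOf F.K t) = 2} =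
      ((({a, b, d} : Finset (Tri F.K)).filter
        fun t => F.thickness (facetOf F.K t) = 2 : Finset (Tri F.K)) : Set (Tri F.K)) := by
    rw [he]; ext t; simp
  rw [thickAt, this, Set.ncard_coe_finset, Finset.card_filter,
    Finset.sum_insert (by simp [hab, had]), Finset.sum_pair hbd, add_assoc]

namespace Coloring

variable (c : F.Coloring)

/-- The color of the region of a triangle. -/
def color (t : Tri F.K) : Finset (Fin 4) := c.col (F.regionOf t)

/-- The pairs of pigments separated by the color of one of the triangles at a face. -/
noncomputable def sepAt (s : Finset E3) : Finset (Fin 4 × Fin 4) :=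
  Finset.univ.filter fun p => ∃ t : Tri F.K, s ⊆ t.1 ∧ p ∈ separated (c.color t)

variable {c}

theorem mem_sepAt {s : Finset E3} {p : Fin 4 × Fin 4} :
    p ∈ c.sepAt s ↔ ∃ t : Tri F.K, s ⊆ t.1 ∧ p ∈ separated (c.color t) := by
  simp [sepAt]

variable (c)

theorem card_color (t : Tri F.K) : (c.color t).card = F.thickness (facetOf F.K t) :=
  c.card_col _

theorem card_color_eq (t : Tri F.K) : (c.color t).card = 1 ∨ (c.color t).card = 2 := by
  rw [c.card_color]; exact F.thickness_eq _

theorem color_eq_of_notMem_defects {e : Finset E3} (he : e ∈ edges F.K) (hs : e ∉ seamEdges F.K)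
    (hd : e ∉ F.defects) {t t' : Tri F.K} (ht : e ⊆ t.1) (ht' : e ⊆ t'.1) :
    c.color t = c.color t' := by
  by_cases htt : t = t'
  · rw [htt]
  unfold color
  congr 1
  refine SimpleGraph.ConnectedComponent.sound (SimpleGraph.Adj.reachable ?_)
  exact ⟨htt, e, he, fun h => h.elim hs hd, ht, ht'⟩

theorem color_eq_compl_of_mem_defects {e : Finset E3} (hd : e ∈ F.defects) {t t' : Tri F.K}
    (ht : e ⊆ t.1) (ht' : e ⊆ t'.1) (htt : t ≠ t') : c.color t' = (c.color t)ᶜ :=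
  eq_compl_of_union_eq_univ _ _ (by rw [c.card_color, F.defects_thick e hd t ht])
    (by rw [c.card_color, F.defects_thick e hd t' ht']) (c.defect e hd t ht t' ht' htt)

/-- Crossing a defect line complements the color, which separates the same pairs of pigments. -/
theorem separated_color_eq_of_facetOf_eq {t t' : Tri F.K} (h : facetOf F.K t = facetOf F.K t') :
    separated (c.color t) = separated (c.color t') := by
  have hr := SimpleGraph.ConnectedComponent.exact h
  clear h
  rw [SimpleGraph.reachable_iff_reflTransGen] at hr
  induction hr with
  | refl => rfl
  | @tail a b _ hab ih =>
    rw [ih]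
    obtain ⟨hne, e, he, hs, ha, hb⟩ := hab
    by_cases hd : e ∈ F.defects
    · rw [c.color_eq_compl_of_mem_defects hd ha hb hne, separated_compl]
    · rw [c.color_eq_of_notMem_defects he hs hd ha hb]

/-- At a seam the three colors add up to zero, as vectors over the field with two elements. -/
theorem color_eq_symmDiff {e : Finset E3} (he : e ∈ seamEdges F.K) {a b d : Tri F.K} (hab : a ≠ b)
    (had : a ≠ d) (hbd : b ≠ d) (habd : trisOn F.K e = {a, b, d}) :
    c.color d = c.color a ∆ c.color b := by
  have ha : a ∈ trisOn F.K e := by rw [habd]; simp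
  have hb : b ∈ trisOn F.K e := by rw [habd]; simp
  have hd : d ∈ trisOn F.K e := by rw [habd]; simp
  have hth := thickAt_eq hab had hbd habd
  rcases F.seam_type e he with h | h
  · rw [h] at hth
    rcases F.thickness_eq (facetOf F.K a) with h1 | h1 <;>
      rcases F.thickness_eq (facetOf F.K b) with h2 | h2 <;>
      rcases F.thickness_eq (facetOf F.K d) with h3 | h3 <;>
      simp [h1, h2, h3] at hth
    · obtain ⟨h4, h5⟩ := c.seam112 e he a ha b hb d hd hab h1 h2 h3
      exact h5.trans (symmDiff_of_disjoint_union _ _ h4).1.symm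
    · obtain ⟨h4, h5⟩ := c.seam112 e he a ha d hd b hb had h1 h3 h2
      have h5 : c.color b = c.color a ∪ c.color d := h5
      rw [h5]
      exact (symmDiff_of_disjoint_union _ _ h4).2.1.symm
    · obtain ⟨h4, h5⟩ := c.seam112 e he b hb d hd a ha hbd h2 h3 h1
      have h5 : c.color a = c.color b ∪ c.color d := h5
      rw [h5, symmDiff_comm]
      exact (symmDiff_of_disjoint_union _ _ h4).2.1.symm
  · obtain ⟨S, hS, himg⟩ := c.seam222 e he h
    have himg : c.color '' trisOn F.K e = {p | p ⊆ S ∧ p.card = 2} := himg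
    have himg' : c.color '' trisOn F.K e = (Finset.powersetCard 2 S : Set (Finset (Fin 4))) := by
      rw [himg]; ext p; simp [Finset.mem_powersetCard]
    have hinj : Set.InjOn c.color (trisOn F.K e) := by
      refine (Set.ncard_image_iff (Set.toFinite _)).1 ?_
      rw [himg', Set.ncard_coe_finset, Finset.card_powersetCard, hS, he.2]
      rfl
    have hmem : ∀ t ∈ trisOn F.K e, c.color t ∈ Finset.powersetCard 2 S := by
      intro t ht
      have : c.color t ∈ c.color '' trisOn F.K e := ⟨t, ht, rfl⟩
      rw [himg'] at this
      exact this
    exact symmDiff_of_powersetCard S (Finset.mem_powersetCard.2 ⟨Finset.subset_univ _, hS⟩)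
      _ (hmem a ha) _ (hmem b hb) _ (hmem d hd) (fun h => hab (hinj ha hb h))
      (fun h => had (hinj ha hd h)) (fun h => hbd (hinj hb hd h))

theorem sepAt_eq_of_trisOn {e : Finset E3} {a b d : Tri F.K} (habd : trisOn F.K e = {a, b, d}) :
    c.sepAt e = separated (c.color a) ∪ separated (c.color b) ∪ separated (c.color d) := by
  have h : ∀ t : Tri F.K, e ⊆ t.1 ↔ t = a ∨ t = b ∨ t = d := by
    intro t
    have : t ∈ trisOn F.K e ↔ t ∈ ({a, b, d} : Set (Tri F.K)) := by rw [habd]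
    exact this
  ext p
  rw [mem_sepAt]
  simp only [h, Finset.mem_union]
  constructor
  · rintro ⟨t, rfl | rfl | rfl, hp⟩ <;> tauto
  · rintro ((hp | hp) | hp)
    exacts [⟨a, by simp, hp⟩, ⟨b, by simp, hp⟩, ⟨d, by simp, hp⟩]

theorem card_sepAt_seam {e : Finset E3} (he : e ∈ seamEdges F.K) :
    (thickAt F.K F.thickness e = 1 → (c.sepAt e).card = 5) ∧
    (thickAt F.K F.thickness e = 3 → (c.sepAt e).card = 6) := by
  obtain ⟨a, b, d, hab, had, hbd, habd⟩ := exists_trisOn_eq_triple he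
  have h1 := c.card_color_eq d
  have h := thickAt_eq hab had hbd habd
  rw [← c.card_color, ← c.card_color, ← c.card_color] at h
  rw [c.sepAt_eq_of_trisOn habd, h]
  rw [c.color_eq_symmDiff he hab had hbd habd] at h1 ⊢
  exact card_separated_union_of_symmDiff _ _ (c.card_color_eq a) (c.card_color_eq b) h1

theorem card_sepAt_le (s : Finset E3) : (c.sepAt s).card ≤ 6 := by
  rw [← card_pairs_of_pigments]
  refine Finset.card_le_card fun p hp => ?_
  obtain ⟨t, -, hp⟩ := mem_sepAt.1 hp
  simp only [separated, Finset.mem_filter, Finset.mem_univ, true_and] at hp ⊢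
  exact hp.1

theorem sepAt_mono {s s' : Finset E3} (h : s ⊆ s') : c.sepAt s' ⊆ c.sepAt s := by
  intro p hp
  obtain ⟨t, ht, hp⟩ := mem_sepAt.1 hp
  exact mem_sepAt.2 ⟨t, h.trans ht, hp⟩

/-- Every sheet at `v` reaches a seam edge, so that the pairs separated near `v` are separated near
one of the seam edges. -/
theorem mem_sepAt_vertex_iff {v : E3} (hv : (seamEdgesAt F.K v).Nonempty) {p : Fin 4 × Fin 4} :
    p ∈ c.sepAt {v} ↔ ∃ e ∈ seamEdgesAt F.K v, p ∈ c.sepAt e := by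
  constructor
  · intro hp
    obtain ⟨t, ht, hp⟩ := mem_sepAt.1 hp
    rw [Finset.singleton_subset_iff] at ht
    have h2 := ncard_touched hv (sheetOf F.K v ⟨t, ht⟩)
    obtain ⟨e, he, t', ht', het'⟩ := Set.nonempty_of_ncard_ne_zero (s := touched _)
      (by rw [h2]; norm_num)
    refine ⟨e, he, mem_sepAt.2 ⟨t', het', ?_⟩⟩
    rwa [c.separated_color_eq_of_facetOf_eq (facetOf_eq_of_sheetOf_eq ht')]
  · rintro ⟨e, he, hp⟩
    exact c.sepAt_mono (Finset.singleton_subset_iff.2 he.2) hp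

/-- Each of the three sheets at a seam point touches both seam edges. -/
theorem sepAt_seam_point {v : E3} (hv : (seamEdgesAt F.K v).ncard = 2) {e : Finset E3}
    (he : e ∈ seamEdgesAt F.K v) : c.sepAt {v} = c.sepAt e := by
  refine Finset.Subset.antisymm (fun p hp => ?_)
    (c.sepAt_mono (Finset.singleton_subset_iff.2 he.2))
  obtain ⟨t, ht, hp⟩ := mem_sepAt.1 hp
  rw [Finset.singleton_subset_iff] at ht
  have h2 := ncard_touched ⟨e, he⟩ (sheetOf F.K v ⟨t, ht⟩)
  have hall : touched (sheetOf F.K v ⟨t, ht⟩) = seamEdgesAt F.K v :=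
    Set.eq_of_subset_of_ncard_le (fun _ h => h.1) (by rw [h2, hv]) (seamEdgesAt_finite v)
  have he' : e ∈ touched (sheetOf F.K v ⟨t, ht⟩) := by rwa [hall]
  obtain ⟨-, t', ht', het'⟩ := he'
  refine mem_sepAt.2 ⟨t', het', ?_⟩
  rwa [c.separated_color_eq_of_facetOf_eq (facetOf_eq_of_sheetOf_eq ht')]

end Coloring

end Foam

/-! ### Singular vertices -/

namespace Foam

variable {F : Foam}

/-- A sheet of thickness two. -/
def IsThick {v : E3} (σ : Sheet F.K v) : Prop :=
  ∃ t : trisAt F.K v, sheetOf F.K v t = σ ∧ F.thickness (facetOf F.K t.1) = 2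

theorem IsThick.thickness_eq {v : E3} {σ : Sheet F.K v} (h : IsThick σ) {t : trisAt F.K v}
    (ht : sheetOf F.K v t = σ) : F.thickness (facetOf F.K t.1) = 2 := by
  obtain ⟨t', ht', h2⟩ := h
  rw [← h2, facetOf_eq_of_sheetOf_eq (ht.trans ht'.symm)]

theorem local_model_of_seam {v : E3} {e : Finset E3} (he : e ∈ seamEdgesAt F.K v) :
    LocalModel F.K v :=
  F.local_model v (mem_vertices_of_mem_edges he.1.1 he.2)

noncomputable instance (v : E3) : Fintype (Sheet F.K v) := Fintype.ofFinite _

theorem thickAt_eq_card {v : E3} {e : Finset E3} (he : e ∈ seamEdgesAt F.K v) :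
    thickAt F.K F.thickness e =
      (Finset.univ.filter fun σ : Sheet F.K v => IsThick σ ∧ σ.Touches e).card := by
  rw [← Set.ncard_coe_finset]
  refine Set.ncard_congr (fun t ht => sheetOf F.K v ⟨t, ht.1 he.2⟩) ?_ ?_ ?_
  · rintro t ⟨ht, h2⟩
    simp only [Finset.coe_filter, Finset.mem_univ, true_and, Set.mem_ofPred_eq]
    exact ⟨⟨_, rfl, h2⟩, _, rfl, ht⟩
  · rintro t t' ⟨ht, h2⟩ ⟨ht', h2'⟩ h
    exact congrArg Subtype.val
      ((local_model_of_seam he).no_loop e he ⟨t, ht he.2⟩ ⟨t', ht' he.2⟩ ht ht' h)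
  · intro σ hσ
    simp only [Finset.coe_filter, Finset.mem_univ, true_and, Set.mem_ofPred_eq] at hσ
    obtain ⟨h, t, ht, het⟩ := hσ
    exact ⟨t.1, ⟨het, h.thickness_eq ht⟩, ht⟩

theorem thickSheets_eq_card (v : E3) : thickSheets F.K F.thickness v =
    (Finset.univ.filter fun σ : Sheet F.K v => IsThick σ).card := by
  rw [← Set.ncard_coe_finset, thickSheets]
  congr 1
  ext σ
  simp [IsThick]

/-- Each thick sheet has two ends on the seams. -/
theorem sum_thickAt {v : E3} (hv : (seamEdgesAt F.K v).Nonempty) :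
    ∑ e ∈ (seamEdgesAt_finite (F := F) v).toFinset, thickAt F.K F.thickness e =
      2 * thickSheets F.K F.thickness v := by
  rw [thickSheets_eq_card]
  have h := Finset.sum_card_bipartiteAbove_eq_sum_card_bipartiteBelow
    (s := (seamEdgesAt_finite (F := F) v).toFinset)
    (t := Finset.univ.filter fun σ : Sheet F.K v => IsThick σ) (fun e σ => σ.Touches e)
  have h1 : ∀ e ∈ (seamEdgesAt_finite (F := F) v).toFinset, thickAt F.K F.thickness e =
      (Finset.bipartiteAbove (fun e (σ : Sheet F.K v) => σ.Touches e)
        (Finset.univ.filter fun σ : Sheet F.K v => IsThick σ) e).card := by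
    intro e he
    rw [thickAt_eq_card ((Set.Finite.mem_toFinset _).1 he), Finset.bipartiteAbove,
      Finset.filter_filter]
  have h2 : ∀ σ ∈ Finset.univ.filter fun σ : Sheet F.K v => IsThick σ,
      (Finset.bipartiteBelow (fun e (σ : Sheet F.K v) => σ.Touches e)
        (seamEdgesAt_finite (F := F) v).toFinset σ).card = 2 := by
    intro σ _
    rw [← ncard_touched hv σ, ← Set.ncard_coe_finset]
    congr 1
    ext e
    simp [Finset.bipartiteBelow, touched]
  rw [Finset.sum_congr rfl h1, h, Finset.sum_congr rfl h2, Finset.sum_const, smul_eq_mul, mul_comm]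

/-- If two seams of type 222 end at a singular vertex, then all four seams have this type. -/
theorem thickAt_eq_three_of_two {v : E3} (hv : (seamEdgesAt F.K v).ncard = 4)
    {e₁ e₂ e : Finset E3} (he₁ : e₁ ∈ seamEdgesAt F.K v) (he₂ : e₂ ∈ seamEdgesAt F.K v)
    (he : e ∈ seamEdgesAt F.K v) (h12 : e₁ ≠ e₂) (h1 : thickAt F.K F.thickness e₁ = 3)
    (h2 : thickAt F.K F.thickness e₂ = 3) : thickAt F.K F.thickness e = 3 := by
  by_cases he1 : e₁ = e
  · rwa [← he1]
  by_cases he2 : e₂ = e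
  · rwa [← he2]
  have thick : ∀ e' ∈ seamEdgesAt F.K v, thickAt F.K F.thickness e' = 3 →
      ∀ σ : Sheet F.K v, σ.Touches e' → IsThick σ := by
    rintro e' he' h3 σ ⟨t, rfl, het⟩
    have hall : {t : Tri F.K | t ∈ trisOn F.K e' ∧ F.thickness (facetOf F.K t) = 2} =
        trisOn F.K e' :=
      Set.eq_of_subset_of_ncard_le (fun _ h => h.1) (by rw [he'.1.2]; exact h3.ge) (Set.toFinite _)
    have ht : t.1 ∈ trisOn F.K e' := het
    rw [← hall] at ht
    exact ⟨t, rfl, ht.2⟩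
  have LM := local_model_of_seam he
  obtain ⟨σ, hσ1, hσ⟩ := LM.complete hv e₁ he₁ e he he1
  obtain ⟨τ, hτ2, hτ⟩ := LM.complete hv e₂ he₂ e he he2
  have hne : σ ≠ τ := by
    rintro rfl
    have h := touched_eq (σ := σ) ⟨he₁, hσ1⟩ ⟨he, hσ⟩ he1
    have : e₂ ∈ touched σ := ⟨he₂, hτ2⟩
    rw [h] at this
    rcases this with h | h
    · exact h12 h.symm
    · exact he2 h
  rcases F.seam_type e he.1 with h | h
  · rw [thickAt_eq_card he, Finset.card_eq_one] at h
    obtain ⟨ρ, hρ⟩ := h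
    have hσ' : σ ∈ ({ρ} : Finset (Sheet F.K v)) := by
      rw [← hρ]; simp only [Finset.mem_filter, Finset.mem_univ, true_and]
      exact ⟨thick _ he₁ h1 σ hσ1, hσ⟩
    have hτ' : τ ∈ ({ρ} : Finset (Sheet F.K v)) := by
      rw [← hρ]; simp only [Finset.mem_filter, Finset.mem_univ, true_and]
      exact ⟨thick _ he₂ h2 τ hτ2, hτ⟩
    rw [Finset.mem_singleton] at hσ' hτ'
    exact absurd (hσ'.trans hτ'.symm) hne
  · exact h

/-- The types of singular vertices. -/
theorem thickSheets_cases {v : E3} (hv : (seamEdgesAt F.K v).ncard = 4) :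
    ((∀ e ∈ seamEdgesAt F.K v, thickAt F.K F.thickness e = 1) ∧
      thickSheets F.K F.thickness v = 2) ∨
    ((∃ e ∈ seamEdgesAt F.K v, thickAt F.K F.thickness e = 3) ∧
      (thickSheets F.K F.thickness v = 3 ∨ thickSheets F.K F.thickness v = 6)) := by
  have hne : (seamEdgesAt F.K v).Nonempty := Set.nonempty_of_ncard_ne_zero (by rw [hv]; norm_num)
  have hsum := sum_thickAt hne
  have hcard : (seamEdgesAt_finite (F := F) v).toFinset.card = 4 := by
    rw [← hv, Set.ncard_eq_toFinset_card _ (seamEdgesAt_finite v)]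
  have hmem : ∀ e, e ∈ (seamEdgesAt_finite (F := F) v).toFinset ↔ e ∈ seamEdgesAt F.K v :=
    fun e => Set.Finite.mem_toFinset _
  by_cases h3 : ∃ e ∈ seamEdgesAt F.K v, thickAt F.K F.thickness e = 3
  swap
  · have h1 : ∀ e ∈ seamEdgesAt F.K v, thickAt F.K F.thickness e = 1 := by
      intro e he
      rcases F.seam_type e he.1 with h | h
      · exact h
      · exact absurd ⟨e, he, h⟩ h3
    rw [Finset.sum_congr rfl fun e he => h1 e ((hmem e).1 he), Finset.sum_const, hcard] at hsum
    exact Or.inl ⟨h1, by simp at hsum; omega⟩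
  refine Or.inr ⟨h3, ?_⟩
  obtain ⟨e, he, h3⟩ := h3
  by_cases h : ∃ e' ∈ seamEdgesAt F.K v, e ≠ e' ∧ thickAt F.K F.thickness e' = 3
  · obtain ⟨e', he', hee, h3'⟩ := h
    rw [Finset.sum_congr rfl fun x hx =>
      thickAt_eq_three_of_two hv he he' ((hmem x).1 hx) hee h3 h3', Finset.sum_const, hcard] at hsum
    exact Or.inr (by simp at hsum; omega)
  · have h1 : ∀ e' ∈ (seamEdgesAt_finite (F := F) v).toFinset.erase e,
        thickAt F.K F.thickness e' = 1 := by
      intro e' he'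
      rw [Finset.mem_erase, hmem] at he'
      rcases F.seam_type e' he'.2.1 with h' | h'
      · exact h'
      · exact absurd ⟨e', he'.2, he'.1.symm, h'⟩ h
    rw [← Finset.add_sum_erase _ _ ((hmem e).2 he), h3, Finset.sum_congr rfl h1, Finset.sum_const,
      Finset.card_erase_of_mem ((hmem e).2 he), hcard] at hsum
    exact Or.inl (by simp at hsum; omega)

/-! ### Defect lines at a vertex -/

/-- The defect edges at `v` that lie in a sheet. -/
def sheetDefects {v : E3} (σ : Sheet F.K v) : Set (Finset E3) :=
  {e | e ∈ F.defects ∧ v ∈ e ∧ σ.Touches e}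

theorem defects_finite : F.defects.Finite :=
  F.finite.subset fun e h => (F.defects_edges e h).1.1

theorem sheetOf_eq_of_subset {v : E3} {t t' : trisAt F.K v} {e : Finset E3} (he2 : e.card = 2)
    (hs : e ∉ seamEdges F.K) (he : e ⊆ t.1.1) (he' : e ⊆ t'.1.1) :
    sheetOf F.K v t = sheetOf F.K v t' := by
  by_cases h : t = t'
  · rw [h]
  · refine SimpleGraph.ConnectedComponent.sound (SimpleGraph.Adj.reachable ?_)
    exact ⟨fun h' => h (Subtype.ext h'), e, mem_edges_of_subset he he2, hs, he, he'⟩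

/-- The number of times a thick sheet changes its color between its two ends has the parity of the
number of defect lines in the sheet. -/
theorem Coloring.color_ends_of_sheet (c : F.Coloring) {v : E3} {σ : Sheet F.K v} (hσ : IsThick σ)
    {e₁ e₂ : Finset E3} (he₁ : e₁ ∈ seamEdgesAt F.K v) (he₂ : e₂ ∈ seamEdgesAt F.K v)
    (he : e₁ ≠ e₂) {t₁ t₂ : trisAt F.K v} (h1 : sheetOf F.K v t₁ = σ) (h2 : sheetOf F.K v t₂ = σ)
    (het₁ : e₁ ⊆ t₁.1.1) (het₂ : e₂ ⊆ t₂.1.1) :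
    (Even (sheetDefects σ).ncard → c.color t₂.1 = c.color t₁.1) ∧
    (Odd (sheetDefects σ).ncard → c.color t₂.1 = (c.color t₁.1)ᶜ) := by
  have LM := local_model_of_seam he₁
  have htouch : touched σ = {e₁, e₂} :=
    touched_eq ⟨he₁, t₁, h1, het₁⟩ ⟨he₂, t₂, h2, het₂⟩ he
  have hcol : ∀ t : trisAt F.K v, sheetOf F.K v t = σ →
      c.color t.1 = c.color t₁.1 ∨ c.color t.1 = (c.color t₁.1)ᶜ := fun t ht =>
    eq_or_eq_compl_of_separated_eq _ _ (by rw [c.card_color, hσ.thickness_eq h1])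
      (by rw [c.card_color, hσ.thickness_eq ht])
      (c.separated_color_eq_of_facetOf_eq (facetOf_eq_of_sheetOf_eq (h1.trans ht.symm)))
  have hnc : ∀ B : Finset (Fin 4), Bᶜ ≠ B := by decide
  -- count the ends and joints of the triangles colored like the first one
  let A : Finset (trisAt F.K v) :=
    Finset.univ.filter fun t => sheetOf F.K v t = σ ∧ c.color t.1 = c.color t₁.1
  have hA : ∀ t, t ∈ A ↔ sheetOf F.K v t = σ ∧ c.color t.1 = c.color t₁.1 := fun t => by simp [A]
  let inc : trisAt F.K v → Finset E3 := fun t => t.1.1.erase v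
  have hsum := congrArg (Nat.cast : ℕ → ZMod 2) (sum_card_eq_sum_incidences inc A)
  have hinc : ∀ t ∈ A, (inc t).card = 2 := fun t _ => by
    simp only [inc]; rw [Finset.card_erase_of_mem t.2, t.1.2.2]
  rw [Finset.sum_congr rfl hinc, Finset.sum_const, smul_eq_mul, mul_comm, Nat.cast_mul,
    Nat.cast_sum] at hsum
  have hterm : ∀ w ∈ A.biUnion inc, ((A.filter fun t => w ∈ inc t).card : ZMod 2) =
      ind ({v, w} ∈ F.defects) + ind ({v, w} ∈ seamEdges F.K) := by
    intro w hw
    obtain ⟨t, ht, hwt⟩ := Finset.mem_biUnion.1 hw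
    have hwv : w ≠ v := (Finset.mem_erase.1 hwt).1
    have hvw : ({v, w} : Finset E3) ⊆ t.1.1 := pair_subset t.2 (Finset.mem_erase.1 hwt).2
    have hedge : ({v, w} : Finset E3) ∈ edges F.K := mem_edges_of_subset hvw
      (Finset.card_pair hwv.symm)
    by_cases hs : ({v, w} : Finset E3) ∈ seamEdges F.K
    · rw [ind_pos hs, ind_neg fun hd => (F.defects_edges _ hd).2 hs, zero_add,
        Finset.card_eq_one.2 ⟨t, ?_⟩, Nat.cast_one]
      ext t'
      simp only [Finset.mem_filter, Finset.mem_singleton]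
      constructor
      · rintro ⟨ht', hwt'⟩
        exact LM.no_loop {v, w} ⟨hs, by simp⟩ t' t
          (pair_subset t'.2 (Finset.mem_erase.1 hwt').2) hvw
          (((hA _).1 ht').1.trans ((hA _).1 ht).1.symm)
      · rintro rfl
        exact ⟨ht, hwt⟩
    · rw [ind_neg hs, add_zero]
      by_cases hd : ({v, w} : Finset E3) ∈ F.defects
      · rw [ind_pos hd, Finset.card_eq_one.2 ⟨t, ?_⟩, Nat.cast_one]
        ext t'
        simp only [Finset.mem_filter, Finset.mem_singleton]
        constructor
        · rintro ⟨ht', hwt'⟩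
          by_contra hne
          have := c.color_eq_compl_of_mem_defects hd hvw
            (pair_subset t'.2 (Finset.mem_erase.1 hwt').2) fun h => hne (Subtype.ext h.symm)
          rw [((hA _).1 ht').2, ((hA _).1 ht).2] at this
          exact hnc _ this.symm
        · rintro rfl
          exact ⟨ht, hwt⟩
      · rw [ind_neg hd]
        have : A.filter (fun t => w ∈ inc t) = Finset.univ.filter fun t => w ∈ inc t := by
          ext t'
          simp only [Finset.mem_filter, Finset.mem_univ, true_and, and_iff_right_iff_imp]
          intro hwt'
          have hvw' : ({v, w} : Finset E3) ⊆ t'.1.1 :=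
            pair_subset t'.2 (Finset.mem_erase.1 hwt').2
          rw [hA, ← ((hA t).1 ht).1, ← ((hA t).1 ht).2]
          exact ⟨sheetOf_eq_of_subset hedge.2 hs hvw' hvw,
            c.color_eq_of_notMem_defects hedge hs hd hvw' hvw⟩
        rw [this, card_link_star hwv, ncard_trisOn_of_notMem_seamEdges hedge hs]
        rfl
  rw [Finset.sum_congr rfl hterm, Finset.sum_add_distrib, ← natCast_card_filter_eq_sum_ind,
    ← natCast_card_filter_eq_sum_ind] at hsum
  have hD : ((A.biUnion inc).filter fun w => {v, w} ∈ F.defects).card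
      = (sheetDefects σ).ncard := by
    rw [← Set.ncard_coe_finset]
    refine Set.ncard_congr (fun w _ => {v, w}) ?_ ?_ ?_
    · intro w hw
      simp only [Finset.coe_filter, Finset.mem_biUnion, Set.mem_ofPred_eq] at hw
      obtain ⟨⟨t, ht, hwt⟩, hd⟩ := hw
      exact ⟨hd, by simp, t, ((hA _).1 ht).1, pair_subset t.2 (Finset.mem_erase.1 hwt).2⟩
    · intro w w' hw hw' h
      simp only [Finset.coe_filter, Finset.mem_biUnion, Set.mem_ofPred_eq] at hw
      obtain ⟨⟨t, ht, hwt⟩, -⟩ := hw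
      exact pair_injective (Finset.mem_erase.1 hwt).1 h
    · rintro e ⟨hd, hve, t, ht, het⟩
      obtain ⟨hedge, hs⟩ := F.defects_edges e hd
      obtain ⟨w, hw, rfl⟩ := exists_pair_of_mem_edges hedge hve
      refine ⟨w, ?_, rfl⟩
      simp only [Finset.coe_filter, Finset.mem_biUnion, Set.mem_ofPred_eq]
      refine ⟨?_, hd⟩
      have hwt : w ∈ inc t := Finset.mem_erase.2 ⟨hw, het (by simp)⟩
      rcases hcol t ht with h | h
      · exact ⟨t, (hA _).2 ⟨ht, h⟩, hwt⟩
      · -- the triangle on the other side has the complementary color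
        obtain ⟨a, b, hab, heq⟩ := exists_trisOn_eq_pair hedge hs
        have hmem : ∃ t', t' ∈ trisOn F.K {v, w} ∧ t' ≠ t.1 := by
          rw [heq]
          by_cases hat : a = t.1
          · exact ⟨b, by simp, fun h => hab (hat.trans h.symm)⟩
          · exact ⟨a, by simp, hat⟩
        obtain ⟨t', ht', hne⟩ := hmem
        have hvt' : v ∈ t'.1 := ht' (by simp)
        refine ⟨⟨t', hvt'⟩, (hA _).2 ⟨?_, ?_⟩, Finset.mem_erase.2 ⟨hw, ht' (by simp)⟩⟩
        · rw [← ht]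
          exact sheetOf_eq_of_subset hedge.2 hs ht' het
        · rw [c.color_eq_compl_of_mem_defects hd het ht' hne.symm, h, compl_compl]
  rw [hD] at hsum
  have hS : ((A.biUnion inc).filter fun w => {v, w} ∈ seamEdges F.K).card
      = if c.color t₂.1 = c.color t₁.1 then 2 else 1 := by
    have himg : ((A.biUnion inc).filter fun w => {v, w} ∈ seamEdges F.K).card =
        {e | e ∈ touched σ ∧ ∃ t ∈ A, e ⊆ t.1.1}.ncard := by
      rw [← Set.ncard_coe_finset]
      refine Set.ncard_congr (fun w _ => {v, w}) ?_ ?_ ?_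
      · intro w hw
        simp only [Finset.coe_filter, Finset.mem_biUnion, Set.mem_ofPred_eq] at hw
        obtain ⟨⟨t, ht, hwt⟩, hd⟩ := hw
        have := pair_subset t.2 (Finset.mem_erase.1 hwt).2
        exact ⟨⟨⟨hd, by simp⟩, t, ((hA _).1 ht).1, this⟩, t, ht, this⟩
      · intro w w' hw hw' h
        simp only [Finset.coe_filter, Finset.mem_biUnion, Set.mem_ofPred_eq] at hw
        obtain ⟨⟨t, ht, hwt⟩, -⟩ := hw
        exact pair_injective (Finset.mem_erase.1 hwt).1 h
      · rintro e ⟨⟨⟨hes, hve⟩, -⟩, t, ht, het⟩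
        obtain ⟨w, hw, rfl⟩ := exists_pair_of_mem_edges hes.1 hve
        refine ⟨w, ?_, rfl⟩
        simp only [Finset.coe_filter, Finset.mem_biUnion, Set.mem_ofPred_eq]
        exact ⟨⟨t, ht, Finset.mem_erase.2 ⟨hw, het (by simp)⟩⟩, hes⟩
    rw [himg, htouch]
    have ht₁A : t₁ ∈ A := (hA _).2 ⟨h1, rfl⟩
    split_ifs with h
    · rw [← Set.ncard_pair he]
      congr 1
      ext e
      constructor
      · exact fun h => h.1
      · rintro (rfl | rfl)
        · exact ⟨by simp, t₁, ht₁A, het₁⟩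
        · exact ⟨by simp, t₂, (hA _).2 ⟨h2, h⟩, het₂⟩
    · rw [← Set.ncard_singleton e₁]
      congr 1
      ext e
      constructor
      · rintro ⟨rfl | rfl, t, ht, het⟩
        · rfl
        · have := LM.no_loop _ he₂ t t₂ het het₂ (((hA _).1 ht).1.trans h2.symm)
          exact absurd (this ▸ ((hA _).1 ht).2) h
      · rintro rfl
        exact ⟨by simp, t₁, ht₁A, het₁⟩
  rw [hS] at hsum
  have two : ((2 : ℕ) : ZMod 2) = 0 := rfl
  rw [two, zero_mul] at hsum
  constructor
  · intro hev
    rw [(ZMod.natCast_eq_zero_iff_even).2 hev, zero_add] at hsum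
    by_contra h
    rw [if_neg h] at hsum
    exact absurd hsum (by decide)
  · intro hodd
    rw [(ZMod.natCast_eq_one_iff_odd).2 hodd] at hsum
    refine (hcol t₂ h2).resolve_left fun h => ?_
    rw [if_pos h] at hsum
    exact absurd hsum (by decide)

end Foam

/-! ### Singular vertices with two thick sheets -/

namespace Foam

variable {F : Foam}

theorem thickness_eq_one_of_not_isThick {v : E3} {σ : Sheet F.K v} (hσ : ¬ IsThick σ)
    {t : trisAt F.K v} (ht : sheetOf F.K v t = σ) : F.thickness (facetOf F.K t.1) = 1 :=
  (F.thickness_eq _).resolve_right fun h => hσ ⟨t, ht, h⟩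

namespace Coloring

variable (c : F.Coloring)

theorem color_eq_of_thin_sheet {v : E3} {σ : Sheet F.K v} (hσ : ¬ IsThick σ) {t t' : trisAt F.K v}
    (ht : sheetOf F.K v t = σ) (ht' : sheetOf F.K v t' = σ) : c.color t.1 = c.color t'.1 :=
  eq_of_separated_eq_of_card_one _ _
    (by rw [c.card_color, thickness_eq_one_of_not_isThick hσ ht])
    (by rw [c.card_color, thickness_eq_one_of_not_isThick hσ ht'])
    (c.separated_color_eq_of_facetOf_eq (facetOf_eq_of_sheetOf_eq (ht.trans ht'.symm)))

/-- At a seam edge where two thin sheets of colors `P` and `Q` meet a third sheet, the third sheet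
has the color `P ∆ Q`. -/
theorem seam_of_thin_sheets {v : E3} {e : Finset E3} (he : e ∈ seamEdgesAt F.K v)
    {σ τ ρ : Sheet F.K v} (hσ : ¬ IsThick σ) (hτ : ¬ IsThick τ) (hρ : IsThick ρ) (hστ : σ ≠ τ)
    (heσ : σ.Touches e) (heτ : τ.Touches e) (heρ : ρ.Touches e) {a b : trisAt F.K v}
    (ha : sheetOf F.K v a = σ) (hb : sheetOf F.K v b = τ) :
    (∃ t : trisAt F.K v, sheetOf F.K v t = ρ ∧ e ⊆ t.1.1 ∧
      c.color t.1 = c.color a.1 ∆ c.color b.1) ∧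
    c.sepAt e = separated (c.color a.1) ∪ separated (c.color b.1) ∪
      separated (c.color a.1 ∆ c.color b.1) := by
  obtain ⟨x, hx, hex⟩ := heσ
  obtain ⟨y, hy, hey⟩ := heτ
  obtain ⟨z, hz, hez⟩ := heρ
  have hxy : x.1 ≠ y.1 := fun h => hστ (by rw [← hx, ← hy, Subtype.ext h])
  have hxz : x.1 ≠ z.1 := fun h => hσ (by rw [← hx, Subtype.ext h, hz]; exact hρ)
  have hyz : y.1 ≠ z.1 := fun h => hτ (by rw [← hy, Subtype.ext h, hz]; exact hρ)
  have htri : trisOn F.K e = {x.1, y.1, z.1} := by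
    refine (Set.eq_of_subset_of_ncard_le ?_ ?_ (Set.toFinite _)).symm
    · rintro t (rfl | rfl | rfl)
      exacts [hex, hey, hez]
    · rw [he.1.2, Set.ncard_eq_three.2 ⟨_, _, _, hxy, hxz, hyz, rfl⟩]
  have hcol := c.color_eq_symmDiff he.1 hxy hxz hyz htri
  rw [c.color_eq_of_thin_sheet hσ ha hx, c.color_eq_of_thin_sheet hτ hb hy]
  refine ⟨⟨z, hz, hez, hcol⟩, ?_⟩
  rw [c.sepAt_eq_of_trisOn htri, hcol]

end Coloring

theorem exists_thick_sheet_of_defect {v : E3} {e : Finset E3} (he : e ∈ F.defects) (hv : v ∈ e) :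
    ∃ σ : Sheet F.K v, IsThick σ ∧ σ.Touches e := by
  obtain ⟨t, ht⟩ := F.pure e (F.defects_edges e he).1.1
  exact ⟨sheetOf F.K v ⟨t, ht hv⟩, ⟨_, rfl, F.defects_thick e he t ht⟩, _, rfl, ht⟩

theorem sheet_unique_of_defect {v : E3} {e : Finset E3} (he : e ∈ F.defects)
    {σ τ : Sheet F.K v} (hσ : σ.Touches e) (hτ : τ.Touches e) : σ = τ := by
  obtain ⟨t, rfl, ht⟩ := hσ
  obtain ⟨t', rfl, ht'⟩ := hτ
  exact sheetOf_eq_of_subset (F.defects_edges e he).1.2 (F.defects_edges e he).2 ht ht'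

/-- At a vertex with two thick sheets, every defect line passes from one into the other. -/
theorem linesThrough_eq {v : E3} (hv : (seamEdgesAt F.K v).Nonempty) {A B : Sheet F.K v}
    (hA : IsThick A) (hB : IsThick B) (hAB : A ≠ B) (hall : ∀ σ, IsThick σ → σ = A ∨ σ = B) :
    F.linesThrough v = (sheetDefects A).ncard ∧ F.linesThrough v = (sheetDefects B).ncard := by
  have hfin : ∀ σ : Sheet F.K v, (sheetDefects σ).Finite := fun σ =>
    defects_finite.subset fun e h => h.1
  obtain ⟨e₀, he₀⟩ := id hv
  obtain ⟨τ, hττ, -, hcross⟩ := F.defects_curves v (mem_vertices_of_mem_edges he₀.1.1 he₀.2)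
  have hle : ∀ σ ρ : Sheet F.K v, (∀ μ, IsThick μ → μ = σ ∨ μ = ρ) →
      (sheetDefects σ).ncard ≤ (sheetDefects ρ).ncard := by
    intro σ ρ h
    refine Set.ncard_le_ncard_of_injOn
      (fun e => if h : e ∈ F.defects ∧ v ∈ e then (τ ⟨e, h⟩).1 else e) ?_ ?_ (hfin ρ)
    · rintro e ⟨hd, hve, het⟩
      simp only [hd, hve, and_self, dite_true]
      obtain ⟨μ, hμ, hμt⟩ := exists_thick_sheet_of_defect (τ ⟨e, hd, hve⟩).2.1 (τ ⟨e, hd, hve⟩).2.2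
      refine ⟨(τ ⟨e, hd, hve⟩).2.1, (τ ⟨e, hd, hve⟩).2.2, ?_⟩
      rcases h μ hμ with rfl | rfl
      · exact absurd ⟨het, hμt⟩ (hcross hv _ μ)
      · exact hμt
    · rintro e ⟨hd, hve, -⟩ e' ⟨hd', hve', -⟩ heq
      simp only [hd, hve, hd', hve', and_self, dite_true] at heq
      have := congrArg τ (Subtype.ext heq)
      rw [hττ, hττ] at this
      exact congrArg Subtype.val this
  have heq : (sheetDefects A).ncard = (sheetDefects B).ncard :=
    (hle A B hall).antisymm (hle B A fun μ h => (hall μ h).symm)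
  have hunion : {e | e ∈ F.defects ∧ v ∈ e} = sheetDefects A ∪ sheetDefects B := by
    ext e
    constructor
    · rintro ⟨hd, hve⟩
      obtain ⟨σ, hσ, hσe⟩ := exists_thick_sheet_of_defect hd hve
      rcases hall σ hσ with rfl | rfl
      exacts [Or.inl ⟨hd, hve, hσe⟩, Or.inr ⟨hd, hve, hσe⟩]
    · rintro (h | h) <;> exact ⟨h.1, h.2.1⟩
  have hdisj : Disjoint (sheetDefects A) (sheetDefects B) := Set.disjoint_left.2 fun e h h' =>
    hAB (sheet_unique_of_defect h.1 h.2.2 h'.2.2)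
  rw [linesThrough, hunion, Set.ncard_union_eq hdisj (hfin _) (hfin _), ← heq]
  omega

namespace Coloring

variable (c : F.Coloring)

/-- A singular vertex of type `1⁴2²` has two thick sheets and four thin ones, whose four pigments
`p`, `q`, `r`, `s` determine all colors nearby. The defect lines cross the thick sheets equally
often, and their parity decides whether the ends of a thick sheet have equal or complementary
colors. -/
theorem card_sepAt_of_thickSheets_eq_two {v : E3} (hv : (seamEdgesAt F.K v).ncard = 4)
    (h1 : ∀ e ∈ seamEdgesAt F.K v, thickAt F.K F.thickness e = 1)
    (h2 : thickSheets F.K F.thickness v = 2) :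
    (Even (F.linesThrough v) → (c.sepAt {v}).card = 5) ∧
    (Odd (F.linesThrough v) → (c.sepAt {v}).card = 6) := by
  have hne : (seamEdgesAt F.K v).Nonempty := Set.nonempty_of_ncard_ne_zero (by rw [hv]; norm_num)
  rw [thickSheets_eq_card, Finset.card_eq_two] at h2
  obtain ⟨A, B, hAB, hthick⟩ := h2
  have hthick' : ∀ σ : Sheet F.K v, IsThick σ ↔ σ = A ∨ σ = B := by
    intro σ
    have : σ ∈ Finset.univ.filter (fun σ : Sheet F.K v => IsThick σ) ↔
      σ ∈ ({A, B} : Finset (Sheet F.K v)) := by rw [hthick]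
    simpa using this
  have hA : IsThick A := (hthick' A).2 (Or.inl rfl)
  have hB : IsThick B := (hthick' B).2 (Or.inr rfl)
  have hdisj : ∀ e, e ∈ touched A → e ∉ touched B := by
    intro e he he'
    have := h1 e he.1
    rw [thickAt_eq_card he.1, Finset.card_eq_one] at this
    obtain ⟨ρ, hρ⟩ := this
    have hA' : A ∈ ({ρ} : Finset (Sheet F.K v)) := by
      rw [← hρ]; simp only [Finset.mem_filter, Finset.mem_univ, true_and]; exact ⟨hA, he.2⟩
    have hB' : B ∈ ({ρ} : Finset (Sheet F.K v)) := by
      rw [← hρ]; simp only [Finset.mem_filter, Finset.mem_univ, true_and]; exact ⟨hB, he'.2⟩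
    rw [Finset.mem_singleton] at hA' hB'
    exact hAB (hA'.trans hB'.symm)
  obtain ⟨e₁, e₂, h12, hAe⟩ := Set.ncard_eq_two.1 (ncard_touched hne A)
  obtain ⟨e₃, e₄, h34, hBe⟩ := Set.ncard_eq_two.1 (ncard_touched hne B)
  have he₁ : e₁ ∈ touched A := by rw [hAe]; simp
  have he₂ : e₂ ∈ touched A := by rw [hAe]; simp
  have he₃ : e₃ ∈ touched B := by rw [hBe]; simp
  have he₄ : e₄ ∈ touched B := by rw [hBe]; simp
  have hunion : seamEdgesAt F.K v = {e₁, e₂, e₃, e₄} := by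
    have hfin : ∀ σ : Sheet F.K v, (touched σ).Finite := fun σ =>
      (seamEdgesAt_finite v).subset fun _ h => h.1
    have : touched A ∪ touched B = seamEdgesAt F.K v := by
      refine Set.eq_of_subset_of_ncard_le ?_ ?_ (seamEdgesAt_finite v)
      · rintro e (h | h) <;> exact h.1
      · rw [Set.ncard_union_eq (Set.disjoint_left.2 hdisj) (hfin A) (hfin B), ncard_touched hne,
          ncard_touched hne, hv]
    rw [← this, hAe, hBe]
    ext e
    simp only [Set.mem_union, Set.mem_insert_iff, Set.mem_singleton_iff]
    tauto
  -- the four thin sheets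
  have thin : ∀ e ∈ touched A, ∀ e' ∈ touched B, ∃ σ : Sheet F.K v, ∃ a : trisAt F.K v,
      ∃ p : Fin 4, ¬ IsThick σ ∧ touched σ = {e, e'} ∧ sheetOf F.K v a = σ ∧
        c.color a.1 = {p} := by
    intro e he e' he'
    have hee : e ≠ e' := fun h => hdisj e he (h ▸ he')
    obtain ⟨σ, hσe, hσe'⟩ := (local_model_of_seam he.1).complete hv e he.1 e' he'.1 hee
    have hσ : ¬ IsThick σ := by
      rw [hthick']
      rintro (rfl | rfl)
      · exact hdisj e' ⟨he'.1, hσe'⟩ he'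
      · exact hdisj e he ⟨he.1, hσe⟩
    obtain ⟨a, ha⟩ := σ.exists_sheetOf_eq
    have hcard : (c.color a.1).card = 1 := by
      rw [c.card_color, thickness_eq_one_of_not_isThick hσ ha]
    obtain ⟨p, hp⟩ := Finset.card_eq_one.1 hcard
    exact ⟨σ, a, p, hσ, touched_eq ⟨he.1, hσe⟩ ⟨he'.1, hσe'⟩ hee, ha, hp⟩
  have seam : ∀ e ∈ seamEdgesAt F.K v, ∀ ρ : Sheet F.K v, IsThick ρ → ρ.Touches e →
      ∀ (σ τ : Sheet F.K v) (a b : trisAt F.K v) (p q : Fin 4) (x y : Finset E3), x ≠ y →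
      ¬ IsThick σ → e ∈ touched σ → x ∈ touched σ → sheetOf F.K v a = σ → c.color a.1 = {p} →
      ¬ IsThick τ → e ∈ touched τ → y ∈ touched τ → sheetOf F.K v b = τ → c.color b.1 = {q} →
      x ≠ e → y ≠ e →
      (∃ t : trisAt F.K v, sheetOf F.K v t = ρ ∧ e ⊆ t.1.1 ∧
        c.color t.1 = {p} ∆ {q}) ∧
      c.sepAt e = separated {p} ∪ separated {q} ∪ separated ({p} ∆ {q}) := by
    intro e he ρ hρ hρe σ τ a b p q x y hxy hσ hσe hσx ha hp hτ hτe hτy hb hq hxe hye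
    have hστ : σ ≠ τ := by
      rintro rfl
      have h := touched_eq hσe hσx hxe.symm
      rw [h] at hτy
      rcases hτy with h | h
      · exact hye h
      · exact hxy h.symm
    have := c.seam_of_thin_sheets he hσ hτ hρ hστ hσe.2 hτe.2 hρe ha hb
    rwa [hp, hq] at this
  obtain ⟨σ₁₃, a₁₃, p, hσ₁₃, ht₁₃, ha₁₃, hp⟩ := thin e₁ he₁ e₃ he₃
  obtain ⟨σ₁₄, a₁₄, q, hσ₁₄, ht₁₄, ha₁₄, hq⟩ := thin e₁ he₁ e₄ he₄
  obtain ⟨σ₂₃, a₂₃, r, hσ₂₃, ht₂₃, ha₂₃, hr⟩ := thin e₂ he₂ e₃ he₃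
  obtain ⟨σ₂₄, a₂₄, s, hσ₂₄, ht₂₄, ha₂₄, hs⟩ := thin e₂ he₂ e₄ he₄
  have n13 : e₁ ≠ e₃ := fun h => hdisj _ he₁ (h ▸ he₃)
  have n14 : e₁ ≠ e₄ := fun h => hdisj _ he₁ (h ▸ he₄)
  have n23 : e₂ ≠ e₃ := fun h => hdisj _ he₂ (h ▸ he₃)
  have n24 : e₂ ≠ e₄ := fun h => hdisj _ he₂ (h ▸ he₄)
  obtain ⟨⟨t₁, hs₁, het₁, hc₁⟩, hsep₁⟩ := seam e₁ he₁.1 A hA he₁.2 σ₁₃ σ₁₄ a₁₃ a₁₄ p q e₃ e₄ h34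
    hσ₁₃ (by simp [ht₁₃]) (by simp [ht₁₃]) ha₁₃ hp hσ₁₄ (by simp [ht₁₄]) (by simp [ht₁₄]) ha₁₄ hq
    n13.symm n14.symm
  obtain ⟨⟨t₂, hs₂, het₂, hc₂⟩, hsep₂⟩ := seam e₂ he₂.1 A hA he₂.2 σ₂₃ σ₂₄ a₂₃ a₂₄ r s e₃ e₄ h34
    hσ₂₃ (by simp [ht₂₃]) (by simp [ht₂₃]) ha₂₃ hr hσ₂₄ (by simp [ht₂₄]) (by simp [ht₂₄]) ha₂₄ hs
    n23.symm n24.symm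
  obtain ⟨⟨t₃, hs₃, het₃, hc₃⟩, hsep₃⟩ := seam e₃ he₃.1 B hB he₃.2 σ₁₃ σ₂₃ a₁₃ a₂₃ p r e₁ e₂ h12
    hσ₁₃ (by simp [ht₁₃]) (by simp [ht₁₃]) ha₁₃ hp hσ₂₃ (by simp [ht₂₃]) (by simp [ht₂₃]) ha₂₃ hr
    n13 n23
  obtain ⟨⟨t₄, hs₄, het₄, hc₄⟩, hsep₄⟩ := seam e₄ he₄.1 B hB he₄.2 σ₁₄ σ₂₄ a₁₄ a₂₄ q s e₁ e₂ h12
    hσ₁₄ (by simp [ht₁₄]) (by simp [ht₁₄]) ha₁₄ hq hσ₂₄ (by simp [ht₂₄]) (by simp [ht₂₄]) ha₂₄ hs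
    n14 n24
  have hsep : c.sepAt {v} = separatedSquare p q r s := by
    ext x
    rw [c.mem_sepAt_vertex_iff hne, hunion]
    simp only [Set.mem_insert_iff, Set.mem_singleton_iff, exists_eq_or_imp, exists_eq_left, hsep₁,
      hsep₂, hsep₃, hsep₄, separatedSquare, Finset.mem_union, or_assoc]
  have hcard₁ : (({p} : Finset (Fin 4)) ∆ {q}).card = 2 := by
    rw [← hc₁, c.card_color, hA.thickness_eq hs₁]
  have hcard₃ : (({p} : Finset (Fin 4)) ∆ {r}).card = 2 := by
    rw [← hc₃, c.card_color, hB.thickness_eq hs₃]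
  obtain ⟨hlA, hlB⟩ := linesThrough_eq hne hA hB hAB fun σ h => (hthick' σ).1 h
  have endsA := c.color_ends_of_sheet hA he₁.1 he₂.1 h12 hs₁ hs₂ het₁ het₂
  have endsB := c.color_ends_of_sheet hB he₃.1 he₄.1 h34 hs₃ hs₄ het₃ het₄
  rw [hc₁, hc₂, ← hlA] at endsA
  rw [hc₃, hc₄, ← hlB] at endsB
  rw [hsep]
  exact ⟨fun h => card_separatedSquare_of_eq p q r s ⟨hcard₁, hcard₃, endsA.1 h, endsB.1 h⟩,
    fun h => card_separatedSquare_of_eq_compl p q r s ⟨hcard₁, hcard₃, endsA.2 h, endsB.2 h⟩⟩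

theorem card_sepAt_of_thickAt_eq_three {v : E3} {e : Finset E3} (he : e ∈ seamEdgesAt F.K v)
    (h : thickAt F.K F.thickness e = 3) : (c.sepAt {v}).card = 6 := by
  refine (c.card_sepAt_le _).antisymm ?_
  rw [← (c.card_sepAt_seam he.1).2 h]
  exact Finset.card_le_card (c.sepAt_mono (Finset.singleton_subset_iff.2 he.2))

end Coloring

end Foam

/-! ### Counting simplices -/

namespace Foam

variable {F : Foam}

noncomputable instance : Fintype {e : Finset E3 // e ∈ seamEdges F.K} :=
  have : Finite {e : Finset E3 // e ∈ seamEdges F.K} :=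
    (F.finite.subset fun _ (h : _ ∈ seamEdges F.K) => h.1.1).to_subtype
  Fintype.ofFinite _

noncomputable instance : Fintype (Facet F.K) := Fintype.ofFinite _

noncomputable instance : Fintype F.Seam := Fintype.ofFinite _

theorem eulerChar_eq_sum {S : Set (Finset E3)} (hS : S ⊆ F.K.faces) :
    eulerChar S = ∑ s ∈ F.finite.toFinset, if s ∈ S then (-1 : ℤ) ^ (s.card + 1) else 0 := by
  rw [eulerChar, finsum_mem_eq_finite_toFinset_sum _ (F.finite.subset hS), ← Finset.sum_filter]
  refine Finset.sum_congr ?_ fun _ _ => rfl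
  ext s
  simp only [Set.Finite.mem_toFinset, Finset.mem_filter]
  exact ⟨fun h => ⟨hS h, h⟩, fun h => h.2⟩

theorem Coloring.mem_bicolored_iff (c : F.Coloring) {i j : Fin 4} (hij : i < j) {s : Finset E3}
    (hs : s ∈ F.K.faces) : s ∈ c.bicolored i j ↔ (i, j) ∈ c.sepAt s := by
  rw [Coloring.mem_sepAt]
  simp only [mem_separated hij]
  exact and_iff_right hs

/-- Each simplex is counted in the Euler characteristics of the surfaces `F_ij(c)` that contain
it. -/
theorem Coloring.sum_eulerChar_bicolored (c : F.Coloring) :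
    ∑ i : Fin 4, ∑ j ∈ Finset.Ioi i, eulerChar (c.bicolored i j) =
      ∑ s ∈ F.finite.toFinset, (-1 : ℤ) ^ (s.card + 1) * (c.sepAt s).card := by
  have h1 : ∀ i : Fin 4, ∑ j ∈ Finset.Ioi i, eulerChar (c.bicolored i j) =
      ∑ j : Fin 4, ∑ s ∈ F.finite.toFinset,
        if (i, j) ∈ c.sepAt s then (-1 : ℤ) ^ (s.card + 1) else 0 := by
    intro i
    rw [← Finset.sum_subset (Finset.subset_univ (Finset.Ioi i))]
    · refine Finset.sum_congr rfl fun j hj => ?_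
      rw [eulerChar_eq_sum fun s h => h.1]
      refine Finset.sum_congr rfl fun s hs => ?_
      exact if_congr (c.mem_bicolored_iff (Finset.mem_Ioi.1 hj) ((Set.Finite.mem_toFinset _).1 hs))
        rfl rfl
    · intro j _ hj
      refine Finset.sum_eq_zero fun s _ => if_neg fun h => ?_
      obtain ⟨t, -, ht⟩ := Coloring.mem_sepAt.1 h
      simp only [separated, Finset.mem_filter] at ht
      exact hj (Finset.mem_Ioi.2 ht.2.1)
  rw [Finset.sum_congr rfl fun i _ => h1 i,
    ← Fintype.sum_prod_type' (f := fun i j : Fin 4 => ∑ s ∈ F.finite.toFinset,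
        if (i, j) ∈ c.sepAt s then (-1 : ℤ) ^ (s.card + 1) else 0), Finset.sum_comm]
  refine Finset.sum_congr rfl fun s _ => ?_
  rw [Finset.sum_ite_mem, Finset.univ_inter, Finset.sum_const, nsmul_eq_mul, mul_comm]

/-! ### Simplices inside the facets -/

/-- A regular point has only one sheet. -/
theorem sheetOf_eq_of_regular_vertex {v : E3} (hv : v ∈ F.K.vertices)
    (h : ∀ e ∈ seamEdges F.K, v ∉ e) (t t' : trisAt F.K v) : sheetOf F.K v t = sheetOf F.K v t' := by
  have hreach := (F.local_model v hv).link_connected.preconnected t t'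
  refine SimpleGraph.ConnectedComponent.sound (hreach.mono ?_)
  intro a b hab
  obtain ⟨hne, w, -, ha, hb⟩ := (induce_adj_iff _ _ _ _).1 hab
  exact (induce_adj_iff _ _ _ _).2 ⟨hne, w, fun hs => h _ hs (by simp), ha, hb⟩

/-- A simplex outside the seams lies in one facet. -/
theorem facetOf_eq_of_subset {s : Finset E3} (hs : s ∈ F.K.faces)
    (h : ∀ e ∈ seamEdges F.K, ¬ s ⊆ e) {t t' : Tri F.K} (ht : s ⊆ t.1) (ht' : s ⊆ t'.1) :
    facetOf F.K t = facetOf F.K t' := by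
  have hcard : s.card = 1 ∨ s.card = 2 ∨ s.card = 3 := by
    have := F.dim_le s hs
    have := (F.K.nonempty_of_mem_faces hs).card_pos
    omega
  rcases hcard with h1 | h2 | h3
  · obtain ⟨v, rfl⟩ := Finset.card_eq_one.1 h1
    simp only [Finset.singleton_subset_iff] at h ht ht'
    exact facetOf_eq_of_sheetOf_eq (sheetOf_eq_of_regular_vertex hs h ⟨t, ht⟩ ⟨t', ht'⟩)
  · by_cases htt : t = t'
    · rw [htt]
    · exact facetOf_eq_of_adj ⟨htt, s, ⟨hs, h2⟩, fun hS => h s hS subset_rfl, ht, ht'⟩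
  · have h4 := Finset.eq_of_subset_of_card_le ht (by rw [t.2.2, h3])
    have h5 := Finset.eq_of_subset_of_card_le ht' (by rw [t'.2.2, h3])
    rw [Subtype.ext (h4.symm.trans h5)]

theorem Coloring.card_sepAt_of_mem_facetSimplices (c : F.Coloring) {s : Finset E3} {f : Facet F.K}
    (hs : s ∈ facetSimplices F.K f) : (c.sepAt s).card = F.thickness f + 2 := by
  obtain ⟨hsK, h, t, rfl, ht⟩ := hs
  have hsep : c.sepAt s = separated (c.color t) := by
    ext p
    rw [Coloring.mem_sepAt]
    constructor
    · rintro ⟨t', ht', hp⟩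
      rwa [c.separated_color_eq_of_facetOf_eq (facetOf_eq_of_subset hsK h ht ht')]
    · exact fun hp => ⟨t, ht, hp⟩
  rw [hsep, ← c.card_color]
  rcases c.card_color_eq t with h1 | h2
  · rw [card_separated_of_card_one _ h1, h1]
  · rw [card_separated_of_card_two _ h2, h2]

/-- A facet of thickness `k` belongs to `k + 2` of the surfaces `F_ij(c)`. -/
theorem Coloring.sum_facets (c : F.Coloring) :
    ∑ s ∈ F.finite.toFinset.filter (fun s => ∀ e ∈ seamEdges F.K, ¬ s ⊆ e),
      (-1 : ℤ) ^ (s.card + 1) * (c.sepAt s).card =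
    3 * ∑ᶠ (f : Facet F.K) (_ : F.thickness f = 1), eulerChar (facetSimplices F.K f) +
    4 * ∑ᶠ (f : Facet F.K) (_ : F.thickness f = 2), eulerChar (facetSimplices F.K f) := by
  have hfin : ∀ k, ∑ᶠ (f : Facet F.K) (_ : F.thickness f = k), eulerChar (facetSimplices F.K f) =
      ∑ f : Facet F.K, if F.thickness f = k then eulerChar (facetSimplices F.K f) else 0 := by
    intro k
    rw [finsum_eq_sum_of_fintype]
    exact Finset.sum_congr rfl fun f _ => finsum_eq_if
  rw [hfin, hfin, Finset.mul_sum, Finset.mul_sum, ← Finset.sum_add_distrib]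
  have hterm : ∀ f : Facet F.K,
      (3 * (if F.thickness f = 1 then eulerChar (facetSimplices F.K f) else 0) +
        4 * (if F.thickness f = 2 then eulerChar (facetSimplices F.K f) else 0) : ℤ) =
      ∑ s ∈ F.finite.toFinset, if s ∈ facetSimplices F.K f then
        (-1 : ℤ) ^ (s.card + 1) * (c.sepAt s).card else 0 := by
    intro f
    have : ∀ s, (if s ∈ facetSimplices F.K f then
        (-1 : ℤ) ^ (s.card + 1) * (c.sepAt s).card else 0) = (F.thickness f + 2 : ℕ) *
        (if s ∈ facetSimplices F.K f then (-1 : ℤ) ^ (s.card + 1) else 0) := by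
      intro s
      split_ifs with h
      · rw [c.card_sepAt_of_mem_facetSimplices h, mul_comm]
      · rw [mul_zero]
    rw [Finset.sum_congr rfl fun s _ => this s, ← Finset.mul_sum,
      ← eulerChar_eq_sum fun s h => h.1]
    rcases F.thickness_eq f with h | h <;> simp [h]
  rw [Finset.sum_congr rfl fun f _ => hterm f, Finset.sum_comm, Finset.sum_filter]
  refine Finset.sum_congr rfl fun s hs => ?_
  rw [Set.Finite.mem_toFinset] at hs
  split_ifs with h
  · obtain ⟨t, ht⟩ := F.pure s hs
    rw [Finset.sum_eq_single (facetOf F.K t), if_pos ⟨hs, h, t, rfl, ht⟩]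
    · rintro f - hf
      refine if_neg ?_
      rintro ⟨-, -, t', rfl, ht'⟩
      exact hf (facetOf_eq_of_subset hs h ht' ht)
    · exact fun h => absurd (Finset.mem_univ _) h
  · exact (Finset.sum_eq_zero fun f _ => if_neg fun hf => h hf.2.1).symm

/-! ### Seams and singular vertices -/

/-- The vertices on the seams. -/
noncomputable def seamVertices (F : Foam) : Finset E3 :=
  Finset.univ.biUnion fun e : {e : Finset E3 // e ∈ seamEdges F.K} => e.1

theorem mem_seamVertices {v : E3} : v ∈ seamVertices F ↔ (seamEdgesAt F.K v).Nonempty := by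
  simp only [seamVertices, Finset.mem_biUnion, Finset.mem_univ, true_and, Subtype.exists]
  exact ⟨fun ⟨e, he, hv⟩ => ⟨e, he, hv⟩, fun ⟨e, he, hv⟩ => ⟨e, he, hv⟩⟩

theorem mem_seamVertices_of_isSingular {v : E3} (hv : IsSingular F.K v) : v ∈ seamVertices F :=
  mem_seamVertices.2 (Set.nonempty_of_ncard_ne_zero (by rw [hv.2]; norm_num))

theorem ncard_seamEdgesAt_of_not_isSingular {v : E3} (hv : ¬ IsSingular F.K v)
    (h : (seamEdgesAt F.K v).Nonempty) : (seamEdgesAt F.K v).ncard = 2 := by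
  obtain ⟨e, he⟩ := id h
  have hvK := mem_vertices_of_mem_edges he.1.1 he.2
  rcases (F.local_model v hvK).branch_count with h0 | h2 | h4
  · rw [Set.ncard_eq_zero (seamEdgesAt_finite v)] at h0
    rw [h0] at h
    exact absurd h (by simp)
  · exact h2
  · exact absurd ⟨hvK, h4⟩ hv

theorem sum_seam_simplices (f : Finset E3 → ℤ) :
    ∑ s ∈ F.finite.toFinset.filter (fun s => ¬ ∀ e ∈ seamEdges F.K, ¬ s ⊆ e),
      (-1 : ℤ) ^ (s.card + 1) * f s =
    ∑ v ∈ seamVertices F, f {v} - ∑ e : {e : Finset E3 // e ∈ seamEdges F.K}, f e.1 := by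
  have hset : F.finite.toFinset.filter (fun s => ¬ ∀ e ∈ seamEdges F.K, ¬ s ⊆ e) =
      (seamVertices F).image (fun v => {v}) ∪
        Finset.univ.image (fun e : {e : Finset E3 // e ∈ seamEdges F.K} => e.1) := by
    ext s
    simp only [Finset.mem_filter, Set.Finite.mem_toFinset, Finset.mem_union, Finset.mem_image,
      Finset.mem_univ, true_and, not_forall, not_not, mem_seamVertices, Subtype.exists]
    constructor
    · rintro ⟨hs, e, he, hse⟩
      have h0 := (F.K.nonempty_of_mem_faces hs).card_pos
      have h2 := Finset.card_le_card hse
      rw [he.1.2] at h2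
      by_cases h1 : s.card = 1
      · obtain ⟨v, rfl⟩ := Finset.card_eq_one.1 h1
        exact Or.inl ⟨v, ⟨e, he, Finset.singleton_subset_iff.1 hse⟩, rfl⟩
      · exact Or.inr ⟨e, he, (Finset.eq_of_subset_of_card_le hse (by rw [he.1.2]; omega)).symm⟩
    · rintro (⟨v, ⟨e, he⟩, rfl⟩ | ⟨e, he, rfl⟩)
      · exact ⟨mem_vertices_of_mem_edges he.1.1 he.2, e, he.1, Finset.singleton_subset_iff.2 he.2⟩
      · exact ⟨he.1.1, e, he, subset_rfl⟩
  rw [hset, Finset.sum_union, Finset.sum_image, Finset.sum_image, sub_eq_add_neg,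
    ← Finset.sum_neg_distrib]
  · congr 1
    · exact Finset.sum_congr rfl fun v _ => by simp
    · exact Finset.sum_congr rfl fun e _ => by rw [e.2.1.2]; ring
  · exact Subtype.val_injective.injOn
  · exact (Finset.singleton_injective).injOn
  · rw [Finset.disjoint_left]
    intro s h h'
    simp only [Finset.mem_image, Finset.mem_univ, true_and] at h h'
    obtain ⟨v, -, rfl⟩ := h
    obtain ⟨e, he⟩ := h'
    have := e.2.1.2
    rw [he] at this
    simp at this

/-- The edges of a seam. -/
noncomputable def seamPart (σ : F.Seam) : Finset {e : Finset E3 // e ∈ seamEdges F.K} :=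
  Finset.univ.filter fun e => F.seamGraph.connectedComponentMk e = σ

/-- The vertices on a seam that are not singular. -/
noncomputable def seamPoints (σ : F.Seam) : Finset E3 :=
  ((seamPart σ).biUnion fun e => e.1).filter fun v => ¬ IsSingular F.K v

theorem mem_seamPart {σ : F.Seam} {e : {e : Finset E3 // e ∈ seamEdges F.K}} :
    e ∈ seamPart σ ↔ F.seamGraph.connectedComponentMk e = σ := by
  simp [seamPart]

/-- The Euler characteristic of a seam. -/
theorem card_seamPart (σ : F.Seam) :
    (seamPart σ).card = (seamPoints σ).card + if σ.IsInterval then 1 else 0 := by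
  have hadj : ∀ e e', F.seamGraph.Adj e e' ↔
      e ≠ e' ∧ ∃ v, ¬ IsSingular F.K v ∧ v ∈ e.1 ∧ v ∈ e'.1 := fun e e' =>
    ⟨fun ⟨h, v, h1, h2, h3⟩ => ⟨h, v, h3, h1, h2⟩, fun ⟨h, v, h1, h2, h3⟩ => ⟨h, v, h2, h3, h1⟩⟩
  have hJ : ∀ v, ¬ IsSingular F.K v → ∀ e : {e : Finset E3 // e ∈ seamEdges F.K}, v ∈ e.1 →
      (Finset.univ.filter fun e : {e : Finset E3 // e ∈ seamEdges F.K} => v ∈ e.1).card = 2 := by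
    intro v hv e he
    rw [← ncard_seamEdgesAt_of_not_isSingular hv ⟨e.1, e.2, he⟩, ← Set.ncard_coe_finset,
      ← Set.ncard_image_of_injective _ Subtype.val_injective]
    congr 1
    ext x
    simp only [Finset.coe_filter, Finset.mem_univ, true_and, Set.mem_image, Set.mem_ofPred_eq,
      Subtype.exists]
    exact ⟨fun ⟨a, ha, hva, hx⟩ => hx ▸ ⟨ha, hva⟩, fun h => ⟨x, h.1, h.2, rfl⟩⟩
  have key := circle_or_interval F.seamGraph (fun e => e.1) (fun v => ¬ IsSingular F.K v)
    (fun e => e.2.1.2) hadj hJ σ (seamPart σ) fun e => mem_seamPart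
  simp only [not_not] at key
  rcases key with ⟨h0, h⟩ | ⟨h2, h⟩
  · rw [if_neg, add_zero]
    · exact h
    · rintro ⟨e, he, v, hv, hs⟩
      have hmem : v ∈ ((seamPart σ).biUnion fun e => e.1).filter fun v => IsSingular F.K v :=
        Finset.mem_filter.2 ⟨Finset.mem_biUnion.2 ⟨e, mem_seamPart.2 he, hv⟩, hs⟩
      have := (Finset.sum_eq_zero_iff.1 h0) v hmem
      rw [Finset.card_eq_zero] at this
      exact absurd (Finset.mem_filter.2 ⟨mem_seamPart.2 he, hv⟩) (this ▸ Finset.notMem_empty e)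
  · rw [if_pos]
    · exact h
    · obtain ⟨v, hv, -⟩ := Finset.exists_ne_zero_of_sum_ne_zero (by rw [h2]; norm_num)
      obtain ⟨h1, hs⟩ := Finset.mem_filter.1 hv
      obtain ⟨e, he, hve⟩ := Finset.mem_biUnion.1 h1
      exact ⟨e, mem_seamPart.1 he, v, hve, hs⟩

namespace Coloring

variable (c : F.Coloring)

theorem sepAt_eq_of_mem_seamPart {σ : F.Seam} {e e' : {e : Finset E3 // e ∈ seamEdges F.K}}
    (he : e ∈ seamPart σ) (he' : e' ∈ seamPart σ) : c.sepAt e.1 = c.sepAt e'.1 := by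
  have hr := SimpleGraph.ConnectedComponent.exact
    ((mem_seamPart.1 he).trans (mem_seamPart.1 he').symm)
  rw [SimpleGraph.reachable_iff_reflTransGen] at hr
  clear he'
  induction hr with
  | refl => rfl
  | @tail a b _ hab ih =>
    obtain ⟨-, v, ha, hb, hs⟩ := hab
    have h2 := ncard_seamEdgesAt_of_not_isSingular hs ⟨a.1, a.2, ha⟩
    rw [ih, ← c.sepAt_seam_point h2 ⟨a.2, ha⟩, ← c.sepAt_seam_point h2 ⟨b.2, hb⟩]

/-- The contribution of a seam. -/
theorem sum_seam (σ : F.Seam) :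
    ∑ e ∈ seamPart σ, ((c.sepAt e.1).card : ℤ) - ∑ v ∈ seamPoints σ, ((c.sepAt {v}).card : ℤ) =
      5 * (if σ.IsInterval ∧ σ.Is112 then 1 else 0) +
        6 * (if σ.IsInterval ∧ σ.Is222 then 1 else 0) := by
  obtain ⟨e₀, he₀⟩ := σ.exists_rep
  have he₀ : e₀ ∈ seamPart σ := mem_seamPart.2 he₀
  have h1 : ∀ e ∈ seamPart σ, ((c.sepAt e.1).card : ℤ) = (c.sepAt e₀.1).card := fun e he => by
    rw [c.sepAt_eq_of_mem_seamPart he he₀]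
  have h2 : ∀ v ∈ seamPoints σ, ((c.sepAt {v}).card : ℤ) = (c.sepAt e₀.1).card := by
    intro v hv
    obtain ⟨hv, hs⟩ := Finset.mem_filter.1 hv
    obtain ⟨e, he, hve⟩ := Finset.mem_biUnion.1 hv
    rw [c.sepAt_seam_point (ncard_seamEdgesAt_of_not_isSingular hs ⟨e.1, e.2, hve⟩) ⟨e.2, hve⟩,
      h1 e he]
  rw [Finset.sum_congr rfl h1, Finset.sum_congr rfl h2, Finset.sum_const, Finset.sum_const,
    card_seamPart]
  have hth : ∀ e ∈ seamPart σ, thickAt F.K F.thickness e.1 = thickAt F.K F.thickness e₀.1 := by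
    intro e he
    have h := congrArg Finset.card (c.sepAt_eq_of_mem_seamPart he he₀)
    rcases F.seam_type _ e.2 with h3 | h3 <;> rcases F.seam_type _ e₀.2 with h4 | h4
    · rw [h3, h4]
    · rw [(c.card_sepAt_seam e.2).1 h3, (c.card_sepAt_seam e₀.2).2 h4] at h
      exact absurd h (by norm_num)
    · rw [(c.card_sepAt_seam e.2).2 h3, (c.card_sepAt_seam e₀.2).1 h4] at h
      exact absurd h (by norm_num)
    · rw [h3, h4]
  have h112 : σ.Is112 ↔ thickAt F.K F.thickness e₀.1 = 1 :=
    ⟨fun h => h e₀ (mem_seamPart.1 he₀), fun h e he => (hth e (mem_seamPart.2 he)).trans h⟩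
  have h222 : σ.Is222 ↔ thickAt F.K F.thickness e₀.1 = 3 :=
    ⟨fun h => h e₀ (mem_seamPart.1 he₀), fun h e he => (hth e (mem_seamPart.2 he)).trans h⟩
  rw [h112, h222]
  rcases F.seam_type _ e₀.2 with h3 | h3
  · rw [(c.card_sepAt_seam e₀.2).1 h3, h3]
    by_cases hI : σ.IsInterval <;> (simp [hI]; try ring)
  · rw [(c.card_sepAt_seam e₀.2).2 h3, h3]
    by_cases hI : σ.IsInterval <;> (simp [hI]; try ring)

theorem card_sepAt_of_isSingular {v : E3} (hv : IsSingular F.K v) :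
    ((c.sepAt {v}).card : ℤ) = 6 * (if v ∈ F.vertices06 ∪ F.vertices33 then 1 else 0) +
      5 * (if v ∈ F.vertices42 ∧ Even (F.linesThrough v) then 1 else 0) +
      6 * (if v ∈ F.vertices42 ∧ Odd (F.linesThrough v) then 1 else 0) := by
  have h06 : v ∈ F.vertices06 ∪ F.vertices33 ↔
      thickSheets F.K F.thickness v = 6 ∨ thickSheets F.K F.thickness v = 3 :=
    or_congr (and_iff_right hv) (and_iff_right hv)
  have h42 : v ∈ F.vertices42 ↔ thickSheets F.K F.thickness v = 2 := and_iff_right hv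
  simp only [h06, h42]
  rcases thickSheets_cases hv.2 with ⟨h1, h2⟩ | ⟨⟨e, he, h3⟩, h | h⟩
  · have := c.card_sepAt_of_thickSheets_eq_two hv.2 h1 h2
    rcases Nat.even_or_odd (F.linesThrough v) with h | h
    · rw [this.1 h, h2]
      simp [h, Nat.not_odd_iff_even.2 h]
    · rw [this.2 h, h2]
      simp [h, Nat.not_even_iff_odd.2 h]
  · rw [c.card_sepAt_of_thickAt_eq_three he h3, h]; norm_num
  · rw [c.card_sepAt_of_thickAt_eq_three he h3, h]; norm_num

theorem ncard_eq_sum_seamVertices {S : Set E3} (hS : ∀ v ∈ S, IsSingular F.K v) :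
    (S.ncard : ℤ) = ∑ v ∈ (seamVertices F).filter (fun v => IsSingular F.K v),
      if v ∈ S then 1 else 0 := by
  rw [Finset.sum_boole, ← Set.ncard_coe_finset]
  congr 2
  ext v
  simp only [Finset.coe_filter, Finset.mem_filter, Set.mem_ofPred_eq]
  exact ⟨fun h => ⟨⟨mem_seamVertices_of_isSingular (hS v h), hS v h⟩, h⟩, fun h => h.2⟩

theorem sum_singular_vertices :
    ∑ v ∈ (seamVertices F).filter (fun v => IsSingular F.K v), ((c.sepAt {v}).card : ℤ) =
      6 * ((F.vertices06 ∪ F.vertices33).ncard : ℤ) +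
      5 * ({v | v ∈ F.vertices42 ∧ Even (F.linesThrough v)}.ncard : ℤ) +
      6 * ({v | v ∈ F.vertices42 ∧ Odd (F.linesThrough v)}.ncard : ℤ) := by
  rw [ncard_eq_sum_seamVertices (S := F.vertices06 ∪ F.vertices33)
      (by rintro v (h | h) <;> exact h.1),
    ncard_eq_sum_seamVertices (S := {v | v ∈ F.vertices42 ∧ Even (F.linesThrough v)})
      (fun v h => h.1.1),
    ncard_eq_sum_seamVertices (S := {v | v ∈ F.vertices42 ∧ Odd (F.linesThrough v)})
      (fun v h => h.1.1), Finset.mul_sum, Finset.mul_sum, Finset.mul_sum, ← Finset.sum_add_distrib,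
    ← Finset.sum_add_distrib]
  refine Finset.sum_congr rfl fun v hv => ?_
  convert c.card_sepAt_of_isSingular (Finset.mem_filter.1 hv).2 <;> rfl

theorem sum_seams :
    ∑ e : {e : Finset E3 // e ∈ seamEdges F.K}, ((c.sepAt e.1).card : ℤ) -
      ∑ v ∈ (seamVertices F).filter (fun v => ¬ IsSingular F.K v), ((c.sepAt {v}).card : ℤ) =
      5 * ({σ : F.Seam | σ.IsInterval ∧ σ.Is112}.ncard : ℤ) +
      6 * ({σ : F.Seam | σ.IsInterval ∧ σ.Is222}.ncard : ℤ) := by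
  have hE : ∑ e : {e : Finset E3 // e ∈ seamEdges F.K}, ((c.sepAt e.1).card : ℤ) =
      ∑ σ : F.Seam, ∑ e ∈ seamPart σ, ((c.sepAt e.1).card : ℤ) :=
    (Finset.sum_fiberwise _ F.seamGraph.connectedComponentMk _).symm
  have hdisj : ∀ σ ∈ (Finset.univ : Finset F.Seam), ∀ τ ∈ (Finset.univ : Finset F.Seam), σ ≠ τ →
      Disjoint (seamPoints σ) (seamPoints τ) := by
    intro σ _ τ _ hne
    rw [Finset.disjoint_left]
    intro v hσ hτ
    obtain ⟨h1, hs⟩ := Finset.mem_filter.1 hσ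
    obtain ⟨e, he, hve⟩ := Finset.mem_biUnion.1 h1
    obtain ⟨e', he', hve'⟩ := Finset.mem_biUnion.1 (Finset.mem_filter.1 hτ).1
    rw [mem_seamPart] at he he'
    refine hne (he.symm.trans (Eq.trans ?_ he'))
    by_cases h : e = e'
    · rw [h]
    · exact SimpleGraph.ConnectedComponent.sound
        (SimpleGraph.Adj.reachable ⟨h, v, hve, hve', hs⟩)
  have hV : (seamVertices F).filter (fun v => ¬ IsSingular F.K v) =
      (Finset.univ : Finset F.Seam).biUnion seamPoints := by
    ext v
    simp only [seamVertices, seamPoints, Finset.mem_filter, Finset.mem_biUnion, Finset.mem_univ,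
      true_and]
    constructor
    · rintro ⟨⟨e, he⟩, hs⟩
      exact ⟨_, ⟨e, mem_seamPart.2 rfl, he⟩, hs⟩
    · rintro ⟨_, ⟨e, -, he⟩, hs⟩
      exact ⟨⟨e, he⟩, hs⟩
  have hcount : ∀ P : F.Seam → Prop,
      ({σ | P σ}.ncard : ℤ) = ∑ σ : F.Seam, if P σ then 1 else 0 := by
    intro P
    rw [Finset.sum_boole, ← Set.ncard_coe_finset]
    congr 2
    ext σ
    simp
  rw [hE, hV, Finset.sum_biUnion hdisj, ← Finset.sum_sub_distrib,
    Finset.sum_congr rfl fun σ _ => c.sum_seam σ, hcount, hcount, Finset.mul_sum, Finset.mul_sum,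
    ← Finset.sum_add_distrib]
  exact Finset.sum_congr rfl fun σ _ => by congr

/-- The degree of a foam, up to the contribution of its dots. -/
theorem degree_eq :
    F.degree = (F.dots.map fun d => 2 * (d.label.totalDegree : ℤ)).sum -
      ∑ i : Fin 4, ∑ j ∈ Finset.Ioi i, eulerChar (c.bicolored i j) := by
  rw [c.sum_eulerChar_bicolored, ← Finset.sum_filter_add_sum_filter_not F.finite.toFinset
      (fun s => ∀ e ∈ seamEdges F.K, ¬ s ⊆ e), c.sum_facets,
    sum_seam_simplices fun s => ((c.sepAt s).card : ℤ),
    ← Finset.sum_filter_add_sum_filter_not (seamVertices F) (fun v => IsSingular F.K v),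
    c.sum_singular_vertices, degree]
  linarith [c.sum_seams]

end Coloring

end Foam

/-! ### The bicolored surfaces -/

namespace Foam

variable {F : Foam}

namespace Coloring

variable (c : F.Coloring) (p : Fin 4 × Fin 4)

/-- The triangles of the bicolored surface that belongs to a pair of pigments. -/
noncomputable def surfaceTris : Finset (Finset E3) :=
  (Finset.univ.filter fun t : Tri F.K => p ∈ separated (c.color t)).image fun t => t.1

variable {c p}

theorem mem_surfaceTris {t : Tri F.K} :
    t.1 ∈ c.surfaceTris p ↔ p ∈ separated (c.color t) := by
  simp only [surfaceTris, Finset.mem_image, Finset.mem_filter, Finset.mem_univ, true_and]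
  exact ⟨fun ⟨t', h, ht⟩ => Subtype.ext ht ▸ h, fun h => ⟨t, h, rfl⟩⟩

theorem exists_tri_of_mem_surfaceTris {s : Finset E3} (hs : s ∈ c.surfaceTris p) :
    ∃ t : Tri F.K, t.1 = s := by
  obtain ⟨t, -, h⟩ := Finset.mem_image.1 hs
  exact ⟨t, h⟩

theorem mem_surfaceTris_congr {t t' : Tri F.K} (h : facetOf F.K t = facetOf F.K t') :
    t.1 ∈ c.surfaceTris p ↔ t'.1 ∈ c.surfaceTris p := by
  rw [mem_surfaceTris, mem_surfaceTris, c.separated_color_eq_of_facetOf_eq h]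

/-- The surface passes through an even number of the three sheets at a seam. -/
theorem mem_surfaceTris_seam {e : Finset E3} (he : e ∈ seamEdges F.K) {a b d : Tri F.K}
    (hab : a ≠ b) (had : a ≠ d) (hbd : b ≠ d) (habd : trisOn F.K e = {a, b, d}) :
    d.1 ∈ c.surfaceTris p ↔ ¬ (a.1 ∈ c.surfaceTris p ↔ b.1 ∈ c.surfaceTris p) := by
  rw [mem_surfaceTris, mem_surfaceTris, mem_surfaceTris, c.color_eq_symmDiff he hab had hbd habd,
    mem_separated_symmDiff]

theorem card_surfaceTris_edge {t : Finset E3} (ht : t ∈ c.surfaceTris p) {e : Finset E3}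
    (het : e ⊆ t) (he2 : e.card = 2) :
    ((c.surfaceTris p).filter fun t' => e ⊆ t').card = 2 := by
  obtain ⟨t, rfl⟩ := exists_tri_of_mem_surfaceTris ht
  have he : e ∈ edges F.K := mem_edges_of_subset het he2
  have pair : ∀ x y : Tri F.K, x ≠ y → (∀ z : Tri F.K, e ⊆ z.1 ∧ z.1 ∈ c.surfaceTris p ↔
      z = x ∨ z = y) → ((c.surfaceTris p).filter fun t' => e ⊆ t').card = 2 := by
    intro x y hxy h
    rw [← Finset.card_pair fun h : x.1 = y.1 => hxy (Subtype.ext h)]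
    congr 1
    ext s
    simp only [Finset.mem_filter, Finset.mem_insert, Finset.mem_singleton]
    constructor
    · rintro ⟨hs, hes⟩
      obtain ⟨z, rfl⟩ := exists_tri_of_mem_surfaceTris hs
      exact ((h z).1 ⟨hes, hs⟩).imp (congrArg _) (congrArg _)
    · rintro (rfl | rfl)
      · exact ((h x).2 (Or.inl rfl)).symm
      · exact ((h y).2 (Or.inr rfl)).symm
  by_cases hs : e ∈ seamEdges F.K
  · obtain ⟨a, b, d, hab, had, hbd, habd⟩ := exists_trisOn_eq_triple hs
    have hon : ∀ z : Tri F.K, e ⊆ z.1 ↔ z = a ∨ z = b ∨ z = d := fun z => by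
      have : z ∈ trisOn F.K e ↔ z ∈ ({a, b, d} : Set (Tri F.K)) := by rw [habd]
      exact this
    have hd := mem_surfaceTris_seam (c := c) (p := p) hs hab had hbd habd
    have ht' := (hon t).1 het
    by_cases ha : a.1 ∈ c.surfaceTris p <;> by_cases hb : b.1 ∈ c.surfaceTris p
    · have hd : d.1 ∉ c.surfaceTris p := by tauto
      refine pair a b hab fun z => ⟨?_, ?_⟩
      · rintro ⟨hz, hzM⟩
        rcases (hon z).1 hz with rfl | rfl | rfl
        exacts [Or.inl rfl, Or.inr rfl, absurd hzM hd]
      · rintro (rfl | rfl)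
        exacts [⟨(hon _).2 (by simp), ha⟩, ⟨(hon _).2 (by simp), hb⟩]
    · have hd : d.1 ∈ c.surfaceTris p := by tauto
      refine pair a d had fun z => ⟨?_, ?_⟩
      · rintro ⟨hz, hzM⟩
        rcases (hon z).1 hz with rfl | rfl | rfl
        exacts [Or.inl rfl, absurd hzM hb, Or.inr rfl]
      · rintro (rfl | rfl)
        exacts [⟨(hon _).2 (by simp), ha⟩, ⟨(hon _).2 (by simp), hd⟩]
    · have hd : d.1 ∈ c.surfaceTris p := by tauto
      refine pair b d hbd fun z => ⟨?_, ?_⟩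
      · rintro ⟨hz, hzM⟩
        rcases (hon z).1 hz with rfl | rfl | rfl
        exacts [absurd hzM ha, Or.inl rfl, Or.inr rfl]
      · rintro (rfl | rfl)
        exacts [⟨(hon _).2 (by simp), hb⟩, ⟨(hon _).2 (by simp), hd⟩]
    · have hd : d.1 ∉ c.surfaceTris p := by tauto
      rcases ht' with rfl | rfl | rfl <;> contradiction
  · obtain ⟨a, b, hab, heq⟩ := exists_trisOn_eq_pair he hs
    have hon : ∀ z : Tri F.K, e ⊆ z.1 ↔ z = a ∨ z = b := fun z => by
      have : z ∈ trisOn F.K e ↔ z ∈ ({a, b} : Set (Tri F.K)) := by rw [heq]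
      exact this
    refine pair a b hab fun z => ⟨fun h => (hon z).1 h.1, fun h => ?_⟩
    have hz := (hon z).2 h
    refine ⟨hz, (mem_surfaceTris_congr ?_).1 ht⟩
    by_cases h : t = z
    · rw [h]
    · exact facetOf_eq_of_adj ⟨h, e, he, hs, het, hz⟩

variable (c p) in
/-- Triangles of the surface at `v` that share a further corner, that is, that are adjacent in the
link of `v` in the surface. -/
def SurfaceAdj (v : E3) (a b : Finset E3) : Prop :=
  a ∈ c.surfaceTris p ∧ b ∈ c.surfaceTris p ∧ v ∈ a ∧ v ∈ b ∧ ∃ w, w ≠ v ∧ w ∈ a ∧ w ∈ b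

theorem reach_of_sheetOf_eq {v : E3} {t t' : trisAt F.K v} (ht : t.1.1 ∈ c.surfaceTris p)
    (h : sheetOf F.K v t = sheetOf F.K v t') :
    Relation.ReflTransGen (c.SurfaceAdj p v) t.1.1 t'.1.1 := by
  have hr := SimpleGraph.ConnectedComponent.exact h
  rw [SimpleGraph.reachable_iff_reflTransGen] at hr
  clear h
  have : Relation.ReflTransGen (c.SurfaceAdj p v) t.1.1 t'.1.1 ∧ t'.1.1 ∈ c.surfaceTris p := by
    induction hr with
    | refl => exact ⟨Relation.ReflTransGen.refl, ht⟩
    | @tail a b _ hab ih =>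
      obtain ⟨-, w, -, ha, hb⟩ := (induce_adj_iff _ _ _ _).1 hab
      have hbM : b.1.1 ∈ c.surfaceTris p := (mem_surfaceTris_congr (facetOf_eq_of_adj hab)).1 ih.2
      rw [Finset.mem_erase] at ha hb
      exact ⟨ih.1.tail ⟨ih.2, hbM, a.2, b.2, w, ha.1, ha.2, hb.2⟩, hbM⟩
  exact this.1

theorem reach_of_touches {v : E3} {e : Finset E3} (he : e ∈ seamEdgesAt F.K v)
    {t t' : trisAt F.K v} (ht : t.1.1 ∈ c.surfaceTris p) (ht' : t'.1.1 ∈ c.surfaceTris p)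
    (h : (sheetOf F.K v t).Touches e) (h' : (sheetOf F.K v t').Touches e) :
    Relation.ReflTransGen (c.SurfaceAdj p v) t.1.1 t'.1.1 := by
  obtain ⟨x, hx, hex⟩ := h
  obtain ⟨y, hy, hey⟩ := h'
  have hxM : x.1.1 ∈ c.surfaceTris p :=
    (mem_surfaceTris_congr (facetOf_eq_of_sheetOf_eq hx)).2 ht
  have hyM : y.1.1 ∈ c.surfaceTris p :=
    (mem_surfaceTris_congr (facetOf_eq_of_sheetOf_eq hy)).2 ht'
  obtain ⟨w, hw, rfl⟩ := exists_pair_of_mem_edges he.1.1 he.2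
  exact ((reach_of_sheetOf_eq ht hx.symm).tail
    ⟨hxM, hyM, x.2, y.2, w, hw, hex (by simp), hey (by simp)⟩).trans (reach_of_sheetOf_eq hyM hy)

/-- The link of a vertex in a bicolored surface is connected. In the case of a singular vertex, two
opposite sheets of the surface are joined by a third one, because the surface contains two of the
sheets at every seam that it meets. -/
theorem surface_link_connected {v : E3} {t t' : trisAt F.K v} (ht : t.1.1 ∈ c.surfaceTris p)
    (ht' : t'.1.1 ∈ c.surfaceTris p) :
    Relation.ReflTransGen (c.SurfaceAdj p v) t.1.1 t'.1.1 := by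
  have hvK : v ∈ F.K.vertices :=
    F.K.down_closed t.1.2.1 (Finset.singleton_subset_iff.2 t.2) (Finset.singleton_nonempty v)
  have LM := F.local_model v hvK
  by_cases hne : (seamEdgesAt F.K v).Nonempty
  swap
  · exact reach_of_sheetOf_eq ht
      (sheetOf_eq_of_regular_vertex hvK (fun e he hve => hne ⟨e, he, hve⟩) t t')
  by_cases hcommon : ∃ e, e ∈ touched (sheetOf F.K v t) ∧ e ∈ touched (sheetOf F.K v t')
  · obtain ⟨e, he, he'⟩ := hcommon
    exact reach_of_touches he.1 ht ht' he.2 he'.2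
  obtain ⟨e₁, e₂, h12, hσ⟩ := Set.ncard_eq_two.1 (ncard_touched hne (sheetOf F.K v t))
  obtain ⟨e₃, e₄, h34, hτ⟩ := Set.ncard_eq_two.1 (ncard_touched hne (sheetOf F.K v t'))
  have he₁ : e₁ ∈ touched (sheetOf F.K v t) := by simp [hσ]
  have he₂ : e₂ ∈ touched (sheetOf F.K v t) := by simp [hσ]
  have he₃ : e₃ ∈ touched (sheetOf F.K v t') := by simp [hτ]
  have he₄ : e₄ ∈ touched (sheetOf F.K v t') := by simp [hτ]
  have hdisj : ∀ e ∈ touched (sheetOf F.K v t), ∀ e' ∈ touched (sheetOf F.K v t'), e ≠ e' :=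
    fun e he e' he' h => hcommon ⟨e, he, h ▸ he'⟩
  have h4 : (seamEdgesAt F.K v).ncard = 4 := by
    have hsub : touched (sheetOf F.K v t) ∪ touched (sheetOf F.K v t') ⊆ seamEdgesAt F.K v := by
      rintro e (h | h) <;> exact h.1
    have hcard := Set.ncard_le_ncard hsub (seamEdgesAt_finite v)
    rw [Set.ncard_union_eq (Set.disjoint_left.2 fun e h h' => hdisj e h e h' rfl)
      ((seamEdgesAt_finite v).subset fun _ h => h.1) ((seamEdgesAt_finite v).subset fun _ h => h.1),
      ncard_touched hne, ncard_touched hne] at hcard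
    rcases LM.branch_count with h | h | h <;> omega
  -- the sheets at the seam `e₁` are the one of `t` and those that lead to `e₃` and `e₄`
  obtain ⟨μ, ⟨y, rfl, hy⟩, hμ⟩ := LM.complete h4 e₁ he₁.1 e₃ he₃.1 (hdisj _ he₁ _ he₃)
  obtain ⟨ν, ⟨z, rfl, hz⟩, hν⟩ := LM.complete h4 e₁ he₁.1 e₄ he₄.1 (hdisj _ he₁ _ he₄)
  obtain ⟨x, hx, hex⟩ := he₁.2
  have hxy : x.1 ≠ y.1 := fun h => hdisj e₃
    ⟨he₃.1, by rw [← hx, Subtype.ext h]; exact hμ⟩ _ he₃ rfl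
  have hxz : x.1 ≠ z.1 := fun h => hdisj e₄
    ⟨he₄.1, by rw [← hx, Subtype.ext h]; exact hν⟩ _ he₄ rfl
  have hyz : y.1 ≠ z.1 := by
    intro h
    have h3 : e₃ ∈ touched (sheetOf F.K v z) := ⟨he₃.1, by rw [← Subtype.ext h]; exact hμ⟩
    have := touched_eq ⟨he₁.1, z, rfl, hz⟩ h3 (hdisj _ he₁ _ he₃)
    have h4 : e₄ ∈ touched (sheetOf F.K v z) := ⟨he₄.1, hν⟩
    rw [this] at h4
    rcases h4 with h | h
    · exact hdisj _ he₁ _ he₄ h.symm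
    · exact h34 h.symm
  have htri : trisOn F.K e₁ = {x.1, y.1, z.1} := by
    refine (Set.eq_of_subset_of_ncard_le ?_ ?_ (Set.toFinite _)).symm
    · rintro s (rfl | rfl | rfl)
      exacts [hex, hy, hz]
    · rw [he₁.1.1.2, Set.ncard_eq_three.2 ⟨_, _, _, hxy, hxz, hyz, rfl⟩]
  have hseam := mem_surfaceTris_seam (c := c) (p := p) he₁.1.1 hxy hxz hyz htri
  have hxM : x.1.1 ∈ c.surfaceTris p := (mem_surfaceTris_congr (facetOf_eq_of_sheetOf_eq hx)).2 ht
  by_cases hyM : y.1.1 ∈ c.surfaceTris p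
  · exact (reach_of_touches he₁.1 ht hyM he₁.2 ⟨y, rfl, hy⟩).trans
      (reach_of_touches he₃.1 hyM ht' hμ he₃.2)
  · have hzM : z.1.1 ∈ c.surfaceTris p := hseam.2 fun h => hyM (h.1 hxM)
    exact (reach_of_touches he₁.1 ht hzM he₁.2 ⟨z, rfl, hz⟩).trans
      (reach_of_touches he₄.1 hzM ht' hν he₄.2)

variable (c)

theorem eulerChar_bicolored {i j : Fin 4} (hij : i < j) :
    eulerChar (c.bicolored i j) =
      (((c.surfaceTris (i, j)).biUnion id).card : ℤ) -
        (((c.surfaceTris (i, j)).biUnion (Finset.powersetCard 2)).card : ℤ) +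
        (c.surfaceTris (i, j)).card := by
  have hmem : ∀ s, s ∈ c.bicolored i j ↔ s.Nonempty ∧ ∃ t ∈ c.surfaceTris (i, j), s ⊆ t := by
    intro s
    constructor
    · rintro ⟨hs, t, hst, h⟩
      exact ⟨F.K.nonempty_of_mem_faces hs, t.1, mem_surfaceTris.2 ((mem_separated hij).2 h), hst⟩
    · rintro ⟨hs, t, ht, hst⟩
      obtain ⟨t, rfl⟩ := exists_tri_of_mem_surfaceTris ht
      exact ⟨F.K.down_closed t.2.1 hst hs, t, hst, (mem_separated hij).1 (mem_surfaceTris.1 ht)⟩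
  have h3 : ∀ t ∈ c.surfaceTris (i, j), t.card = 3 := by
    intro t ht
    obtain ⟨t, rfl⟩ := exists_tri_of_mem_surfaceTris ht
    exact t.2.2
  have hset : c.bicolored i j = ((((c.surfaceTris (i, j)).biUnion id).image (fun v => {v}) ∪
      (c.surfaceTris (i, j)).biUnion (Finset.powersetCard 2) ∪ c.surfaceTris (i, j) :
        Finset (Finset E3)) : Set (Finset E3)) := by
    ext s
    rw [hmem, Finset.mem_coe, Finset.mem_union, Finset.mem_union]
    simp only [Finset.mem_image, Finset.mem_biUnion, id, Finset.mem_powersetCard]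
    constructor
    · rintro ⟨hs, t, ht, hst⟩
      have h1 := hs.card_pos
      have h2 := Finset.card_le_card hst
      rw [h3 t ht] at h2
      rcases (show s.card = 1 ∨ s.card = 2 ∨ s.card = 3 by omega) with h | h | h
      · obtain ⟨v, rfl⟩ := Finset.card_eq_one.1 h
        exact Or.inl (Or.inl ⟨v, ⟨t, ht, Finset.singleton_subset_iff.1 hst⟩, rfl⟩)
      · exact Or.inl (Or.inr ⟨t, ht, hst, h⟩)
      · rw [Finset.eq_of_subset_of_card_le hst (by rw [h3 t ht, h])]
        exact Or.inr ht
    · rintro ((⟨v, ⟨t, ht, hv⟩, rfl⟩ | ⟨t, ht, hst, h⟩) | ht)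
      · exact ⟨Finset.singleton_nonempty v, t, ht, Finset.singleton_subset_iff.2 hv⟩
      · exact ⟨Finset.card_pos.1 (by omega), t, ht, hst⟩
      · exact ⟨Finset.card_pos.1 (by rw [h3 s ht]; norm_num), s, ht, subset_rfl⟩
  have c1 : ∀ s ∈ ((c.surfaceTris (i, j)).biUnion id).image fun v => ({v} : Finset E3),
      s.card = 1 := by
    intro s hs
    obtain ⟨v, -, rfl⟩ := Finset.mem_image.1 hs
    rfl
  have c2 : ∀ s ∈ (c.surfaceTris (i, j)).biUnion (Finset.powersetCard 2), s.card = 2 := by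
    intro s hs
    obtain ⟨t, -, hs⟩ := Finset.mem_biUnion.1 hs
    exact (Finset.mem_powersetCard.1 hs).2
  rw [eulerChar, hset, finsum_mem_coe_finset, Finset.sum_union, Finset.sum_union,
    Finset.sum_congr rfl fun s hs => by rw [c1 s hs],
    Finset.sum_congr (s₁ := (c.surfaceTris (i, j)).biUnion (Finset.powersetCard 2)) rfl
      fun s hs => by rw [c2 s hs],
    Finset.sum_congr (s₁ := c.surfaceTris (i, j)) rfl fun s hs => by rw [h3 s hs],
    Finset.sum_const, Finset.sum_const, Finset.sum_const,
    Finset.card_image_of_injective _ Finset.singleton_injective]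
  · simp only [nsmul_eq_mul]; ring
  · exact Finset.disjoint_left.2 fun s h h' => by
      have := c2 s h'
      rw [c1 s h] at this
      omega
  · refine Finset.disjoint_left.2 fun s h h' => ?_
    have := h3 s h'
    rcases Finset.mem_union.1 h with h | h
    · rw [c1 s h] at this; omega
    · rw [c2 s h] at this; omega

theorem even_eulerChar_bicolored {i j : Fin 4} (hij : i < j) :
    Even (eulerChar (c.bicolored i j)) := by
  rw [c.eulerChar_bicolored hij]
  refine even_eulerChar_of_closed_surface (K := F.K) ?_ ?_
    (fun t ht e he he2 => card_surfaceTris_edge ht he he2) ?_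
  · intro t ht
    obtain ⟨t, rfl⟩ := exists_tri_of_mem_surfaceTris ht
    exact t.2.1
  · intro t ht
    obtain ⟨t, rfl⟩ := exists_tri_of_mem_surfaceTris ht
    exact t.2.2
  · intro v t ht hv t' ht' hv'
    obtain ⟨t, rfl⟩ := exists_tri_of_mem_surfaceTris ht
    obtain ⟨t', rfl⟩ := exists_tri_of_mem_surfaceTris ht'
    exact surface_link_connected (t := ⟨t, hv⟩) (t' := ⟨t', hv'⟩) ht ht'

end Coloring

end Foam

end SL4

theorem mainTheorem11 (F : SL4.Foam) (c : F.Coloring) :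
    (F.dots = 0 →
      F.degree =
        - ∑ i : Fin 4, ∑ j ∈ Finset.Ioi i, SL4.eulerChar (c.bicolored i j)) ∧
    Even F.degree := by
  rw [c.degree_eq]
  refine ⟨fun h => by rw [h]; simp, Even.sub ?_ ?_⟩
  · rw [Multiset.sum_map_mul_left]
    exact even_two_mul _
  · exact Finset.even_sum _ fun i _ => Finset.even_sum _ fun j hj =>
      c.even_eulerChar_bicolored (Finset.mem_Ioi.1 hj)
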